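/- Conventions. For a graph $G$ and disjoint finite vertex sets $A,B$, write $d(X,Y)=e_G(X,Y)/(|X||Y|)$ for non-empty $X\subseteq A$, $Y\subseteq B$. The pair $(A,B)$ is $(\varepsilon,d)$-super-regular with respect to $G$ if $d(X,Y)\ge d$ for all $X\subseteq A$, $Y\subseteq B$ with $|X|\ge\varepsilon|A|$ and $|Y|\ge\varepsilon|B|$, every $a\in A$ has at least $d|B|$ neighbours in $B$, and every $b\in B$ has at least $d|A|$ neighbours in $A$. $G[U,V]$ denotes the bipartite graph of the edges of $G$ between $U$ and $V$, and $G(S,p)$ the binomial random graph on vertex set $S$, in which each pair of vertices is an edge independently with probability $p$. The square of a path $v_1,\dots,v_k$ has the edges $v_iv_j$ with $1\le|i-j|\le2$; its end-tuples are $(v_2,v_1)$ and $(v_{k-1},v_k)$. Lemma. For any $0<d<1$ there exist $\varepsilon>0$ and $C>0$ such that the following holds. Let $U,V$ be disjoint sets with $|V|=n$ and $\tfrac34 n\le|U|\le n$, and let $(U,V)$ be $(\varepsilon,d)$-super-regular with respect to a graph $G$. Let $x\ne x'$ be vertices of $V$ with at least $\tfrac12d^2n$ common neighbours in $U$, and let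 $y\ne y'$ be vertices of $U$ with at least $\tfrac12d^2n$ common neighbours in $V$ (with respect to $G$). Let $p\in[0,1]$ with $p\ge C/n$, and let $G(U,p)$ and $G(V,p)$ be independent random graphs. Then a.a.s. the graph $G[U,V]\cup G(U,p)\cup G(V,p)$ contains the square of a Hamilton path $v_1,\dots,v_k$ covering exactly $U\cup V$, with end-tuples $(v_2,v_1)=(x,x')$ and $(v_{k-1},v_k)=(y,y')$, in which the edges $xx'$ and $yy'$ are not required to be present. Here "a.a.s." means: with probability tending to $1$ as $n\to\infty$, uniformly in the other data; that is, for every $\eta>0$ there is $N=N(d,\varepsilon,C,\eta)$ such that for all $n\ge N$ and all $U,V,G,x,x',y,y',p$ as above the probability is at least $1-\eta$. -/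

import Mathlib

/-- The number of neighbours of `v` in the finite set `S`, in the graph `G`. -/
noncomputable def degInto {W : Type*} (G : SimpleGraph W) (v : W) (S : Finset W) : ℕ :=
  Set.ncard {w : W | w ∈ S ∧ G.Adj v w}

/-- The number of common neighbours of `v` and `v'` in the finite set `S`, in the graph `G`. -/
noncomputable def codegInto {W : Type*} (G : SimpleGraph W) (v v' : W) (S : Finset W) : ℕ :=
  Set.ncard {w : W | w ∈ S ∧ G.Adj v w ∧ G.Adj v' w}

open Classical in
/-- The pair `(A, B)` of disjoint vertex sets is `(ε, d)`-super-regular with respect to `G`: all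
`X ⊆ A`, `Y ⊆ B` with `|X| ≥ ε|A|` and `|Y| ≥ ε|B|` satisfy `e(X, Y) / (|X||Y|) ≥ d`, every vertex
of `A` has at least `d|B|` neighbours in `B`, and every vertex of `B` has at least `d|A|`
neighbours in `A`. -/
structure IsSuperRegular {W : Type*} (G : SimpleGraph W) (ε d : ℝ) (A B : Finset W) : Prop where
  disjoint : Disjoint A B
  density : ∀ X ⊆ A, ∀ Y ⊆ B, ε * (A.card : ℝ) ≤ (X.card : ℝ) → ε * (B.card : ℝ) ≤ (Y.card : ℝ) →
    d ≤ ((G.edgeDensity X Y : ℚ) : ℝ)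
  degree_left : ∀ a ∈ A, d * (B.card : ℝ) ≤ (degInto G a B : ℝ)
  degree_right : ∀ b ∈ B, d * (A.card : ℝ) ≤ (degInto G b A : ℝ)

/-- The list `l = v₁, …, v_k` of vertices of `H` spells the square of a Hamilton path on the vertex
set `S` with end-tuples `(x, x') = (v₂, v₁)` and `(y, y') = (v_{k-1}, v_k)`: the vertices
`v₁, …, v_k` are pairwise distinct, they are exactly the elements of `S`, and `v_i v_j` is an edge
of `H` whenever `1 ≤ j - i ≤ 2`, except that the edges `x x' = v₁ v₂` and `y y' = v_{k-1} v_k` are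
not required. (List positions start at `0`.) -/
structure IsSquareHamiltonPath {W : Type*} (H : SimpleGraph W) (S : Finset W) (x x' y y' : W)
    (l : List W) : Prop where
  nodup : l.Nodup
  mem_iff : ∀ w : W, w ∈ l ↔ w ∈ S
  ends : ∃ m : List W, l = [x', x] ++ m ++ [y, y']
  adj : ∀ (i j : ℕ) (hij : i < j) (hj : j < l.length), j ≤ i + 2 →
    ¬ (i = 0 ∧ j = 1) → ¬ (i + 2 = l.length ∧ j + 1 = l.length) →
    H.Adj (l[i]'(hij.trans hj)) (l[j]'hj)

/-- The graph `G[U, V] ∪ R ∪ S` on the ambient vertex type, where `G[U, V]` consists of the edges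
of `G` between `U` and `V`, the graph `R` has vertex set `U` and the graph `S` has vertex
set `V`. -/
def perturbedPair {W : Type*} (G : SimpleGraph W) (U V : Finset W)
    (R : SimpleGraph {w : W // w ∈ U}) (S : SimpleGraph {w : W // w ∈ V}) : SimpleGraph W :=
  G.between (U : Set W) (V : Set W) ⊔
    R.map (Function.Embedding.subtype fun w => w ∈ U) ⊔
    S.map (Function.Embedding.subtype fun w => w ∈ V)

/-- The joint law of the pair of independent binomial random graphs `G(U, p)`, `G(V, p)`. -/
noncomputable def randomPair {W : Type*} (U V : Finset W) (p : unitInterval) :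
    MeasureTheory.Measure (SimpleGraph {w : W // w ∈ U} × SimpleGraph {w : W // w ∈ V}) :=
  (SimpleGraph.binomialRandom {w : W // w ∈ U} p).prod
    (SimpleGraph.binomialRandom {w : W // w ∈ V} p)

/-! The random graphs only have to supply paths; all other edges of the square come from G. Take a
path f₀ f₁ f₂ … inside U on an even number of vertices, cut it into consecutive pairs, and insert a
vertex of V after every pair but the last: f₀ f₁ h₀ f₂ f₃ h₁ …. The square of this sequence uses the
path edges of f, and otherwise only G-edges from each inserted vertex to the four vertices around
it. Segments built on paths e in V, with vertices of U inserted, behave alike. The Hamilton path is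
x' x, then segments on U and V in turn, then y y'. Where two segments meet, only G-edges are needed.
So it suffices to find short paths ("chunks") in both classes, to order them so that neighbouring
chunks are completely joined in G, and to match the remaining vertices to the gaps between pairs.
`exists_isSquareHamiltonPath_of_robust` carries out this reduction.

For p ≥ C/n a random graph has, with high probability, a path missing few vertices, by depth first
search (`exists_path_of_bipartite_edge`). Cut it into blocks of K vertices. As the law of the graph
is invariant under permutations of the vertices, the blocks may be regarded as placed by a uniformly
random permutation (`exists_random_chunks`). From there on no random edges are exposed: permutations
are counted, and Markov's inequality for product weights (`card_perm_weight_le`) compares them with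
independent tuples.

Random chunks have two properties (`exists_robust_chunks`). For every large set T', all but a few
chunks have a positive proportion of T' as common neighbours; the failure probability for one T' is
small enough to beat the number of all sets T'. And each of linearly many prescribed boxes X₁ × … ×
X_K contains linearly many chunks. These yield the hypotheses of a robust Hall theorem
(`exists_bijective_of_robust`): minimum degree m on both sides and an edge between any two sets of
size m.

The two classes are treated in two rounds. First G(V,p) gives typical chunks e. With e fixed, their
typicality makes the relation between vertices of U and gaps of the sequence e lower regular again,
so Hall's theorem assigns chunks of G(U,p) to these gaps (`exists_matched_chunks`). Two more Hall
matchings insert the remaining vertices of U and of V. The segment lengths are chosen beforehand so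
that vertices and gaps agree in number. -/

/-! ### Permutation invariance of the binomial random graph. -/

open MeasureTheory in
instance measurableSingletonClass_simpleGraph {Z : Type*} [Finite Z] :
    MeasurableSingletonClass (SimpleGraph Z) where
  measurableSet_singleton G := by
    have : ({G} : Set (SimpleGraph Z)) = SimpleGraph.edgeSet ⁻¹' {G.edgeSet} := by
      ext H; simp
    rw [this]
    exact SimpleGraph.measurable_edgeSet (measurableSet_singleton _)

theorem binomialRandom_singleton_map {Z : Type*} [Finite Z] (p : unitInterval)
    (σ : Equiv.Perm Z) (G : SimpleGraph Z) :
    SimpleGraph.binomialRandom Z p {G.map σ} = SimpleGraph.binomialRandom Z p {G} := by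
  have : (G.map σ).edgeSet.ncard = G.edgeSet.ncard := by
    rw [show (G.map σ) = G.map σ.toEmbedding from rfl, SimpleGraph.edgeSet_map]
    exact Set.ncard_image_of_injective _ (Function.Embedding.injective _)
  simp [this]

/-- The law of a binomial random graph is invariant under permutations of the vertices, so its
measure of an event may be computed by averaging over all permutations. -/
theorem binomialRandom_real_ge_of_perm {Z : Type*} [Fintype Z] [DecidableEq Z] (p : unitInterval)
    (H E : Set (SimpleGraph Z)) (η : ℝ) (hη : 0 ≤ η)
    (h : ∀ G ∈ H, (Nat.card {σ : Equiv.Perm Z // G.map σ ∉ E} : ℝ) ≤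
      η * (Fintype.card Z).factorial) :
    (SimpleGraph.binomialRandom Z p).real H - η ≤ (SimpleGraph.binomialRandom Z p).real E := by
  classical
  have : Fintype (SimpleGraph Z) := Fintype.ofFinite _
  set μ := SimpleGraph.binomialRandom Z p
  have hsum : ∀ A : Set (SimpleGraph Z), μ.real A = ∑ G, if G ∈ A then μ.real {G} else 0 := by
    intro A
    rw [← Finset.sum_filter, MeasureTheory.sum_measureReal_singleton]
    simp
  have hperm : ∀ σ : Equiv.Perm Z, μ.real Eᶜ = ∑ G, if G.map σ ∉ E then μ.real {G} else 0 := by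
    intro σ
    rw [hsum]
    let e : SimpleGraph Z ≃ SimpleGraph Z := Equiv.ofBijective (fun G => G.map σ) (by
      have : Function.Injective (fun G : SimpleGraph Z => G.map σ) :=
        SimpleGraph.map_injective σ.toEmbedding
      exact Finite.injective_iff_bijective.mp this)
    rw [← e.sum_comp]
    refine Finset.sum_congr rfl fun G _ => ?_
    have : μ.real {G.map σ} = μ.real {G} := by
      simp only [MeasureTheory.measureReal_def, μ, binomialRandom_singleton_map]
    simp [e, this]
  -- Weighted double counting of the pairs (σ, G) with σG ∉ E. Below, a graph outside H is charged
  -- all permutations, a graph in H only the proportion η.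
  have h1 : (Fintype.card Z).factorial * μ.real Eᶜ =
      ∑ G, μ.real {G} * Nat.card {σ : Equiv.Perm Z // G.map σ ∉ E} := by
    have : ∑ σ : Equiv.Perm Z, μ.real Eᶜ =
        ∑ σ : Equiv.Perm Z, ∑ G, if G.map σ ∉ E then μ.real {G} else 0 :=
      Finset.sum_congr rfl fun σ _ => hperm σ
    rw [Finset.sum_comm] at this
    simp only [Finset.sum_const, Finset.card_univ, Fintype.card_perm, nsmul_eq_mul] at this
    rw [this]
    refine Finset.sum_congr rfl fun G _ => ?_
    rw [← Finset.sum_filter, Finset.sum_const, nsmul_eq_mul, mul_comm, Nat.card_eq_fintype_card,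
      Fintype.card_subtype]
  have hf : (0 : ℝ) < (Fintype.card Z).factorial := by positivity
  have h2 : ∑ G, μ.real {G} * Nat.card {σ : Equiv.Perm Z // G.map σ ∉ E} ≤
      ∑ G, ((if G ∈ Hᶜ then μ.real {G} else 0) * (Fintype.card Z).factorial +
        μ.real {G} * (η * (Fintype.card Z).factorial)) := by
    refine Finset.sum_le_sum fun G _ => ?_
    have hG : 0 ≤ μ.real {G} := MeasureTheory.measureReal_nonneg
    by_cases hGH : G ∈ H
    · simp only [Set.mem_compl_iff, hGH, not_true_eq_false, if_false, zero_mul, zero_add]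
      exact mul_le_mul_of_nonneg_left (h G hGH) hG
    · simp only [Set.mem_compl_iff, hGH, not_false_eq_true, if_true]
      have : (Nat.card {σ : Equiv.Perm Z // G.map σ ∉ E} : ℝ) ≤ (Fintype.card Z).factorial := by
        rw [← Fintype.card_perm, ← Nat.card_eq_fintype_card]
        exact_mod_cast Nat.card_le_card_of_injective _ Subtype.val_injective
      have h3 := mul_le_mul_of_nonneg_left this hG
      have : 0 ≤ μ.real {G} * (η * (Fintype.card Z).factorial) := by positivity
      linarith
  have hcompl : (∑ G, if G ∈ Hᶜ then μ.real {G} else 0) = μ.real Hᶜ := by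
    rw [hsum]
    exact Finset.sum_congr rfl fun G _ => by congr
  rw [← h1, Finset.sum_add_distrib, ← Finset.sum_mul, ← Finset.sum_mul, hcompl] at h2
  have h4 : ∑ G, μ.real {G} = 1 := by
    have := hsum Set.univ
    simp only [Set.mem_univ, if_true] at this
    rw [← this]; simp
  rw [h4] at h2
  have h5 : μ.real Eᶜ ≤ μ.real Hᶜ + η := by
    refine le_of_mul_le_mul_left ?_ hf
    linarith
  rw [MeasureTheory.probReal_compl_eq_one_sub (Set.toFinite _).measurableSet,
    MeasureTheory.probReal_compl_eq_one_sub (Set.toFinite _).measurableSet] at h5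
  linarith

/-! ### Long paths in a sparse random graph. -/

theorem binomialRandom_no_edges {Z : Type*} [Finite Z] (p : unitInterval)
    (F : Finset (Sym2 Z)) (hF : ∀ e ∈ F, ¬ e.IsDiag) :
    (SimpleGraph.binomialRandom Z p).real {G | ∀ e ∈ F, e ∉ G.edgeSet} ≤ (1 - (p : ℝ)) ^ F.card := by
  rw [MeasureTheory.measureReal_def, SimpleGraph.binomialRandom_apply]
  have hsub : ((fun (G : SimpleGraph Z) (e : Sym2 Z) => e ∈ G.edgeSet) ''
      {G | ∀ e ∈ F, e ∉ G.edgeSet}) ⊆ (F : Set (Sym2 Z)).pi fun _ => ({False} : Set Prop) := by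
    rintro _ ⟨G, hG, rfl⟩ e he
    simpa using hG e he
  refine ENNReal.toReal_le_of_le_ofReal (pow_nonneg (by linarith [p.2.2]) _) ?_
  refine (MeasureTheory.measure_mono hsub).trans ?_
  rw [MeasureTheory.Measure.infinitePi_pi]
  · rw [Finset.prod_congr rfl (g := fun _ => ENNReal.ofReal (1 - (p : ℝ)))]
    · rw [Finset.prod_const, ENNReal.ofReal_pow (by linarith [p.2.2])]
    · intro e he
      rw [MeasureTheory.Measure.add_apply, MeasureTheory.Measure.smul_apply,
        MeasureTheory.Measure.smul_apply, MeasureTheory.Measure.dirac_apply' _ (measurableSet_singleton _),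
        MeasureTheory.Measure.dirac_apply' _ (measurableSet_singleton _)]
      simp only [hF e he, not_false_eq_true, Set.indicator, Set.mem_singleton_iff, eq_iff_iff,
        iff_false, not_true_eq_false, if_false, if_true, smul_zero, zero_add, Pi.one_apply]
      rw [ENNReal.smul_def, smul_eq_mul, mul_one, ENNReal.ofReal]
      congr 1
      ext
      simp [unitInterval.coe_symm_eq, Real.coe_toNNReal _ (show (0 : ℝ) ≤ 1 - p by linarith [p.2.2])]
  · intro i _; exact measurableSet_singleton _

/-- Depth first search: if any two disjoint sets of `k` vertices are joined by an edge, then there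
is a path missing at most `2 * k` vertices. -/
theorem exists_path_of_bipartite_edge {Z : Type*} [Fintype Z] [DecidableEq Z] (G : SimpleGraph Z)
    (k : ℕ) (h : ∀ A B : Finset Z, Disjoint A B → A.card = k → B.card = k →
      ∃ a ∈ A, ∃ b ∈ B, G.Adj a b) :
    ∃ l : List Z, l.Nodup ∧ l.IsChain G.Adj ∧ Fintype.card Z ≤ l.length + 2 * k := by
  -- S holds the abandoned vertices, T the untouched ones, and l is the search stack with its top at
  -- the head. Every step lowers |T| - |S| by exactly one, so after |Z| steps the two sets have
  -- equal size, which must then be below k.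
  have key : ∀ j ≤ Fintype.card Z, ∃ (S T : Finset Z) (l : List Z), Disjoint S T ∧
      (∀ a ∈ l, a ∉ S ∧ a ∉ T) ∧ l.Nodup ∧ l.IsChain G.Adj ∧
      S.card + T.card + l.length = Fintype.card Z ∧ (∀ a ∈ S, ∀ b ∈ T, ¬ G.Adj a b) ∧
      T.card + j = Fintype.card Z + S.card := by
    intro j
    induction j with
    | zero => exact fun _ => ⟨∅, Finset.univ, [], by simp⟩
    | succ j ih =>
      intro hj
      obtain ⟨S, T, l, hST, hl, hnd, hch, hcard, hno, hbal⟩ := ih (by omega)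
      have hT : T.Nonempty := Finset.card_pos.mp (by omega)
      cases l with
      | nil =>
        obtain ⟨t, ht⟩ := hT
        refine ⟨S, T.erase t, [t], hST.mono_right (Finset.erase_subset _ _), ?_, by simp, by simp,
          ?_, fun a ha b hb => hno a ha b (Finset.mem_of_mem_erase hb), ?_⟩
        · simpa using Finset.disjoint_right.mp hST ht
        · rw [Finset.card_erase_of_mem ht]
          have := Finset.card_pos.mpr ⟨t, ht⟩
          simp at hcard ⊢; omega
        · rw [Finset.card_erase_of_mem ht]
          have := Finset.card_pos.mpr ⟨t, ht⟩
          omega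
      | cons a l =>
        by_cases hex : ∃ t ∈ T, G.Adj t a
        · obtain ⟨t, ht, hta⟩ := hex
          refine ⟨S, T.erase t, t :: a :: l, hST.mono_right (Finset.erase_subset _ _), ?_, ?_, ?_,
            ?_, fun a ha b hb => hno a ha b (Finset.mem_of_mem_erase hb), ?_⟩
          · intro b hb
            rcases List.mem_cons.mp hb with rfl | hb
            · simpa using Finset.disjoint_right.mp hST ht
            · exact ⟨(hl b hb).1, fun h' => (hl b hb).2 (Finset.mem_of_mem_erase h')⟩
          · exact List.nodup_cons.mpr ⟨fun h' => (hl t h').2 ht, hnd⟩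
          · exact List.isChain_cons_cons.mpr ⟨hta, hch⟩
          · rw [Finset.card_erase_of_mem ht]
            have := Finset.card_pos.mpr ⟨t, ht⟩
            simp at hcard ⊢; omega
          · rw [Finset.card_erase_of_mem ht]
            have := Finset.card_pos.mpr ⟨t, ht⟩
            omega
        · push Not at hex
          have ha := hl a (by simp)
          refine ⟨insert a S, T, l, ?_, ?_, (List.nodup_cons.mp hnd).2, hch.tail, ?_, ?_, ?_⟩
          · exact Finset.disjoint_insert_left.mpr ⟨ha.2, hST⟩
          · intro b hb
            refine ⟨?_, (hl b (by simp [hb])).2⟩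
            rw [Finset.mem_insert, not_or]
            refine ⟨?_, (hl b (by simp [hb])).1⟩
            rintro rfl
            exact (List.nodup_cons.mp hnd).1 hb
          · rw [Finset.card_insert_of_notMem ha.1]
            simp at hcard ⊢; omega
          · intro b hb c hc
            rcases Finset.mem_insert.mp hb with rfl | hb
            · exact fun h' => hex c hc h'.symm
            · exact hno b hb c hc
          · rw [Finset.card_insert_of_notMem ha.1]; omega
  obtain ⟨S, T, l, hST, -, hnd, hch, hcard, hno, hbal⟩ := key _ le_rfl
  refine ⟨l, hnd, hch, ?_⟩
  by_contra hlt
  obtain ⟨A, hA, hAk⟩ := Finset.exists_subset_card_eq (show k ≤ S.card by omega)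
  obtain ⟨B, hB, hBk⟩ := Finset.exists_subset_card_eq (show k ≤ T.card by omega)
  obtain ⟨a, ha, b, hb, hab⟩ := h A B (hST.mono hA hB) hAk hBk
  exact hno a (hA ha) b (hB hb) hab

/-- Union bound over the at most 4^|Z| pairs of disjoint k-sets: each of them spans no edge with
probability at most (1-p)^(k²), and if every pair spans an edge, depth first search finds the path.
-/
theorem binomialRandom_long_path {Z : Type*} [Fintype Z] [DecidableEq Z] (p : unitInterval)
    (k : ℕ) :
    1 - 4 ^ (Fintype.card Z) * (1 - (p : ℝ)) ^ (k * k) ≤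
      (SimpleGraph.binomialRandom Z p).real
        {G | ∃ l : List Z, l.Nodup ∧ l.IsChain G.Adj ∧ Fintype.card Z ≤ l.length + 2 * k} := by
  classical
  set μ := SimpleGraph.binomialRandom Z p
  set E : Set (SimpleGraph Z) :=
    {G | ∃ l : List Z, l.Nodup ∧ l.IsChain G.Adj ∧ Fintype.card Z ≤ l.length + 2 * k}
  let P : Finset (Finset Z × Finset Z) :=
    Finset.univ.filter fun q => Disjoint q.1 q.2 ∧ q.1.card = k ∧ q.2.card = k
  let F : Finset Z × Finset Z → Finset (Sym2 Z) := fun q => (q.1 ×ˢ q.2).image fun c => s(c.1, c.2)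
  have hsub : Eᶜ ⊆ ⋃ q ∈ P, {G | ∀ e ∈ F q, e ∉ G.edgeSet} := by
    intro G hG
    by_contra hcon
    refine hG (exists_path_of_bipartite_edge G k fun A B hAB hA hB => ?_)
    by_contra hno
    push Not at hno
    refine hcon (Set.mem_biUnion (x := (A, B)) (by simp [P, hAB, hA, hB]) ?_)
    intro e he
    simp only [F, Finset.mem_image, Finset.mem_product, Prod.exists] at he
    obtain ⟨a, b, ⟨ha, hb⟩, rfl⟩ := he
    exact hno a ha b hb
  have hle : μ.real Eᶜ ≤ ∑ q ∈ P, (1 - (p : ℝ)) ^ (k * k) := by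
    refine (MeasureTheory.measureReal_mono hsub (MeasureTheory.measure_ne_top _ _)).trans
      ((MeasureTheory.measureReal_biUnion_finset_le _ _).trans (Finset.sum_le_sum fun q hq => ?_))
    obtain ⟨hd, h1, h2⟩ := (Finset.mem_filter.mp hq).2
    have hcard : (F q).card = k * k := by
      rw [Finset.card_image_of_injOn, Finset.card_product, h1, h2]
      rintro ⟨a, b⟩ hab ⟨a', b'⟩ hab' heq
      simp only [Finset.coe_product, Set.mem_prod, Finset.mem_coe] at hab hab'
      rcases Sym2.eq_iff.mp heq with ⟨rfl, rfl⟩ | ⟨h3, h4⟩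
      · rfl
      · have h3 : a = b' := h3
        exact absurd (h3 ▸ hab.1) (Finset.disjoint_right.mp hd hab'.2)
    rw [← hcard]
    refine binomialRandom_no_edges p (F q) fun e he => ?_
    simp only [F, Finset.mem_image, Finset.mem_product, Prod.exists] at he
    obtain ⟨a, b, ⟨ha, hb⟩, rfl⟩ := he
    rw [Sym2.mk_isDiag_iff]
    rintro rfl
    exact Finset.disjoint_left.mp hd ha hb
  have hP : (P.card : ℝ) ≤ 4 ^ Fintype.card Z := by
    have : P.card ≤ 2 ^ Fintype.card Z * 2 ^ Fintype.card Z := by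
      refine (Finset.card_le_univ _).trans ?_
      simp
    rw [← mul_pow] at this
    exact_mod_cast this
  rw [Finset.sum_const, nsmul_eq_mul] at hle
  have h3 : (P.card : ℝ) * (1 - (p : ℝ)) ^ (k * k) ≤ 4 ^ Fintype.card Z * (1 - (p : ℝ)) ^ (k * k) :=
    mul_le_mul_of_nonneg_right hP (pow_nonneg (by linarith [p.2.2]) _)
  rw [MeasureTheory.probReal_compl_eq_one_sub (Set.toFinite _).measurableSet] at hle
  linarith

/-! ### Cutting the long path into uniformly placed chunks. -/

/-- A random graph with edge probability at least `C / z` contains a family of disjoint paths on `K`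
vertices which avoids any property of uniformly random families that is unlikely. -/
theorem exists_random_chunks (δ : ℝ) (hδ : 0 < δ) :
    ∃ C : ℝ, 0 < C ∧ ∀ η : ℝ, 0 < η → ∃ z₀ : ℕ, ∀ (Z : Type*) [Fintype Z] [DecidableEq Z],
      z₀ ≤ Fintype.card Z → ∀ p : unitInterval, C / (Fintype.card Z : ℝ) ≤ p →
      ∀ N K : ℕ, (N * K : ℝ) ≤ (1 - δ) * Fintype.card Z →
      ∀ Bad : Set (Fin N → Fin K → Z),
      (∀ b : Fin N → Fin K → Z, Function.Injective (fun q : Fin N × Fin K => b q.1 q.2) →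
        (Nat.card {σ : Equiv.Perm Z // (fun j i => σ (b j i)) ∈ Bad} : ℝ) ≤
          η / 2 * (Fintype.card Z).factorial) →
      1 - η ≤ (SimpleGraph.binomialRandom Z p).real {G | ∃ φ : Fin N → Fin K → Z,
        Function.Injective (fun q : Fin N × Fin K => φ q.1 q.2) ∧
        (∀ j (i i' : Fin K), (i : ℕ) + 1 = i' → G.Adj (φ j i) (φ j i')) ∧ φ ∉ Bad} := by
  -- With k between δz/4 and δz/2 the path misses at most 2k ≤ δz vertices, and 48/δ² makes k²p ≥
  -- 3z. Then e^(-3z) beats 4^z ≤ e^(2z).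
  refine ⟨48 / δ ^ 2, by positivity, fun η hη => ?_⟩
  obtain ⟨z₁, hz₁⟩ := exists_nat_ge (4 / δ)
  obtain ⟨z₂, hz₂⟩ := exists_nat_ge (2 / η)
  refine ⟨z₁ + z₂ + 1, fun Z _ _ hZ p hp N K hNK Bad hBad => ?_⟩
  set z := Fintype.card Z
  have hz0 : (0 : ℝ) < z := by
    have : 0 < z := by omega
    exact_mod_cast this
  have hz1 : 4 ≤ δ * z := by
    have : (z₁ : ℝ) ≤ z := by exact_mod_cast (by omega)
    rw [div_le_iff₀ hδ] at hz₁
    nlinarith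
  set k := ⌊δ * z / 2⌋₊
  have hk1 : (k : ℝ) ≤ δ * z / 2 := Nat.floor_le (by positivity)
  have hk2 : δ * z / 4 ≤ k := by
    have := Nat.lt_floor_add_one (δ * z / 2)
    have h2 : δ * z / 2 < k + 1 := this
    linarith
  set H : Set (SimpleGraph Z) :=
    {G | ∃ l : List Z, l.Nodup ∧ l.IsChain G.Adj ∧ z ≤ l.length + 2 * k}
  have hH : 1 - η / 2 ≤ (SimpleGraph.binomialRandom Z p).real H := by
    refine le_trans ?_ (binomialRandom_long_path p k)
    have hp0 : 0 ≤ 1 - (p : ℝ) := by linarith [p.2.2]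
    have h1 : (1 - (p : ℝ)) ^ (k * k) ≤ Real.exp (-(3 * z)) := by
      have h2 : 1 - (p : ℝ) ≤ Real.exp (-p) := by
        have := Real.add_one_le_exp (-(p : ℝ)); linarith
      refine (pow_le_pow_left₀ hp0 h2 _).trans ?_
      rw [← Real.exp_nat_mul]
      refine Real.exp_le_exp.mpr ?_
      have h3 : (δ * z / 4) * (δ * z / 4) ≤ (k : ℝ) * k :=
        mul_le_mul hk2 hk2 (by positivity) (by positivity)
      have h4 : (3 : ℝ) * z ≤ (k * k) * p := by
        calc (3 : ℝ) * z = (δ * z / 4) * (δ * z / 4) * (48 / δ ^ 2 / z) := by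
              field_simp; norm_num
          _ ≤ (k * k) * p := mul_le_mul h3 hp (by positivity) (by positivity)
      push_cast
      linarith
    have h4 : (4 : ℝ) ^ z ≤ Real.exp (2 * z) := by
      have : (4 : ℝ) ≤ Real.exp 2 := by
        have := Real.add_one_le_exp (1 : ℝ)
        rw [show (2 : ℝ) = 1 + 1 by norm_num, Real.exp_add]
        nlinarith
      rw [mul_comm, Real.exp_nat_mul]
      exact pow_le_pow_left₀ (by norm_num) this _
    have h5 : Real.exp (-(z : ℝ)) ≤ η / 2 := by
      have h6 : (z₂ : ℝ) ≤ z := by exact_mod_cast (by omega)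
      have h7 : 2 / η ≤ Real.exp z := by
        have := Real.add_one_le_exp (z : ℝ); linarith
      rw [Real.exp_neg, inv_le_comm₀ (Real.exp_pos _) (by positivity), inv_div]
      exact h7
    have h8 : (4 : ℝ) ^ z * (1 - (p : ℝ)) ^ (k * k) ≤ Real.exp (2 * z) * Real.exp (-(3 * z)) :=
      mul_le_mul h4 h1 (pow_nonneg hp0 _) (Real.exp_pos _).le
    rw [← Real.exp_add, show (2 * z + -(3 * z) : ℝ) = -z by ring] at h8
    linarith
  have := binomialRandom_real_ge_of_perm p H {G | ∃ φ : Fin N → Fin K → Z,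
        Function.Injective (fun q : Fin N × Fin K => φ q.1 q.2) ∧
        (∀ j (i i' : Fin K), (i : ℕ) + 1 = i' → G.Adj (φ j i) (φ j i')) ∧ φ ∉ Bad} (η / 2)
        (by positivity) ?_
  · linarith
  · rintro G ⟨l, hnd, hch, hlen⟩
    have hNKl : N * K ≤ l.length := by
      have h1 : (z : ℝ) ≤ l.length + 2 * k := by exact_mod_cast hlen
      have : (N * K : ℝ) ≤ l.length := by nlinarith
      exact_mod_cast this
    have hidx : ∀ q : Fin N × Fin K, (q.1 : ℕ) * K + q.2 < l.length := by
      rintro ⟨j, i⟩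
      have : ((j : ℕ) + 1) * K ≤ N * K := Nat.mul_le_mul_right _ j.2
      have := i.2
      simp only
      nlinarith
    let b : Fin N → Fin K → Z := fun j i => l[(j : ℕ) * K + i]'(hidx (j, i))
    have hb : Function.Injective (fun q : Fin N × Fin K => b q.1 q.2) := by
      rintro ⟨j, i⟩ ⟨j', i'⟩ h
      have h1 : (j : ℕ) * K + i = j' * K + i' := (List.Nodup.getElem_inj_iff hnd).mp h
      have hK : 0 < K := i.pos
      have h2 : (i : ℕ) = i' := by
        have := congrArg (· % K) h1
        simpa [Nat.add_mod, Nat.mod_eq_of_lt i.2, Nat.mod_eq_of_lt i'.2] using this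
      have h3 : (j : ℕ) = j' := by
        rw [h2] at h1
        exact Nat.eq_of_mul_eq_mul_right hK (by omega)
      exact Prod.ext (Fin.ext h3) (Fin.ext h2)
    have hcb : ∀ j (i i' : Fin K), (i : ℕ) + 1 = i' → G.Adj (b j i) (b j i') := by
      intro j i i' hi
      have h1 := hidx (j, i')
      have := List.isChain_iff_getElem.mp hch ((j : ℕ) * K + i) (by simp only at h1; omega)
      simp only [b, ← hi]
      exact this
    refine le_trans ?_ (hBad b hb)
    refine Nat.cast_le.mpr (Nat.card_le_card_of_injective
      (fun σ => ⟨σ.1, by_contra fun hn => σ.2 ⟨fun j i => σ.1 (b j i), ?_, ?_, hn⟩⟩) ?_)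
    · exact σ.1.injective.comp hb
    · intro j i i' hi
      exact (SimpleGraph.map_adj σ.1.toEmbedding G _ _).mpr ⟨_, _, hcb j i i' hi, rfl, rfl⟩
    · intro σ σ' h
      exact Subtype.ext (congrArg (fun q => q.1) h)

/-! ### Counting permutations and Markov's inequality. -/

/-- If some σ₀ extends the prescription, every other such permutation is σ₀ composed with one fixing
the range of b pointwise. -/
theorem card_perm_extending_le {I Z : Type*} [Fintype I] [Fintype Z] [DecidableEq Z]
    (b : I → Z) (hb : Function.Injective b) (f : I → Z) :
    Nat.card {σ : Equiv.Perm Z // σ ∘ b = f} ≤ (Fintype.card Z - Fintype.card I).factorial := by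
  classical
  by_cases hex : ∃ σ₀ : Equiv.Perm Z, σ₀ ∘ b = f
  · obtain ⟨σ₀, rfl⟩ := hex
    have h1 : Nat.card (Equiv.Perm {z // z ∉ Set.range b}) =
        (Fintype.card Z - Fintype.card I).factorial := by
      rw [Nat.card_eq_fintype_card, Fintype.card_perm, Fintype.card_subtype_compl]
      congr 2
      exact Set.card_range_of_injective hb
    rw [← h1, Nat.card_congr (Equiv.Perm.subtypeEquivSubtypePerm _)]
    refine Nat.card_le_card_of_injective (fun σ => ⟨σ₀⁻¹ * σ.1, ?_⟩) ?_
    · intro z hz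
      rw [not_not] at hz
      obtain ⟨i, rfl⟩ := hz
      have : σ.1 (b i) = σ₀ (b i) := congrFun σ.2 i
      simp [this]
    · intro σ σ' h
      have := congrArg Subtype.val h
      exact Subtype.ext (mul_left_cancel this)
  · have : IsEmpty {σ : Equiv.Perm Z // σ ∘ b = f} := ⟨fun σ => hex ⟨σ.1, σ.2⟩⟩
    simp

/-- The number of permutations mapping a given injective family into `P`, compared with the number
of all families in `P`. -/
theorem card_perm_mem_le {I Z : Type*} [Fintype I] [Fintype Z] [DecidableEq Z]
    (b : I → Z) (hb : Function.Injective b) (P : Set (I → Z)) :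
    Nat.card {σ : Equiv.Perm Z // σ ∘ b ∈ P} ≤
      P.ncard * (Fintype.card Z - Fintype.card I).factorial := by
  classical
  let e : {σ : Equiv.Perm Z // σ ∘ b ∈ P} → Σ f : P, {σ : Equiv.Perm Z // σ ∘ b = f.1} :=
    fun σ => ⟨⟨_, σ.2⟩, ⟨σ.1, rfl⟩⟩
  have he : Function.Injective e := fun σ σ' h =>
    Subtype.ext (congrArg (fun q : Σ f : P, {σ : Equiv.Perm Z // σ ∘ b = f.1} => q.2.1) h)
  refine (Nat.card_le_card_of_injective e he).trans ?_
  rw [Nat.card_sigma]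
  refine (Finset.sum_le_card_nsmul _ _ _ fun f _ => card_perm_extending_le b hb f.1).trans ?_
  rw [smul_eq_mul, Finset.card_univ, ← Nat.card_eq_fintype_card, Nat.card_coe_set_eq]

/-- Markov's inequality for product weights on families of independent `K`-tuples, transferred to a
uniformly random permutation. -/
theorem card_perm_weight_le {Z : Type*} [Fintype Z] [DecidableEq Z] (hz : 0 < Fintype.card Z)
    {J : Type*} [Fintype J]
    (K : ℕ) (b : J → Fin K → Z) (hb : Function.Injective (fun q : J × Fin K => b q.1 q.2))
    (w : (Fin K → Z) → ℝ) (hw : ∀ h, 0 ≤ w h) (P : Set (J → Fin K → Z)) (θ : ℝ) (hθ : 0 < θ)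
    (hP : ∀ φ ∈ P, θ ≤ ∏ j, w (φ j)) (κ : ℝ) (hκ : 0 < κ)
    (hK : (Fintype.card J * K : ℝ) ≤ (1 - κ) * Fintype.card Z) :
    (Nat.card {σ : Equiv.Perm Z // (fun j i => σ (b j i)) ∈ P} : ℝ) ≤
      (((∑ h, w h) / (κ * Fintype.card Z) ^ K) ^ Fintype.card J / θ) *
        (Fintype.card Z).factorial := by
  classical
  set z := Fintype.card Z
  have hz' : (0 : ℝ) < z := by exact_mod_cast hz
  let P' : Set (J × Fin K → Z) := {g | (fun j i => g (j, i)) ∈ P}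
  have h1 := card_perm_mem_le (fun q : J × Fin K => b q.1 q.2) hb P'
  -- The power of the sum expands into a sum over all families of tuples, including those with
  -- repeated vertices. Each family in P contributes at least θ.
  have h2 : (P'.ncard : ℝ) * θ ≤ (∑ h, w h) ^ Fintype.card J := by
    have hc : (∑ h, w h) ^ Fintype.card J = ∑ φ : J → Fin K → Z, ∏ j, w (φ j) := by
      rw [← Finset.card_univ, ← Finset.prod_const, Finset.prod_univ_sum, Fintype.piFinset_univ]
    have hn : P'.ncard = P.ncard :=
      Set.ncard_congr (fun g _ => fun j i => g (j, i)) (fun g hg => hg)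
        (fun g g' _ _ h => by
          funext q
          exact congrFun (congrFun h q.1) q.2)
        (fun φ hφ => ⟨fun q => φ q.1 q.2, hφ, rfl⟩)
    rw [hc, hn, Set.ncard_eq_toFinset_card', ← nsmul_eq_mul, ← Finset.sum_const]
    refine (Finset.sum_le_sum fun φ hφ => hP φ (Set.mem_toFinset.mp hφ)).trans ?_
    exact Finset.sum_le_sum_of_subset_of_nonneg (Finset.subset_univ _)
      fun φ _ _ => Finset.prod_nonneg fun j _ => hw _
  set k := Fintype.card J * K
  have hkz : (k : ℝ) ≤ (1 - κ) * z := by push_cast [k]; exact hK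
  have hkz' : k ≤ z := by
    have : (k : ℝ) ≤ z := by nlinarith
    exact_mod_cast this
  -- The price of sampling without replacement: while k positions are filled, at least κz vertices
  -- remain free, so each position costs at most a factor 1/κ against independent sampling.
  have h3 : (κ * z) ^ k ≤ (z.descFactorial k : ℝ) := by
    have := Nat.pow_sub_le_descFactorial z k
    have h4 : ((z + 1 - k : ℕ) : ℝ) ^ k ≤ z.descFactorial k := by exact_mod_cast this
    refine le_trans (pow_le_pow_left₀ (by positivity) ?_ _) h4
    rw [Nat.cast_sub (by omega)]
    push_cast
    linarith
  have h4 := Nat.factorial_mul_descFactorial hkz'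
  have h5 : ((z - k).factorial : ℝ) * (κ * z) ^ k ≤ z.factorial := by
    rw [← h4]; push_cast
    exact mul_le_mul_of_nonneg_left h3 (by positivity)
  have hS : 0 ≤ ∑ h, w h := Finset.sum_nonneg fun h _ => hw h
  rw [div_pow, ← pow_mul, mul_comm K]
  have h6 : (Nat.card {σ : Equiv.Perm Z // (fun j i => σ (b j i)) ∈ P} : ℝ) ≤
      P'.ncard * (z - k).factorial := by
    have : Fintype.card (J × Fin K) = k := by simp [k]
    rw [this] at h1
    exact_mod_cast h1
  refine h6.trans ?_
  have hpos : 0 < (κ * z) ^ k := by positivity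
  rw [div_div, div_mul_eq_mul_div, le_div_iff₀ (by positivity)]
  calc (P'.ncard : ℝ) * (z - k).factorial * ((κ * z) ^ k * θ)
      = (P'.ncard * θ) * ((z - k).factorial * (κ * z) ^ k) := by ring
    _ ≤ _ := mul_le_mul h2 h5 (by positivity) (by positivity)

/-! ### Lower regularity and typical tuples. -/

open Classical in
/-- The elements of `T'` related to all entries of the tuple `h`, where the relation may depend on
the position. -/
noncomputable def commonRel {Z T : Type*} {K : ℕ} (Rel : Fin K → Z → T → Prop) (T' : Finset T)
    (h : Fin K → Z) : Finset T :=
  T'.filter fun t => ∀ i, Rel i (h i) t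

open Classical in
/-- For every large set `T'`, few elements of `Z` are related to less than a proportion `d`
of `T'`. -/
def IsLowerRegular {Z T : Type*} [Fintype Z] [Fintype T] (R : Z → T → Prop) (ε d : ℝ) : Prop :=
  ∀ T' : Finset T, ε * Fintype.card T ≤ T'.card →
    ((Finset.univ.filter fun z => ((T'.filter fun t => R z t).card : ℝ) < d * T'.card).card : ℝ) ≤
      ε * Fintype.card Z

theorem IsLowerRegular.mono {Z T : Type*} [Fintype Z] [Fintype T] {R : Z → T → Prop} {ε ε' d : ℝ}
    (h : IsLowerRegular R ε d) (hε : ε ≤ ε') : IsLowerRegular R ε' d := fun T' hT' =>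
  (h T' ((mul_le_mul_of_nonneg_right hε (Nat.cast_nonneg _)).trans hT')).trans
    (mul_le_mul_of_nonneg_right hε (Nat.cast_nonneg _))

-- The entries are chosen one at a time. As long as the current candidate set is large, at most a
-- proportion ε of the choices shrinks it by a factor below d. The size condition on T' keeps it
-- above ε|T| throughout, and the K possible first failures add up to Kε.
open Classical in
theorem card_bad_tuples_le {Z T : Type*} [Fintype Z] [Fintype T] {ε d : ℝ} (hd0 : 0 ≤ d)
    (hd1 : d ≤ 1) (hε : 0 ≤ ε) {K : ℕ} (Rel : Fin K → Z → T → Prop)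
    (hR : ∀ i, IsLowerRegular (Rel i) ε d) (T' : Finset T)
    (hT' : ε * Fintype.card T ≤ d ^ K * T'.card) :
    ((Finset.univ.filter fun h : Fin K → Z =>
      ((commonRel Rel T' h).card : ℝ) < d ^ K * T'.card).card : ℝ) ≤
        K * ε * (Fintype.card Z : ℝ) ^ K := by
  induction K generalizing T' with
  | zero =>
    have : (Finset.univ.filter fun h : Fin 0 → Z =>
      ((commonRel Rel T' h).card : ℝ) < d ^ 0 * T'.card) = ∅ := by
      ext h; simp [commonRel]
    rw [this]; simp
  | succ K ih =>
    set z := Fintype.card Z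
    have hT'0 : (0 : ℝ) ≤ T'.card := Nat.cast_nonneg _
    have hdK : d ^ K ≤ 1 := pow_le_one₀ hd0 hd1
    let B : Finset Z := Finset.univ.filter fun z =>
      ((T'.filter fun t => Rel 0 z t).card : ℝ) < d * T'.card
    have hB : (B.card : ℝ) ≤ ε * z := by
      refine hR 0 T' (hT'.trans ?_)
      have : d ^ (K + 1) ≤ 1 := pow_le_one₀ hd0 hd1
      nlinarith
    have hsplit : ((Finset.univ.filter fun h : Fin (K + 1) → Z =>
        ((commonRel Rel T' h).card : ℝ) < d ^ (K + 1) * T'.card).card : ℝ) =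
        ∑ a : Z, ((Finset.univ.filter fun h : Fin K → Z =>
          ((commonRel Rel T' (Fin.cons a h : Fin (K + 1) → Z)).card : ℝ) <
            d ^ (K + 1) * T'.card).card : ℝ) := by
      simp only [Finset.card_filter, Nat.cast_sum]
      rw [← (Fin.consEquiv fun _ : Fin (K + 1) => Z).sum_comp, Fintype.sum_prod_type]
      rfl
    rw [hsplit]
    have hterm : ∀ a : Z, ((Finset.univ.filter fun h : Fin K → Z =>
          ((commonRel Rel T' (Fin.cons a h : Fin (K + 1) → Z)).card : ℝ) <
            d ^ (K + 1) * T'.card).card : ℝ) ≤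
          (if a ∈ B then (z : ℝ) ^ K else 0) + K * ε * (z : ℝ) ^ K := by
      intro a
      by_cases ha : a ∈ B
      · rw [if_pos ha]
        have : (Finset.univ.filter fun h : Fin K → Z =>
          ((commonRel Rel T' (Fin.cons a h : Fin (K + 1) → Z)).card : ℝ) <
            d ^ (K + 1) * T'.card).card ≤ z ^ K := by
          refine (Finset.card_le_univ _).trans ?_
          simp [z]
        have h2 : 0 ≤ K * ε * (z : ℝ) ^ K := by positivity
        have h3 : ((Finset.univ.filter fun h : Fin K → Z =>
          ((commonRel Rel T' (Fin.cons a h : Fin (K + 1) → Z)).card : ℝ) <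
            d ^ (K + 1) * T'.card).card : ℝ) ≤ (z : ℝ) ^ K := by exact_mod_cast this
        linarith
      · rw [if_neg ha, zero_add]
        have ha' : d * T'.card ≤ ((T'.filter fun t => Rel 0 a t).card : ℝ) := by
          simpa [B] using ha
        have h1 : d ^ (K + 1) * T'.card ≤ d ^ K * ((T'.filter fun t => Rel 0 a t).card : ℝ) := by
          rw [pow_succ, mul_assoc]
          exact mul_le_mul_of_nonneg_left ha' (by positivity)
        refine le_trans ?_ (ih (fun i => Rel i.succ) (fun i => hR i.succ)
          (T'.filter fun t => Rel 0 a t) (hT'.trans h1))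
        refine Nat.cast_le.mpr (Finset.card_le_card fun h hh => ?_)
        simp only [Finset.mem_filter, Finset.mem_univ, true_and] at hh ⊢
        refine lt_of_lt_of_le ?_ h1
        refine lt_of_le_of_lt (Nat.cast_le.mpr (Finset.card_le_card fun t ht => ?_)) hh
        simp only [commonRel, Finset.mem_filter, Fin.forall_fin_succ, Fin.cons_zero,
          Fin.cons_succ] at ht ⊢
        exact ⟨ht.1.1, ht.1.2, ht.2⟩
    refine (Finset.sum_le_sum fun a _ => hterm a).trans ?_
    rw [Finset.sum_add_distrib, ← Finset.sum_filter, Finset.sum_const, Finset.sum_const,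
      Finset.filter_mem_eq_inter, Finset.univ_inter, Finset.card_univ, nsmul_eq_mul, nsmul_eq_mul]
    have := mul_le_mul_of_nonneg_right hB (show (0 : ℝ) ≤ (z : ℝ) ^ K by positivity)
    push_cast
    calc _ ≤ ε * z * (z : ℝ) ^ K + z * (K * ε * (z : ℝ) ^ K) := by gcongr
      _ = _ := by ring

-- For fixed T', give bad tuples weight M and all others weight 1. Bad tuples are so rare that the
-- mean weight is at most 2, so the moment is at most (2/κ)^z. More than γz bad chunks force weight
-- M^(γz) = (16/κ)^z. This leaves probability 8^(-z), small enough for a union over at most 4^z sets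
-- T'.
open Classical in
theorem card_perm_common_nbrs_le (K : ℕ) (hK0 : 0 < K) (d c γ κ : ℝ) (hd0 : 0 < d) (hd1 : d ≤ 1)
    (hc : 0 < c) (hγ : 0 < γ) (hκ : 0 < κ) (hκ1 : κ ≤ 1) :
    ∃ ε : ℝ, 0 < ε ∧ ∀ (Z T : Type*) [Fintype Z] [Fintype T], 0 < Fintype.card Z →
      Fintype.card T ≤ 2 * Fintype.card Z → ∀ (Rel : Fin K → Z → T → Prop),
      (∀ i, IsLowerRegular (Rel i) ε d) → ∀ (N : ℕ), (N * K : ℝ) ≤ (1 - κ) * Fintype.card Z →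
      ∀ b : Fin N → Fin K → Z, Function.Injective (fun q : Fin N × Fin K => b q.1 q.2) →
      (Nat.card {σ : Equiv.Perm Z // ∃ T' : Finset T, c * Fintype.card T ≤ T'.card ∧
        γ * Fintype.card Z < ((Finset.univ.filter fun j =>
          ((commonRel Rel T' (fun i => σ (b j i))).card : ℝ) < d ^ K * T'.card).card : ℝ)} : ℝ) ≤
      (1 / 2) ^ Fintype.card Z * (Fintype.card Z).factorial := by
  set M : ℝ := (16 / κ) ^ (1 / γ)
  have hMb : 1 ≤ 16 / κ := by rw [le_div_iff₀ hκ]; linarith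
  have hM1 : 1 ≤ M := Real.one_le_rpow hMb (by positivity)
  have hM0 : 0 < M := by linarith
  have hMγ : M ^ γ = 16 / κ := by
    rw [← Real.rpow_mul (by positivity), one_div_mul_cancel hγ.ne', Real.rpow_one]
  -- The first bound gives M · Kε ≤ 1, so the bad tuples add at most 1 to the mean weight. The
  -- second gives the size condition of `card_bad_tuples_le` for all T' with |T'| ≥ c|T|.
  refine ⟨min (1 / (M * K)) (d ^ K * c), by positivity, ?_⟩
  intro Z T _ _ hz hT Rel hR N hN b hb
  set ε := min (1 / (M * K)) (d ^ K * c)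
  set z := Fintype.card Z
  have hz' : (0 : ℝ) < z := by exact_mod_cast hz
  have hε0 : 0 < ε := by positivity
  have hεM : M * (K * ε) ≤ 1 := by
    have : ε ≤ 1 / (M * K) := min_le_left _ _
    rw [le_div_iff₀ (by positivity)] at this
    linarith
  have hone : ∀ T' : Finset T, c * Fintype.card T ≤ T'.card →
      (Nat.card {σ : Equiv.Perm Z // γ * z < ((Finset.univ.filter fun j =>
          ((commonRel Rel T' (fun i => σ (b j i))).card : ℝ) < d ^ K * T'.card).card : ℝ)} : ℝ) ≤
      (1 / 8) ^ z * z.factorial := by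
    intro T' hT'
    have hbad := card_bad_tuples_le hd0.le hd1 hε0.le Rel hR T' (by
      have : ε ≤ d ^ K * c := min_le_right _ _
      calc ε * Fintype.card T ≤ d ^ K * c * Fintype.card T := by gcongr
        _ = d ^ K * (c * Fintype.card T) := by ring
        _ ≤ _ := by gcongr)
    set B := Finset.univ.filter fun h : Fin K → Z =>
      ((commonRel Rel T' h).card : ℝ) < d ^ K * T'.card
    let w : (Fin K → Z) → ℝ := fun h => if h ∈ B then M else 1
    have hw : ∑ h, w h ≤ 2 * (z : ℝ) ^ K := by
      have h1 : ∀ h, w h ≤ (if h ∈ B then M else 0) + 1 := by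
        intro h
        by_cases hh : h ∈ B <;> simp [w, hh]
      refine (Finset.sum_le_sum fun h _ => h1 h).trans ?_
      rw [Finset.sum_add_distrib, ← Finset.sum_filter, Finset.sum_const, Finset.sum_const,
        Finset.filter_mem_eq_inter, Finset.univ_inter, Finset.card_univ, nsmul_eq_mul, nsmul_eq_mul]
      have h2 : (Fintype.card (Fin K → Z) : ℝ) = (z : ℝ) ^ K := by simp [z]
      rw [h2]
      have h3 := mul_le_mul_of_nonneg_right hbad hM0.le
      have h4 := mul_le_mul_of_nonneg_right hεM (show (0 : ℝ) ≤ (z : ℝ) ^ K by positivity)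
      nlinarith
    have hmain := card_perm_weight_le hz K b hb w (fun h => by simp only [w]; split_ifs <;> linarith)
      {φ | γ * z < ((Finset.univ.filter fun j =>
          ((commonRel Rel T' (φ j)).card : ℝ) < d ^ K * T'.card).card : ℝ)}
      (M ^ (γ * z)) (by positivity) (by
        intro φ hφ
        have h1 : ∏ j, w (φ j) = M ^ (Finset.univ.filter fun j =>
            ((commonRel Rel T' (φ j)).card : ℝ) < d ^ K * T'.card).card := by
          simp only [w]
          rw [Finset.prod_ite, Finset.prod_const, Finset.prod_const_one, mul_one]
          congr 2
          ext j; simp [B]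
        rw [h1, ← Real.rpow_natCast]
        exact Real.rpow_le_rpow_of_exponent_le hM1 (Set.mem_ofPred.mp hφ).le) κ hκ (by simpa using hN)
    refine hmain.trans (mul_le_mul_of_nonneg_right ?_ (by positivity))
    have hNK : (N : ℝ) * K ≤ z := by nlinarith
    have hNz : N ≤ z := by
      have : N * K ≤ z := by exact_mod_cast hNK
      nlinarith
    have h5 : ((∑ h, w h) / (κ * z) ^ K) ^ Fintype.card (Fin N) ≤ (2 / κ) ^ z := by
      rw [Fintype.card_fin]
      have h6 : (∑ h, w h) / (κ * z) ^ K ≤ 2 * (1 / κ) ^ K := by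
        rw [div_le_iff₀ (by positivity), mul_pow]
        refine hw.trans (le_of_eq ?_)
        field_simp
        rw [← mul_pow, one_div_mul_cancel hκ.ne', one_pow]
      have h0 : 0 ≤ (∑ h, w h) / (κ * z) ^ K :=
        div_nonneg (Finset.sum_nonneg fun h _ => by simp only [w]; split_ifs <;> linarith)
          (by positivity)
      refine (pow_le_pow_left₀ h0 h6 N).trans ?_
      rw [mul_pow, ← pow_mul, show (2 / κ : ℝ) = 2 * (1 / κ) by ring, mul_pow]
      refine mul_le_mul (pow_le_pow_right₀ (by norm_num) hNz) (pow_le_pow_right₀ ?_ ?_)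
        (by positivity) (by positivity)
      · rw [le_div_iff₀ hκ]; linarith
      · rw [mul_comm]; exact_mod_cast hNK
    have h7 : M ^ (γ * z) = (16 / κ) ^ z := by
      rw [Real.rpow_mul hM0.le, hMγ, Real.rpow_natCast]
    rw [h7, div_le_iff₀ (by positivity), ← mul_pow]
    refine h5.trans (le_of_eq ?_)
    congr 1
    ring
  have hunion : Nat.card {σ : Equiv.Perm Z // ∃ T' : Finset T, c * Fintype.card T ≤ T'.card ∧
        γ * z < ((Finset.univ.filter fun j =>
          ((commonRel Rel T' (fun i => σ (b j i))).card : ℝ) < d ^ K * T'.card).card : ℝ)} ≤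
      ∑ T' ∈ Finset.univ.filter fun T' : Finset T => c * Fintype.card T ≤ T'.card,
        Nat.card {σ : Equiv.Perm Z // γ * z < ((Finset.univ.filter fun j =>
          ((commonRel Rel T' (fun i => σ (b j i))).card : ℝ) < d ^ K * T'.card).card : ℝ)} := by
    simp only [Nat.card_eq_fintype_card, Fintype.card_subtype]
    refine le_trans (Finset.card_le_card ?_) Finset.card_biUnion_le
    intro σ hσ
    simp only [Finset.mem_filter, Finset.mem_univ, true_and, Finset.mem_biUnion] at hσ ⊢
    exact hσ
  have hcardT : ((Finset.univ.filter fun T' : Finset T =>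
      c * Fintype.card T ≤ T'.card).card : ℝ) ≤ 4 ^ z := by
    have h1 : (Finset.univ.filter fun T' : Finset T => c * Fintype.card T ≤ T'.card).card ≤ 4 ^ z := by
      refine (Finset.card_le_univ _).trans ?_
      rw [Fintype.card_finset, show 4 = 2 ^ 2 by norm_num, ← pow_mul]
      exact Nat.pow_le_pow_right (by norm_num) hT
    exact_mod_cast h1
  refine (Nat.cast_le.mpr hunion).trans ?_
  push_cast
  refine (Finset.sum_le_sum fun T' hT' => hone T' (Finset.mem_filter.mp hT').2).trans ?_
  rw [Finset.sum_const, nsmul_eq_mul, ← mul_assoc]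
  refine mul_le_mul_of_nonneg_right ?_ (by positivity)
  refine (mul_le_mul_of_nonneg_right hcardT (by positivity)).trans (le_of_eq ?_)
  rw [← mul_pow]
  norm_num

-- Lower tail by an exponential moment: a tuple in the box, of which there is a proportion at least
-- q = c^K, gets weight 1/2. Only a small part J₀ of the chunks is examined, so that sampling
-- without replacement costs a factor κ^K ≥ 1 - q/4 per chunk, less than the gain 1 - q/2. The
-- quotient is at most 1 - q/4.
open Classical in
theorem card_perm_few_chunks_le (K : ℕ) (hK0 : 0 < K) (c ν : ℝ) (hc : 0 < c) (hc1 : c ≤ 1)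
    (hν : 0 < ν) :
    ∃ c' : ℝ, 0 < c' ∧ ∃ ρ : ℝ, 0 < ρ ∧ ρ < 1 ∧ ∃ z₀ : ℕ, 0 < z₀ ∧ ∀ (Z : Type*) [Fintype Z],
      z₀ ≤ Fintype.card Z → ∀ (N : ℕ) (b : Fin N → Fin K → Z),
      Function.Injective (fun q : Fin N × Fin K => b q.1 q.2) →
      ∀ J : Finset (Fin N), ν * Fintype.card Z ≤ J.card →
      ∀ X : Fin K → Finset Z, (∀ i, c * Fintype.card Z ≤ (X i).card) →
      (Nat.card {σ : Equiv.Perm Z // ((J.filter fun j => ∀ i, σ (b j i) ∈ X i).card : ℝ) <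
        c' * Fintype.card Z} : ℝ) ≤ ρ ^ Fintype.card Z * (Fintype.card Z).factorial := by
  set q : ℝ := c ^ K
  have hq0 : 0 < q := by positivity
  have hq1 : q ≤ 1 := pow_le_one₀ hc.le hc1
  have hK1 : (1 : ℝ) ≤ K := by exact_mod_cast hK0
  set c₁ : ℝ := min ν (q / (4 * K ^ 2))
  have hc₁ : 0 < c₁ := by positivity
  have hc₁K : K * c₁ ≤ q / (4 * K) := by
    have : c₁ ≤ q / (4 * K ^ 2) := min_le_right _ _
    calc K * c₁ ≤ K * (q / (4 * K ^ 2)) := by gcongr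
      _ = q / (4 * K) := by field_simp
  have hq4 : q / (4 * K) ≤ 1 / 4 := by
    rw [div_le_iff₀ (by positivity)]; nlinarith
  set κ : ℝ := 1 - K * c₁
  have hκ : 0 < κ := by simp only [κ]; linarith
  have hκK : 1 - q / 4 ≤ κ ^ K := by
    have h1 : -2 ≤ -(K * c₁) := by linarith
    have h2 := one_add_mul_le_pow h1 K
    have h3 : (K : ℝ) * (K * c₁) ≤ K * (q / (4 * K)) := by gcongr
    rw [show (K : ℝ) * (q / (4 * K)) = q / 4 by field_simp] at h3
    rw [show κ = 1 + -(K * c₁) by simp only [κ]; ring]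
    linarith
  -- At least c₁z/2 examined chunks give the moment e^(-q c₁ z/8). The threshold 2^(-c'z) with c' =
  -- q c₁/16 gives back at most half of that exponent.
  refine ⟨q * c₁ / 16, by positivity, Real.exp (-(q * c₁ / 16)), Real.exp_pos _, ?_, ?_⟩
  · rw [Real.exp_lt_one_iff]; linarith [show 0 < q * c₁ / 16 by positivity]
  obtain ⟨z₁, hz₁⟩ := exists_nat_ge (2 / c₁)
  refine ⟨z₁ + 1, by omega, fun Z _ hZ N b hb J hJ X hX => ?_⟩
  set z := Fintype.card Z
  have hz : 0 < z := by omega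
  have hz' : (0 : ℝ) < z := by exact_mod_cast hz
  have hz1 : 2 ≤ c₁ * z := by
    have : (z₁ : ℝ) ≤ z := by exact_mod_cast (by omega)
    rw [div_le_iff₀ hc₁] at hz₁
    nlinarith
  set s := ⌊c₁ * z⌋₊
  have hs1 : (s : ℝ) ≤ c₁ * z := Nat.floor_le (by positivity)
  have hs2 : c₁ * z / 2 ≤ s := by
    have h2 : c₁ * z < s + 1 := Nat.lt_floor_add_one (c₁ * z)
    linarith
  have hsJ : s ≤ J.card := by
    have : (s : ℝ) ≤ J.card := by
      refine hs1.trans (le_trans ?_ hJ)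
      gcongr
      exact min_le_left _ _
    exact_mod_cast this
  obtain ⟨J₀, hJ₀, hJ₀s⟩ := Finset.exists_subset_card_eq hsJ
  let w : (Fin K → Z) → ℝ := fun h => if ∀ i, h i ∈ X i then 1 / 2 else 1
  have hw0 : ∀ h, 0 ≤ w h := fun h => by simp only [w]; split_ifs <;> norm_num
  have hw : ∑ h, w h ≤ (1 - q / 2) * (z : ℝ) ^ K := by
    have h1 : ∀ h, w h = 1 - (if h ∈ Fintype.piFinset X then 1 / 2 else 0) := by
      intro h
      simp only [w, Fintype.mem_piFinset]
      split_ifs <;> norm_num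
    simp only [h1]
    rw [Finset.sum_sub_distrib, ← Finset.sum_filter, Finset.sum_const, Finset.sum_const,
        Finset.filter_mem_eq_inter, Finset.univ_inter, Finset.card_univ, nsmul_eq_mul, nsmul_eq_mul,
        Fintype.card_piFinset]
    have h2 : (Fintype.card (Fin K → Z) : ℝ) = (z : ℝ) ^ K := by simp [z]
    rw [h2]
    have h3 : q * (z : ℝ) ^ K ≤ ((∏ i, (X i).card : ℕ) : ℝ) := by
      push_cast
      calc q * (z : ℝ) ^ K = ∏ i : Fin K, (c * z) := by
            rw [Finset.prod_const, Finset.card_univ, Fintype.card_fin, mul_pow]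
        _ ≤ _ := Finset.prod_le_prod (fun i _ => by positivity) fun i _ => hX i
    linarith
  have hmain := card_perm_weight_le hz (J := J₀) K (fun j => b j) (by
      rintro ⟨j, i⟩ ⟨j', i'⟩ h
      have := @hb (j.1, i) (j'.1, i') h
      simp only [Prod.mk.injEq] at this
      exact Prod.ext (Subtype.ext this.1) this.2) w hw0
    {φ | ((Finset.univ.filter fun j => ∀ i, φ j i ∈ X i).card : ℝ) < q * c₁ / 16 * z}
    (2 ^ (-(q * c₁ / 16 * z))) (by positivity) (by
      intro φ hφ
      have h1 : ∏ j, w (φ j) = (1 / 2) ^ (Finset.univ.filter fun j => ∀ i, φ j i ∈ X i).card := by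
        simp only [w]
        rw [Finset.prod_ite, Finset.prod_const, Finset.prod_const_one, mul_one]
      rw [h1, one_div, inv_pow, Real.rpow_neg (by norm_num), ← Real.rpow_natCast]
      have h2 : (2 : ℝ) ^ ((Finset.univ.filter fun j => ∀ i, φ j i ∈ X i).card : ℝ) ≤
          2 ^ (q * c₁ / 16 * z) :=
        Real.rpow_le_rpow_of_exponent_le (by norm_num) (Set.mem_ofPred.mp hφ).le
      exact inv_anti₀ (by positivity) h2) κ hκ (by
      rw [Fintype.card_coe, hJ₀s]
      simp only [κ]
      calc (s * K : ℝ) ≤ (c₁ * z) * K := by gcongr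
        _ = _ := by ring)
  refine le_trans (Nat.cast_le.mpr (Nat.card_le_card_of_injective
    (Subtype.map id fun σ hσ => ?_) (Subtype.map_injective _ Function.injective_id)))
    (hmain.trans (mul_le_mul_of_nonneg_right ?_ (by positivity)))
  · refine lt_of_le_of_lt (Nat.cast_le.mpr ?_) hσ
    rw [← Finset.card_map (Function.Embedding.subtype _)]
    refine Finset.card_le_card fun j hj => ?_
    simp only [Finset.mem_map, Finset.mem_filter, Finset.mem_univ, true_and] at hj ⊢
    obtain ⟨j, hj, rfl⟩ := hj
    exact ⟨hJ₀ j.2, hj⟩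
  · rw [Fintype.card_coe, hJ₀s]
    have h1 : (∑ h, w h) / (κ * z) ^ K ≤ 1 - q / 4 := by
      rw [div_le_iff₀ (by positivity), mul_pow]
      refine hw.trans ?_
      rw [← mul_assoc]
      gcongr
      nlinarith
    have h0 : 0 ≤ (∑ h, w h) / (κ * z) ^ K :=
      div_nonneg (Finset.sum_nonneg fun h _ => hw0 h) (by positivity)
    have h2 : ((∑ h, w h) / (κ * z) ^ K) ^ s ≤ Real.exp (-(q * c₁ / 8) * z) := by
      refine (pow_le_pow_left₀ h0 (h1.trans (Real.one_sub_le_exp_neg _)) s).trans ?_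
      rw [← Real.exp_nat_mul]
      refine Real.exp_le_exp.mpr ?_
      nlinarith
    have h3 : (2 : ℝ) ^ (q * c₁ / 16 * z) ≤ Real.exp (q * c₁ / 16 * z) := by
      rw [← Real.exp_one_rpow]
      refine Real.rpow_le_rpow (by norm_num) ?_ (by positivity)
      have := Real.add_one_le_exp (1 : ℝ); linarith
    rw [Real.rpow_neg (by norm_num), div_inv_eq_mul, ← Real.exp_nat_mul]
    refine (mul_le_mul h2 h3 (by positivity) (Real.exp_pos _).le).trans (le_of_eq ?_)
    rw [← Real.exp_add]
    congr 1
    ring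

/-! ### A robust Hall theorem. -/

open Classical in
/-- A robust form of Hall's theorem for bipartite relations with a minimum degree condition and
edges between all large sets. -/
theorem exists_bijective_of_robust {X Y : Type*} [Fintype X] [Fintype Y] (r : X → Y → Prop)
    (hcard : Fintype.card X = Fintype.card Y) (m : ℝ)
    (hX : ∀ x, m ≤ ((Finset.univ.filter fun y => r x y).card : ℝ))
    (hY : ∀ y, m ≤ ((Finset.univ.filter fun x => r x y).card : ℝ))
    (hXY : ∀ (A : Finset X) (B : Finset Y), m ≤ A.card → m ≤ B.card → ∃ a ∈ A, ∃ b ∈ B, r a b) :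
    ∃ f : X → Y, Function.Bijective f ∧ ∀ x, r x (f x) := by
  obtain ⟨f, hf, hr⟩ := (Fintype.all_card_le_filter_rel_iff_exists_injective r).mp (by
    intro A
    by_contra hlt
    push Not at hlt
    set N : Finset Y := Finset.univ.filter fun b => ∃ a ∈ A, r a b
    have hA : A.Nonempty := Finset.card_pos.mp (by omega)
    have hle : A.card ≤ Fintype.card Y := hcard ▸ Finset.card_le_univ A
    have hN : Nᶜ.Nonempty := by
      rw [← Finset.card_pos, Finset.card_compl]
      omega
    obtain ⟨b, hb⟩ := hN
    obtain ⟨a, ha⟩ := hA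
    -- A violating A exceeds its neighbourhood N, so it has at least m elements. A vertex outside N
    -- has all its neighbours outside A, so the complement of A, and with it the larger complement
    -- of N, has at least m elements. But no edge joins A to that complement.
    have h1 : m ≤ A.card := by
      refine (hX a).trans (Nat.cast_le.mpr (le_trans (Finset.card_le_card ?_) hlt.le))
      intro y hy
      simp only [Finset.mem_filter, Finset.mem_univ, true_and, N] at hy ⊢
      exact ⟨a, ha, hy⟩
    have h2 : m ≤ Nᶜ.card := by
      refine (hY b).trans (Nat.cast_le.mpr (le_trans (Finset.card_le_card (t := Aᶜ) ?_) ?_))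
      · intro x hx
        simp only [Finset.mem_filter, Finset.mem_univ, true_and, N, Finset.mem_compl] at hx hb ⊢
        exact fun hxA => hb ⟨x, hxA, hx⟩
      · rw [Finset.card_compl, Finset.card_compl]
        omega
    obtain ⟨a', ha', b', hb', hr⟩ := hXY A Nᶜ h1 h2
    simp only [Finset.mem_filter, Finset.mem_univ, true_and, N, Finset.mem_compl] at hb'
    exact hb' ⟨a', ha', hr⟩)
  exact ⟨f, (Fintype.bijective_iff_injective_and_card f).mpr ⟨hf, hcard⟩, hr⟩

/-! ### Assembling squares of paths from segments. -/

/-- The list spells the square of a path in `H`. -/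
def IsSquarePath {W : Type*} (H : SimpleGraph W) : List W → Prop
  | [] => True
  | [_] => True
  | [a, b] => H.Adj a b
  | a :: b :: c :: l => H.Adj a b ∧ H.Adj a c ∧ IsSquarePath H (b :: c :: l)

theorem IsSquarePath.cons {W : Type*} {H : SimpleGraph W} {a b c : W} {l : List W}
    (h : IsSquarePath H (b :: c :: l)) (hab : H.Adj a b) (hac : H.Adj a c) :
    IsSquarePath H (a :: b :: c :: l) :=
  ⟨hab, hac, h⟩

theorem IsSquarePath.adj {W : Type*} {H : SimpleGraph W} {l : List W} (h : IsSquarePath H l) :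
    ∀ (i j : ℕ) (hij : i < j) (hj : j < l.length), j ≤ i + 2 →
      H.Adj (l[i]'(hij.trans hj)) (l[j]'hj) := by
  induction l with
  | nil => intro i j _ hj; simp at hj
  | cons a l ih =>
    match l, ih, h with
    | [], _, _ => intro i j hij hj; simp at hj; omega
    | [b], _, h =>
      intro i j hij hj _
      simp at hj
      obtain ⟨rfl, rfl⟩ : i = 0 ∧ j = 1 := by omega
      exact h
    | b :: c :: l, ih, h =>
      intro i j hij hj hji
      obtain ⟨h1, h2, h3⟩ := h
      cases i with
      | zero =>
        rcases (show j = 1 ∨ j = 2 by omega) with rfl | rfl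
        · exact h1
        · exact h2
      | succ i =>
        cases j with
        | zero => omega
        | succ j => exact ih h3 i j (by omega) (by simpa using hj) (by omega)

/-- `r` consecutive pairs taken from the sequence `e`, with entries of `g` inserted between
consecutive pairs, followed by `tail`. -/
def pairSegment {W : Type*} : ℕ → (ℕ → W) → (ℕ → W) → List W → List W
  | 0, _, _, tail => tail
  | 1, e, _, tail => e 0 :: e 1 :: tail
  | r + 2, e, g, tail =>
    e 0 :: e 1 :: g 0 :: pairSegment (r + 1) (fun i => e (i + 2)) (fun i => g (i + 1)) tail

theorem length_pairSegment {W : Type*} (r : ℕ) (e g : ℕ → W) (tail : List W) :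
    (pairSegment r e g tail).length = 2 * r + (r - 1) + tail.length := by
  induction r generalizing e g with
  | zero => simp [pairSegment]
  | succ r ih =>
    cases r with
    | zero => simp [pairSegment]; omega
    | succ r => simp [pairSegment, ih]; omega

theorem mem_pairSegment {W : Type*} (r : ℕ) (e g : ℕ → W) (tail : List W) (w : W) :
    w ∈ pairSegment r e g tail ↔
      (∃ i < 2 * r, w = e i) ∨ (∃ i < r - 1, w = g i) ∨ w ∈ tail := by
  induction r generalizing e g with
  | zero => simp [pairSegment]
  | succ r ih =>
    cases r with
    | zero =>
      simp only [pairSegment, List.mem_cons, zero_add, mul_one]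
      constructor
      · rintro (h | h | h)
        · exact Or.inl ⟨0, by omega, h⟩
        · exact Or.inl ⟨1, by omega, h⟩
        · exact Or.inr (Or.inr h)
      · rintro (⟨i, hi, h⟩ | ⟨i, hi, h⟩ | h)
        · rcases (show i = 0 ∨ i = 1 by omega) with rfl | rfl
          · exact Or.inl h
          · exact Or.inr (Or.inl h)
        · omega
        · exact Or.inr (Or.inr h)
    | succ r =>
      simp only [pairSegment, List.mem_cons, ih]
      constructor
      · rintro (h | h | h | ⟨i, hi, h⟩ | ⟨i, hi, h⟩ | h)
        · exact Or.inl ⟨0, by omega, h⟩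
        · exact Or.inl ⟨1, by omega, h⟩
        · exact Or.inr (Or.inl ⟨0, by omega, h⟩)
        · exact Or.inl ⟨i + 2, by omega, h⟩
        · exact Or.inr (Or.inl ⟨i + 1, by omega, h⟩)
        · exact Or.inr (Or.inr h)
      · rintro (⟨i, hi, h⟩ | ⟨i, hi, h⟩ | h)
        · match i, hi, h with
          | 0, _, h => exact Or.inl h
          | 1, _, h => exact Or.inr (Or.inl h)
          | i + 2, hi, h =>
            exact Or.inr (Or.inr (Or.inr (Or.inl ⟨i, by omega, h⟩)))
        · match i, hi, h with
          | 0, _, h => exact Or.inr (Or.inr (Or.inl h))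
          | i + 1, hi, h =>
            exact Or.inr (Or.inr (Or.inr (Or.inr (Or.inl ⟨i, by omega, h⟩))))
        · exact Or.inr (Or.inr (Or.inr (Or.inr (Or.inr h))))

theorem exists_pairSegment_eq_append {W : Type*} (r : ℕ) (e g : ℕ → W) (tail : List W) :
    ∃ m, pairSegment r e g tail = m ++ tail := by
  induction r generalizing e g with
  | zero => exact ⟨[], rfl⟩
  | succ r ih =>
    cases r with
    | zero => exact ⟨[e 0, e 1], rfl⟩
    | succ r =>
      obtain ⟨m, hm⟩ := ih (fun i => e (i + 2)) (fun i => g (i + 1))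
      exact ⟨e 0 :: e 1 :: g 0 :: m, by simp [pairSegment, hm]⟩

/-- `g` is adjacent to the pairs before and after it, and consecutive entries of `e` are adjacent. -/
structure IsPairSegment {W : Type*} (H : SimpleGraph W) (r : ℕ) (e g : ℕ → W) : Prop where
  pos : 0 < r
  chain : ∀ i, i + 1 < 2 * r → H.Adj (e i) (e (i + 1))
  insert : ∀ i, i + 1 < r → ∀ k < 4, H.Adj (g i) (e (2 * i + k))

/-- The second conclusion exposes the first two entries, which is what prepending the next vertex
requires. -/
theorem IsPairSegment.isSquarePath {W : Type*} {H : SimpleGraph W} {r : ℕ} {e g : ℕ → W}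
    (h : IsPairSegment H r e g) {c d : W} {tail : List W} (ht : IsSquarePath H (c :: d :: tail))
    (h1 : H.Adj (e (2 * r - 2)) c) (h2 : H.Adj (e (2 * r - 1)) c) (h3 : H.Adj (e (2 * r - 1)) d) :
    IsSquarePath H (pairSegment r e g (c :: d :: tail)) ∧
      ∃ l, pairSegment r e g (c :: d :: tail) = e 0 :: e 1 :: l := by
  obtain ⟨hr, hc, hi⟩ := h
  induction r generalizing e g with
  | zero => omega
  | succ r ih =>
    cases r with
    | zero =>
      exact ⟨(ht.cons h2 h3).cons (hc 0 (by omega)) h1, _, rfl⟩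
    | succ r =>
      refine ⟨?_, _, rfl⟩
      obtain ⟨h4, l, hl⟩ := ih (e := fun i => e (i + 2)) (g := fun i => g (i + 1))
        (by convert h1 using 2; omega) (by convert h2 using 2; omega) (by convert h3 using 2; omega)
        (by omega) (fun i h => hc (i + 2) (by omega)) (fun i h k hk => by
          have := hi (i + 1) (by omega) k hk
          convert this using 2; omega)
      have hg : ∀ k < 4, H.Adj (g 0) (e k) := fun k hk => by
        simpa using hi 0 (by omega) k hk
      rw [pairSegment]
      rw [hl] at h4 ⊢
      exact ((h4.cons (hg 2 (by omega)) (hg 3 (by omega))).cons (hg 1 (by omega)).symm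
        (hc 1 (by omega))).cons (hc 0 (by omega)) (hg 0 (by omega)).symm

/-- Alternating segments `f 0, e 0, f 1, e 1, …`, followed by the first two entries of `f t`. -/
def alternatingSegments {W : Type*} : (t : ℕ) → (r s : ℕ → ℕ) → (e g f h : ℕ → ℕ → W) → List W
  | 0, _, _, _, _, f, _ => [f 0 0, f 0 1]
  | t + 1, r, s, e, g, f, h =>
    pairSegment (s 0) (f 0) (h 0) (pairSegment (r 0) (e 0) (g 0)
      (alternatingSegments t (fun j => r (j + 1)) (fun j => s (j + 1)) (fun j => e (j + 1))
        (fun j => g (j + 1)) (fun j => f (j + 1)) (fun j => h (j + 1))))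

theorem length_alternatingSegments {W : Type*} (t : ℕ) (r s : ℕ → ℕ) (e g f h : ℕ → ℕ → W) :
    (alternatingSegments t r s e g f h).length =
      (∑ j ∈ Finset.range t, (2 * r j + (r j - 1) + (2 * s j + (s j - 1)))) + 2 := by
  induction t generalizing r s e g f h with
  | zero => simp [alternatingSegments]
  | succ t ih =>
    rw [alternatingSegments, length_pairSegment, length_pairSegment, ih, Finset.sum_range_succ']
    ring

theorem mem_alternatingSegments {W : Type*} (t : ℕ) (r s : ℕ → ℕ) (e g f h : ℕ → ℕ → W) (w : W) :
    w ∈ alternatingSegments t r s e g f h ↔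
      (∃ j < t, (∃ i < 2 * r j, w = e j i) ∨ (∃ i < r j - 1, w = g j i) ∨
        (∃ i < 2 * s j, w = f j i) ∨ (∃ i < s j - 1, w = h j i)) ∨ w = f t 0 ∨ w = f t 1 := by
  induction t generalizing r s e g f h with
  | zero => simp [alternatingSegments]
  | succ t ih =>
    rw [alternatingSegments, mem_pairSegment, mem_pairSegment, ih]
    constructor
    · rintro (h1 | h1 | h1 | h1 | ⟨j, hj, h1⟩ | h1)
      · exact Or.inl ⟨0, by omega, Or.inr (Or.inr (Or.inl h1))⟩
      · exact Or.inl ⟨0, by omega, Or.inr (Or.inr (Or.inr h1))⟩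
      · exact Or.inl ⟨0, by omega, Or.inl h1⟩
      · exact Or.inl ⟨0, by omega, Or.inr (Or.inl h1)⟩
      · exact Or.inl ⟨j + 1, by omega, h1⟩
      · exact Or.inr h1
    · rintro (⟨j, hj, h1⟩ | h1)
      · cases j with
        | zero =>
          rcases h1 with h1 | h1 | h1 | h1
          · exact Or.inr (Or.inr (Or.inl h1))
          · exact Or.inr (Or.inr (Or.inr (Or.inl h1)))
          · exact Or.inl h1
          · exact Or.inr (Or.inl h1)
        | succ j =>
          exact Or.inr (Or.inr (Or.inr (Or.inr (Or.inl ⟨j, by omega, h1⟩))))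
      · exact Or.inr (Or.inr (Or.inr (Or.inr (Or.inr h1))))

theorem exists_alternatingSegments_eq_append {W : Type*} (t : ℕ) (r s : ℕ → ℕ)
    (e g f h : ℕ → ℕ → W) :
    ∃ m, alternatingSegments t r s e g f h = m ++ [f t 0, f t 1] := by
  induction t generalizing r s e g f h with
  | zero => exact ⟨[], rfl⟩
  | succ t ih =>
    rw [alternatingSegments]
    obtain ⟨m, hm⟩ := ih (fun j => r (j + 1)) (fun j => s (j + 1)) (fun j => e (j + 1))
        (fun j => g (j + 1)) (fun j => f (j + 1)) (fun j => h (j + 1))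
    rw [hm]
    obtain ⟨m₁, hm₁⟩ := exists_pairSegment_eq_append (r 0) (e 0) (g 0) (m ++ [f (t + 1) 0, f (t + 1) 1])
    rw [hm₁]
    obtain ⟨m₂, hm₂⟩ := exists_pairSegment_eq_append (s 0) (f 0) (h 0)
      (m₁ ++ (m ++ [f (t + 1) 0, f (t + 1) 1]))
    rw [hm₂]
    exact ⟨m₂ ++ m₁ ++ m, by simp⟩

/-- The last two of the first `2 * r` entries of `e` may be followed by the pair `c, d`. -/
structure IsLink {W : Type*} (H : SimpleGraph W) (r : ℕ) (e : ℕ → W) (c d : W) : Prop where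
  fst_fst : H.Adj (e (2 * r - 2)) c
  snd_fst : H.Adj (e (2 * r - 1)) c
  snd_snd : H.Adj (e (2 * r - 1)) d

theorem isSquarePath_alternatingSegments {W : Type*} {H : SimpleGraph W} (t : ℕ) (r s : ℕ → ℕ)
    (e g f h : ℕ → ℕ → W) (he : ∀ j < t, IsPairSegment H (r j) (e j) (g j))
    (hf : ∀ j < t, IsPairSegment H (s j) (f j) (h j))
    (hfe : ∀ j < t, IsLink H (s j) (f j) (e j 0) (e j 1))
    (hef : ∀ j < t, IsLink H (r j) (e j) (f (j + 1) 0) (f (j + 1) 1))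
    (hend : H.Adj (f t 0) (f t 1)) :
    IsSquarePath H (alternatingSegments t r s e g f h) ∧
      ∃ l, alternatingSegments t r s e g f h = f 0 0 :: f 0 1 :: l := by
  induction t generalizing r s e g f h with
  | zero => exact ⟨hend, _, rfl⟩
  | succ t ih =>
    obtain ⟨h1, l, hl⟩ := ih (fun j => r (j + 1)) (fun j => s (j + 1)) (fun j => e (j + 1))
        (fun j => g (j + 1)) (fun j => f (j + 1)) (fun j => h (j + 1))
        (fun j hj => he (j + 1) (by omega)) (fun j hj => hf (j + 1) (by omega))
        (fun j hj => hfe (j + 1) (by omega)) (fun j hj => hef (j + 1) (by omega)) hend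
    rw [alternatingSegments]
    rw [hl] at h1 ⊢
    obtain ⟨a1, a2, a3⟩ := hef 0 (by omega)
    obtain ⟨h2, l', hl'⟩ := (he 0 (by omega)).isSquarePath h1 a1 a2 a3
    rw [hl'] at h2 ⊢
    obtain ⟨b1, b2, b3⟩ := hfe 0 (by omega)
    exact (hf 0 (by omega)).isSquarePath h2 b1 b2 b3

/-- Distinctness is not checked by hand: the list covers S and its length is |S|, so it has no
repetition. -/
theorem exists_isSquareHamiltonPath {W : Type*} {H : SimpleGraph W} {S : Finset W} {x x' : W}
    (t : ℕ) (r s : ℕ → ℕ) (e g f h : ℕ → ℕ → W)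
    (he : ∀ j < t, IsPairSegment H (r j) (e j) (g j))
    (hf : ∀ j < t, IsPairSegment H (s j) (f j) (h j))
    (hfe : ∀ j < t, IsLink H (s j) (f j) (e j 0) (e j 1))
    (hef : ∀ j < t, IsLink H (r j) (e j) (f (j + 1) 0) (f (j + 1) 1))
    (hx : x ≠ x') (hy : f t 0 ≠ f t 1)
    (hx'0 : H.Adj x' (f 0 0)) (hx0 : H.Adj x (f 0 0)) (hx1 : H.Adj x (f 0 1))
    (hS : ∀ w, w ∈ S ↔ w = x' ∨ w = x ∨
      (∃ j < t, (∃ i < 2 * r j, w = e j i) ∨ (∃ i < r j - 1, w = g j i) ∨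
        (∃ i < 2 * s j, w = f j i) ∨ (∃ i < s j - 1, w = h j i)) ∨ w = f t 0 ∨ w = f t 1)
    (hcard : S.card =
      (∑ j ∈ Finset.range t, (2 * r j + (r j - 1) + (2 * s j + (s j - 1)))) + 4) :
    ∃ l, IsSquareHamiltonPath H S x x' (f t 0) (f t 1) l := by
  classical
  set l := x' :: x :: alternatingSegments t r s e g f h
  have hmem : ∀ w, w ∈ l ↔ w ∈ S := fun w => by
    simp only [l, List.mem_cons, mem_alternatingSegments, hS]
  have hlen : l.length = S.card := by
    simp only [l, List.length_cons, length_alternatingSegments, hcard]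
  have hnd : l.Nodup := by
    have : l.toFinset = S := by ext w; simp [hmem]
    rw [← List.dedup_eq_self]
    refine (List.dedup_sublist l).eq_of_length ?_
    rw [hlen, ← this, List.card_toFinset]
  obtain ⟨m, hm⟩ := exists_alternatingSegments_eq_append t r s e g f h
  have hl : l = [x', x] ++ m ++ [f t 0, f t 1] := by simp [l, hm]
  refine ⟨l, hnd, hmem, ⟨m, hl⟩, ?_⟩
  -- With the two optional end edges added, the whole list is the square of a path and no end needs
  -- separate treatment. As the entries are distinct, an added edge can only occur at the two
  -- exempted pairs of positions.
  set H' : SimpleGraph W := H ⊔ SimpleGraph.edge x x' ⊔ SimpleGraph.edge (f t 0) (f t 1)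
  have hHH : ∀ {a b}, H.Adj a b → H'.Adj a b := fun h => Or.inl (Or.inl h)
  have hlk : ∀ {r e c d}, IsLink H r e c d → IsLink H' r e c d := fun h =>
    ⟨hHH h.1, hHH h.2, hHH h.3⟩
  have hsg : ∀ {r e g}, IsPairSegment H r e g → IsPairSegment H' r e g := fun h =>
    ⟨h.1, fun i hi => hHH (h.2 i hi), fun i hi k hk => hHH (h.3 i hi k hk)⟩
  have hsq : IsSquarePath H' l := by
    obtain ⟨h1, q, hq⟩ := isSquarePath_alternatingSegments (H := H') t r s e g f h
      (fun j hj => hsg (he j hj)) (fun j hj => hsg (hf j hj)) (fun j hj => hlk (hfe j hj))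
      (fun j hj => hlk (hef j hj)) (Or.inr ((SimpleGraph.edge_adj _ _ _ _).mpr ⟨Or.inl ⟨rfl, rfl⟩, hy⟩))
    simp only [l]
    rw [hq] at h1 ⊢
    exact (h1.cons (hHH hx0) (hHH hx1)).cons
      (Or.inl (Or.inr ((SimpleGraph.edge_adj _ _ _ _).mpr ⟨Or.inr ⟨rfl, rfl⟩, hx.symm⟩))) (hHH hx'0)
  intro i j hij hj hji hn1 hn2
  have hlast0 : l[l.length - 2]'(by omega) = f t 0 := by
    simp [hl]
  have hlast1 : l[l.length - 1]'(by omega) = f t 1 := by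
    simp [hl]
  have hl4 : 4 ≤ l.length := by rw [hlen, hcard]; omega
  have h0 : l[0]'(by omega) = x' := rfl
  have h1 : l[1]'(by omega) = x := rfl
  rcases hsq.adj i j hij hj hji with (hadj | hadj) | hadj
  · exact hadj
  · exfalso
    rcases ((SimpleGraph.edge_adj _ _ _ _).mp hadj).1 with ⟨h2, h3⟩ | ⟨h2, h3⟩
    · rw [← h0] at h3
      have := (List.Nodup.getElem_inj_iff hnd).mp h3
      omega
    · rw [← h0] at h2
      rw [← h1] at h3
      have := (List.Nodup.getElem_inj_iff hnd).mp h3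
      have := (List.Nodup.getElem_inj_iff hnd).mp h2
      omega
  · exfalso
    rcases ((SimpleGraph.edge_adj _ _ _ _).mp hadj).1 with ⟨h2, h3⟩ | ⟨h2, h3⟩
    · rw [← hlast0] at h2
      rw [← hlast1] at h3
      have := (List.Nodup.getElem_inj_iff hnd).mp h3
      have := (List.Nodup.getElem_inj_iff hnd).mp h2
      omega
    · rw [← hlast1] at h2
      rw [← hlast0] at h3
      have := (List.Nodup.getElem_inj_iff hnd).mp h3
      have := (List.Nodup.getElem_inj_iff hnd).mp h2
      omega

/-- Passes from chunks of fixed length, of which only the first 2 r j or 2 s j vertices are used, to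
sequences indexed by natural numbers. The conditions 2 ≤ r j and 2 ≤ s j give every chunk a gap, and
keep the last two used vertices of f j away from positions 0 and 1, which belong to the preceding
chunk of e. -/
theorem exists_isSquareHamiltonPath_of_chunks {W : Type*} {H : SimpleGraph W} {S : Finset W}
    {x x' y y' : W} {t a b : ℕ} (ht : 0 < t) (r s : Fin t → ℕ)
    (hr2 : ∀ j, 2 ≤ r j) (hra : ∀ j, r j ≤ a) (hs2 : ∀ j, 2 ≤ s j) (hsb : ∀ j, s j ≤ b)
    (e : Fin t → Fin (2 * a) → W) (f : Fin t → Fin (2 * b) → W)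
    (g : (j : Fin t) → Fin (r j - 1) → W) (h : (j : Fin t) → Fin (s j - 1) → W)
    (he : ∀ j (i i' : Fin (2 * a)), (i : ℕ) + 1 = i' → H.Adj (e j i) (e j i'))
    (hf : ∀ j (i i' : Fin (2 * b)), (i : ℕ) + 1 = i' → H.Adj (f j i) (f j i'))
    (hg : ∀ j k i, H.Adj (g j k) (e j i)) (hh : ∀ j k i, H.Adj (h j k) (f j i))
    (hfe : ∀ j (i : Fin (2 * b)) i', 2 ≤ (i : ℕ) → H.Adj (f j i) (e j i'))
    (hef : ∀ j j' : Fin t, (j : ℕ) + 1 = j' → ∀ (i : Fin (2 * b)) i', (i : ℕ) < 2 →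
      H.Adj (e j i') (f j' i))
    (hxf : ∀ j : Fin t, (j : ℕ) = 0 → ∀ i : Fin (2 * b), (i : ℕ) < 2 →
      H.Adj x (f j i) ∧ H.Adj x' (f j i))
    (hey : ∀ j : Fin t, (j : ℕ) + 1 = t → ∀ i, H.Adj (e j i) y ∧ H.Adj (e j i) y')
    (hx : x ≠ x') (hy : y ≠ y')
    (hS : ∀ w, w ∈ S ↔ w = x' ∨ w = x ∨
      (∃ j, (∃ i : Fin (2 * a), (i : ℕ) < 2 * r j ∧ w = e j i) ∨ (∃ i, w = g j i) ∨
        (∃ i : Fin (2 * b), (i : ℕ) < 2 * s j ∧ w = f j i) ∨ (∃ i, w = h j i)) ∨ w = y ∨ w = y')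
    (hcard : S.card = (∑ j, (2 * r j + (r j - 1) + (2 * s j + (s j - 1)))) + 4) :
    ∃ l, IsSquareHamiltonPath H S x x' y y' l := by
  let r' : ℕ → ℕ := fun j => if hj : j < t then r ⟨j, hj⟩ else 0
  let s' : ℕ → ℕ := fun j => if hj : j < t then s ⟨j, hj⟩ else 0
  let e' : ℕ → ℕ → W := fun j i => if hj : j < t ∧ i < 2 * a then e ⟨j, hj.1⟩ ⟨i, hj.2⟩ else x
  -- The default value matters: it makes y, y' the first two entries of a fictitious chunk number t,
  -- which closes the path. The other defaults are never used.
  let f' : ℕ → ℕ → W := fun j i => if hj : j < t ∧ i < 2 * b then f ⟨j, hj.1⟩ ⟨i, hj.2⟩ else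
    if i = 0 then y else y'
  let g' : ℕ → ℕ → W := fun j i => if hj : ∃ hj : j < t, i < r ⟨j, hj⟩ - 1 then
    g ⟨j, hj.1⟩ ⟨i, hj.2⟩ else x
  let h' : ℕ → ℕ → W := fun j i => if hj : ∃ hj : j < t, i < s ⟨j, hj⟩ - 1 then
    h ⟨j, hj.1⟩ ⟨i, hj.2⟩ else x
  have r'e : ∀ j (hj : j < t), r' j = r ⟨j, hj⟩ := fun j hj => by simp [r', hj]
  have s'e : ∀ j (hj : j < t), s' j = s ⟨j, hj⟩ := fun j hj => by simp [s', hj]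
  have e'e : ∀ j i (hj : j < t) (hi : i < 2 * a), e' j i = e ⟨j, hj⟩ ⟨i, hi⟩ :=
    fun j i hj hi => by simp [e', hj, hi]
  have f'e : ∀ j i (hj : j < t) (hi : i < 2 * b), f' j i = f ⟨j, hj⟩ ⟨i, hi⟩ :=
    fun j i hj hi => by simp [f', hj, hi]
  have g'e : ∀ j i (hj : j < t) (hi : i < r ⟨j, hj⟩ - 1), g' j i = g ⟨j, hj⟩ ⟨i, hi⟩ :=
    fun j i hj hi => by simp [g', hj, hi]
  have h'e : ∀ j i (hj : j < t) (hi : i < s ⟨j, hj⟩ - 1), h' j i = h ⟨j, hj⟩ ⟨i, hi⟩ :=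
    fun j i hj hi => by simp [h', hj, hi]
  have ft0 : f' t 0 = y := by simp [f']
  have ft1 : f' t 1 = y' := by simp [f']
  have key := exists_isSquareHamiltonPath (H := H) (S := S) (x := x) (x' := x') t r' s' e' g' f' h'
    ?_ ?_ ?_ ?_ hx (by rw [ft0, ft1]; exact hy) ?_ ?_ ?_ ?_ ?_
  · rw [ft0, ft1] at key; exact key
  · intro j hj
    have h1 := hr2 ⟨j, hj⟩
    have h2 := hra ⟨j, hj⟩
    refine ⟨by rw [r'e j hj]; omega, fun i hi => ?_, fun i hi k hk => ?_⟩
    · rw [r'e j hj] at hi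
      rw [e'e j i hj (by omega), e'e j (i + 1) hj (by omega)]
      exact he _ _ _ rfl
    · rw [r'e j hj] at hi
      rw [g'e j i hj (by omega), e'e j _ hj (by omega)]
      exact hg _ _ _
  · intro j hj
    have h1 := hs2 ⟨j, hj⟩
    have h2 := hsb ⟨j, hj⟩
    refine ⟨by rw [s'e j hj]; omega, fun i hi => ?_, fun i hi k hk => ?_⟩
    · rw [s'e j hj] at hi
      rw [f'e j i hj (by omega), f'e j (i + 1) hj (by omega)]
      exact hf _ _ _ rfl
    · rw [s'e j hj] at hi
      rw [h'e j i hj (by omega), f'e j _ hj (by omega)]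
      exact hh _ _ _
  · intro j hj
    have h1 := hr2 ⟨j, hj⟩
    have h2 := hra ⟨j, hj⟩
    have h3 := hs2 ⟨j, hj⟩
    have h4 := hsb ⟨j, hj⟩
    rw [s'e j hj, e'e j 0 hj (by omega), e'e j 1 hj (by omega)]
    refine ⟨?_, ?_, ?_⟩ <;> rw [f'e j _ hj (by omega)] <;> refine hfe _ _ _ ?_ <;> simp only <;> omega
  · intro j hj
    have h1 := hr2 ⟨j, hj⟩
    have h2 := hra ⟨j, hj⟩
    have h3 := hs2 ⟨j, hj⟩
    have h4 := hsb ⟨j, hj⟩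
    rw [r'e j hj]
    by_cases hjt : j + 1 < t
    · rw [f'e (j + 1) 0 hjt (by omega), f'e (j + 1) 1 hjt (by omega)]
      refine ⟨?_, ?_, ?_⟩ <;> rw [e'e j _ hj (by omega)] <;>
        refine hef _ _ ?_ _ _ ?_ <;> simp
    · obtain rfl : j + 1 = t := by omega
      rw [ft0, ft1]
      refine ⟨?_, ?_, ?_⟩ <;> rw [e'e j _ hj (by omega)]
      · exact (hey _ rfl _).1
      · exact (hey _ rfl _).1
      · exact (hey _ rfl _).2
  · have h3 := hs2 ⟨0, ht⟩
    have h4 := hsb ⟨0, ht⟩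
    rw [f'e 0 0 ht (by omega)]
    exact (hxf _ rfl _ (by simp)).2
  · have h3 := hs2 ⟨0, ht⟩
    have h4 := hsb ⟨0, ht⟩
    rw [f'e 0 0 ht (by omega)]
    exact (hxf _ rfl _ (by simp)).1
  · have h3 := hs2 ⟨0, ht⟩
    have h4 := hsb ⟨0, ht⟩
    rw [f'e 0 1 ht (by omega)]
    exact (hxf _ rfl _ (by simp)).1
  · intro w
    rw [hS w, ft0, ft1]
    refine or_congr_right (or_congr_right (or_congr_left ?_))
    constructor
    · rintro ⟨j, h1⟩
      refine ⟨j, j.2, ?_⟩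
      rcases h1 with ⟨i, hi, h1⟩ | ⟨i, h1⟩ | ⟨i, hi, h1⟩ | ⟨i, h1⟩
      · exact Or.inl ⟨i, by rw [r'e j j.2]; exact hi, by rw [e'e j i j.2 i.2]; exact h1⟩
      · exact Or.inr (Or.inl ⟨i, by rw [r'e j j.2]; exact i.2, by rw [g'e j i j.2 i.2]; exact h1⟩)
      · exact Or.inr (Or.inr (Or.inl
          ⟨i, by rw [s'e j j.2]; exact hi, by rw [f'e j i j.2 i.2]; exact h1⟩))
      · exact Or.inr (Or.inr (Or.inr
          ⟨i, by rw [s'e j j.2]; exact i.2, by rw [h'e j i j.2 i.2]; exact h1⟩))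
    · rintro ⟨j, hj, h1⟩
      rw [r'e j hj, s'e j hj] at h1
      have h2 := hra ⟨j, hj⟩
      have h4 := hsb ⟨j, hj⟩
      refine ⟨⟨j, hj⟩, ?_⟩
      rcases h1 with ⟨i, hi, h1⟩ | ⟨i, hi, h1⟩ | ⟨i, hi, h1⟩ | ⟨i, hi, h1⟩
      · exact Or.inl ⟨⟨i, by omega⟩, hi, by rw [h1, e'e j i hj]⟩
      · exact Or.inr (Or.inl ⟨⟨i, hi⟩, by rw [h1, g'e j i hj]⟩)
      · exact Or.inr (Or.inr (Or.inl ⟨⟨i, by omega⟩, hi, by rw [h1, f'e j i hj]⟩))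
      · exact Or.inr (Or.inr (Or.inr ⟨⟨i, hi⟩, by rw [h1, h'e j i hj]⟩))
  · rw [hcard, Finset.sum_range]
    congr 1
    refine Finset.sum_congr rfl fun j _ => ?_
    rw [r'e j j.2, s'e j j.2]

/-! ### Inserting the remaining vertices into the gaps. -/

open Classical in
/-- A perfect matching between single vertices and the gaps between consecutive pairs of the
chunks. -/
theorem exists_singles_matching {X : Type*} [Fintype X] {t a : ℕ} (r : Fin t → ℕ)
    (hr2 : ∀ j, 2 ≤ r j) (hra : ∀ j, r j ≤ a) (ρ : X → Fin t → Prop) (m : ℝ)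
    (hcard : Fintype.card X = ∑ j, (r j - 1))
    (hX : ∀ x, m ≤ ((Finset.univ.filter fun j => ρ x j).card : ℝ))
    (hY : ∀ j, m ≤ ((Finset.univ.filter fun x => ρ x j).card : ℝ))
    (hXY : ∀ (A : Finset X) (J : Finset (Fin t)), m ≤ A.card → m ≤ a * J.card →
      ∃ x ∈ A, ∃ j ∈ J, ρ x j) :
    ∃ g : (j : Fin t) → Fin (r j - 1) → X, (∀ j k, ρ (g j k) j) ∧ ∀ x, ∃ j k, g j k = x := by
  have key := exists_bijective_of_robust
    (fun (q : Σ j : Fin t, Fin (r j - 1)) (x : X) => ρ x q.1) (by simp [hcard]) m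
    (fun q => hY q.1) ?_ ?_
  · obtain ⟨F, hF, hρ⟩ := key
    exact ⟨fun j k => F ⟨j, k⟩, fun j k => hρ ⟨j, k⟩, fun x => by
      obtain ⟨q, hq⟩ := hF.2 x
      exact ⟨q.1, q.2, hq⟩⟩
  · intro x
    refine (hX x).trans (Nat.cast_le.mpr ?_)
    refine Finset.card_le_card_of_injOn (fun j => ⟨j, ⟨0, by have := hr2 j; omega⟩⟩) ?_ ?_
    · intro j hj
      simpa using hj
    · intro j _ j' _ h
      exact congrArg Sigma.fst h
  · intro B A hB hA
    -- A chunk has fewer than a gaps, all with the same neighbours, so a large set of gaps meets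
    -- many chunks.
    have hcB : (B.card : ℝ) ≤ a * (B.image Sigma.fst).card := by
      have : B.card ≤ a * (B.image Sigma.fst).card := by
        refine Finset.card_le_mul_card_image _ _ fun j _ => ?_
        refine le_trans (Finset.card_le_card_of_injOn
          (t := Finset.univ.image fun k : Fin (r j - 1) => (⟨j, k⟩ : Σ j : Fin t, Fin (r j - 1)))
          id ?_ Function.injective_id.injOn) (Finset.card_image_le.trans ?_)
        · rintro ⟨j', k⟩ hq
          simp only [Finset.coe_filter, Set.mem_ofPred_eq] at hq
          obtain ⟨_, rfl⟩ := hq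
          simp
        · have := hra j
          simp; omega
      exact_mod_cast this
    obtain ⟨x, hx, j, hj, h⟩ := hXY A (B.image Sigma.fst) hA (hB.trans hcB)
    obtain ⟨q, hq, rfl⟩ := Finset.mem_image.mp hj
    exact ⟨q, hq, x, hx, h⟩

-- Turns the cardinality equations for U and V into equality between the number of vertices left
-- over and the number of gaps, without which Hall's theorem gives no bijection. Unused tails of
-- chunks count as left over.
open Classical in
theorem card_singles {Z : Type*} [Fintype Z] {t K : ℕ} (φ : Fin t → Fin K → Z)
    (hφ : Function.Injective (fun q : Fin t × Fin K => φ q.1 q.2)) (l : Fin t → ℕ)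
    (hl : ∀ j, l j ≤ K) (p p' : Z) (hp : p ≠ p') (hφp : ∀ j i, φ j i ≠ p ∧ φ j i ≠ p') :
    Nat.card {z : Z // z ≠ p ∧ z ≠ p' ∧ ∀ j (i : Fin _), (i : ℕ) < l j → φ j i ≠ z} + 2 + ∑ j, l j =
      Fintype.card Z := by
  rw [Nat.card_eq_fintype_card]
  let g : (Σ j : Fin t, Fin (l j)) → Z := fun q => φ q.1 ⟨q.2, q.2.2.trans_le (hl q.1)⟩
  have hg : Function.Injective g := by
    rintro ⟨j, i⟩ ⟨j', i'⟩ h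
    have := @hφ (j, ⟨i, _⟩) (j', ⟨i', _⟩) h
    simp only [Prod.mk.injEq, Fin.mk.injEq] at this
    obtain ⟨rfl, h2⟩ := this
    obtain rfl := Fin.ext h2
    rfl
  have hcompl : (Finset.univ.filter fun z : Z => ¬ (z ≠ p ∧ z ≠ p' ∧ ∀ j (i : Fin _), (i : ℕ) < l j → φ j i ≠ z)) =
      insert p (insert p' (Finset.univ.image g)) := by
    ext z
    simp only [Finset.mem_filter, Finset.mem_univ, true_and, Finset.mem_insert, Finset.mem_image,
      g, Sigma.exists]
    constructor
    · intro h
      by_contra hcon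
      push Not at hcon
      exact h ⟨hcon.1, hcon.2.1, fun j i hi => hcon.2.2 j ⟨i, hi⟩⟩
    · rintro (rfl | rfl | ⟨j, i, rfl⟩) ⟨h1, h2, h3⟩
      · exact h1 rfl
      · exact h2 rfl
      · exact h3 j _ i.2 rfl
  have h1 := Finset.card_filter_add_card_filter_not (s := (Finset.univ : Finset Z))
    (fun z : Z => z ≠ p ∧ z ≠ p' ∧ ∀ j (i : Fin _), (i : ℕ) < l j → φ j i ≠ z)
  rw [hcompl, Finset.card_insert_of_notMem, Finset.card_insert_of_notMem,
    Finset.card_image_of_injective _ hg, Finset.card_univ, Finset.card_univ, Fintype.card_sigma,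
    ← Fintype.card_subtype] at h1
  · simp only [Fintype.card_fin] at h1
    omega
  · simp only [Finset.mem_image, Finset.mem_univ, true_and, not_exists]
    exact fun q => (hφp _ _).2
  · simp only [Finset.mem_insert, Finset.mem_image, Finset.mem_univ, true_and, not_or, not_exists]
    exact ⟨hp, fun q => (hφp _ _).1⟩

open Classical in
/-- Chunks `e` in `V` and `f` in `U` satisfying robust matching conditions can be completed to the
square of a Hamilton path. -/
theorem exists_isSquareHamiltonPath_of_robust {W : Type*} {G : SimpleGraph W} {U V : Finset W}
    (hUV : Disjoint U V) {R : SimpleGraph {w // w ∈ U}} {S : SimpleGraph {w // w ∈ V}}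
    {x x' : {w // w ∈ V}} {y y' : {w // w ∈ U}} (hx : x ≠ x') (hy : y ≠ y') {t a b : ℕ} (ht : 0 < t)
    (r s : Fin t → ℕ) (hr2 : ∀ j, 2 ≤ r j) (hra : ∀ j, r j ≤ a) (hs2 : ∀ j, 2 ≤ s j)
    (hsb : ∀ j, s j ≤ b) (hcardU : U.card = 2 + ∑ j, 2 * s j + ∑ j, (r j - 1))
    (hcardV : V.card = 2 + ∑ j, 2 * r j + ∑ j, (s j - 1))
    (e : Fin t → Fin (2 * a) → {w // w ∈ V}) (f : Fin t → Fin (2 * b) → {w // w ∈ U})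
    (hei : Function.Injective (fun q : Fin t × Fin (2 * a) => e q.1 q.2))
    (hfi : Function.Injective (fun q : Fin t × Fin (2 * b) => f q.1 q.2))
    (he : ∀ j (i i' : Fin (2 * a)), (i : ℕ) + 1 = i' → S.Adj (e j i) (e j i'))
    (hf : ∀ j (i i' : Fin (2 * b)), (i : ℕ) + 1 = i' → R.Adj (f j i) (f j i'))
    (hex : ∀ j i, e j i ≠ x ∧ e j i ≠ x') (hfy : ∀ j i, f j i ≠ y ∧ f j i ≠ y')
    (hfe : ∀ j (i : Fin (2 * b)) i', 2 ≤ (i : ℕ) → G.Adj (f j i) (e j i'))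
    (hef : ∀ j j' : Fin t, (j : ℕ) + 1 = j' → ∀ (i : Fin (2 * b)) i', (i : ℕ) < 2 →
      G.Adj (f j' i) (e j i'))
    (hxf : ∀ j : Fin t, (j : ℕ) = 0 → ∀ i : Fin (2 * b), (i : ℕ) < 2 →
      G.Adj (f j i) x ∧ G.Adj (f j i) x')
    (hey : ∀ j : Fin t, (j : ℕ) + 1 = t → ∀ i, G.Adj y (e j i) ∧ G.Adj y' (e j i))
    (m : ℝ)
    (hU : ∀ u : {w // w ∈ U},
      m ≤ ((Finset.univ.filter fun j => ∀ i, G.Adj u (e j i)).card : ℝ))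
    (hV : ∀ v : {w // w ∈ V},
      m ≤ ((Finset.univ.filter fun j => ∀ i, G.Adj (f j i) v).card : ℝ))
    (hE : ∀ j, m ≤ ((Finset.univ.filter fun u : {w // w ∈ U} => (∀ i, G.Adj u (e j i)) ∧
      u ≠ y ∧ u ≠ y' ∧ ∀ j i, f j i ≠ u).card : ℝ))
    (hF : ∀ j, m ≤ ((Finset.univ.filter fun v : {w // w ∈ V} => (∀ i, G.Adj (f j i) v) ∧
      v ≠ x ∧ v ≠ x' ∧ ∀ j i, e j i ≠ v).card : ℝ))
    (hUE : ∀ (A : Finset {w // w ∈ U}) (J : Finset (Fin t)), m ≤ A.card → m ≤ a * J.card →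
      ∃ u ∈ A, ∃ j ∈ J, ∀ i, G.Adj u (e j i))
    (hVF : ∀ (A : Finset {w // w ∈ V}) (J : Finset (Fin t)), m ≤ A.card → m ≤ b * J.card →
      ∃ v ∈ A, ∃ j ∈ J, ∀ i, G.Adj (f j i) v) :
    ∃ l, IsSquareHamiltonPath (perturbedPair G U V R S) (U ∪ V) x x' y y' l := by
  set H := perturbedPair G U V R S
  have hHR : ∀ {u u' : {w // w ∈ U}}, R.Adj u u' → H.Adj u u' := fun {u u'} h =>
    Or.inl (Or.inr ((SimpleGraph.map_adj (Function.Embedding.subtype fun w => w ∈ U) R _ _).mpr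
      ⟨u, u', h, rfl, rfl⟩))
  have hHS : ∀ {v v' : {w // w ∈ V}}, S.Adj v v' → H.Adj v v' := fun {v v'} h =>
    Or.inr ((SimpleGraph.map_adj (Function.Embedding.subtype fun w => w ∈ V) S _ _).mpr
      ⟨v, v', h, rfl, rfl⟩)
  have hHG : ∀ {u : {w // w ∈ U}} {v : {w // w ∈ V}}, G.Adj u v → H.Adj u v := fun {u v} h =>
    Or.inl (Or.inl (SimpleGraph.between_adj.mpr ⟨h, Or.inl ⟨u.2, v.2⟩⟩))
  have hXc := card_singles f hfi (fun j => 2 * s j) (fun j => by have := hsb j; omega) y y' hy hfy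
  have hYc := card_singles e hei (fun j => 2 * r j) (fun j => by have := hra j; omega) x x' hx hex
  rw [Fintype.card_coe] at hXc hYc
  obtain ⟨g, hg, hgs⟩ := exists_singles_matching (X := {u : {w // w ∈ U} // u ≠ y ∧ u ≠ y' ∧
      ∀ j (i : Fin _), (i : ℕ) < 2 * s j → f j i ≠ u}) r hr2 hra (fun u j => ∀ i, G.Adj u.1 (e j i)) m
    (by rw [← Nat.card_eq_fintype_card]; omega) (fun u => by convert hU u.1) (fun j => by
      refine (hE j).trans (Nat.cast_le.mpr ?_)
      refine le_trans (Finset.card_le_card ?_)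
        (Finset.card_map (Function.Embedding.subtype _)).le
      intro u hu
      simp only [Finset.mem_filter, Finset.mem_univ, true_and, Finset.mem_map,
        Function.Embedding.coe_subtype, Subtype.exists, exists_and_right, exists_eq_right] at hu ⊢
      exact ⟨⟨hu.2.1, hu.2.2.1, fun j i _ => hu.2.2.2 j i⟩, hu.1⟩)
    (fun A J hA hJ => by
      obtain ⟨u, hu, j, hj, h⟩ := hUE (A.map (Function.Embedding.subtype _)) J
        (by rwa [Finset.card_map]) hJ
      obtain ⟨u', hu', rfl⟩ := Finset.mem_map.mp hu
      exact ⟨u', hu', j, hj, h⟩)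
  obtain ⟨h, hh, hhs⟩ := exists_singles_matching (X := {v : {w // w ∈ V} // v ≠ x ∧ v ≠ x' ∧
      ∀ j (i : Fin _), (i : ℕ) < 2 * r j → e j i ≠ v}) s hs2 hsb (fun v j => ∀ i, G.Adj (f j i) v.1) m
    (by rw [← Nat.card_eq_fintype_card]; omega) (fun v => by convert hV v.1) (fun j => by
      refine (hF j).trans (Nat.cast_le.mpr ?_)
      refine le_trans (Finset.card_le_card ?_)
        (Finset.card_map (Function.Embedding.subtype _)).le
      intro v hv
      simp only [Finset.mem_filter, Finset.mem_univ, true_and, Finset.mem_map,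
        Function.Embedding.coe_subtype, Subtype.exists, exists_and_right, exists_eq_right] at hv ⊢
      exact ⟨⟨hv.2.1, hv.2.2.1, fun j i _ => hv.2.2.2 j i⟩, hv.1⟩)
    (fun A J hA hJ => by
      obtain ⟨v, hv, j, hj, h⟩ := hVF (A.map (Function.Embedding.subtype _)) J
        (by rwa [Finset.card_map]) hJ
      obtain ⟨v', hv', rfl⟩ := Finset.mem_map.mp hv
      exact ⟨v', hv', j, hj, h⟩)
  refine exists_isSquareHamiltonPath_of_chunks ht r s hr2 hra hs2 hsb (fun j i => (e j i : W))
    (fun j i => (f j i : W)) (fun j k => ((g j k).1 : W)) (fun j k => ((h j k).1 : W))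
    (fun j i i' hi => hHS (he j i i' hi)) (fun j i i' hi => hHR (hf j i i' hi))
    (fun j k i => hHG (hg j k i)) (fun j k i => (hHG (hh j k i)).symm)
    (fun j i i' hi => hHG (hfe j i i' hi))
    (fun j j' hj i i' hi => (hHG (hef j j' hj i i' hi)).symm)
    (fun j hj i hi => ⟨(hHG (hxf j hj i hi).1).symm, (hHG (hxf j hj i hi).2).symm⟩)
    (fun j hj i => ⟨(hHG (hey j hj i).1).symm, (hHG (hey j hj i).2).symm⟩)
    (fun h => hx (Subtype.ext h)) (fun h => hy (Subtype.ext h)) ?_ ?_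
  · intro w
    rw [Finset.mem_union]
    constructor
    · rintro (hw | hw)
      · by_cases hcase : (⟨w, hw⟩ : {w // w ∈ U}) ≠ y ∧ (⟨w, hw⟩ : {w // w ∈ U}) ≠ y' ∧
          ∀ j (i : Fin _), (i : ℕ) < 2 * s j → f j i ≠ ⟨w, hw⟩
        · obtain ⟨j, k, hk⟩ := hgs ⟨_, hcase⟩
          exact Or.inr (Or.inr (Or.inl ⟨j, Or.inr (Or.inl ⟨k, by rw [hk]⟩)⟩))
        · by_cases h1 : (⟨w, hw⟩ : {w // w ∈ U}) = y
          · exact Or.inr (Or.inr (Or.inr (Or.inl (congrArg Subtype.val h1))))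
          by_cases h2 : (⟨w, hw⟩ : {w // w ∈ U}) = y'
          · exact Or.inr (Or.inr (Or.inr (Or.inr (congrArg Subtype.val h2))))
          have h3 : ∃ j, ∃ i : Fin _, (i : ℕ) < 2 * s j ∧ f j i = ⟨w, hw⟩ := by
            by_contra hcon
            push Not at hcon
            exact hcase ⟨h1, h2, hcon⟩
          obtain ⟨j, i, hi, h4⟩ := h3
          exact Or.inr (Or.inr (Or.inl ⟨j, Or.inr (Or.inr (Or.inl ⟨i, hi, by rw [h4]⟩))⟩))
      · by_cases hcase : (⟨w, hw⟩ : {w // w ∈ V}) ≠ x ∧ (⟨w, hw⟩ : {w // w ∈ V}) ≠ x' ∧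
          ∀ j (i : Fin _), (i : ℕ) < 2 * r j → e j i ≠ ⟨w, hw⟩
        · obtain ⟨j, k, hk⟩ := hhs ⟨_, hcase⟩
          exact Or.inr (Or.inr (Or.inl ⟨j, Or.inr (Or.inr (Or.inr ⟨k, by rw [hk]⟩))⟩))
        · by_cases h1 : (⟨w, hw⟩ : {w // w ∈ V}) = x
          · exact Or.inr (Or.inl (congrArg Subtype.val h1))
          by_cases h2 : (⟨w, hw⟩ : {w // w ∈ V}) = x'
          · exact Or.inl (congrArg Subtype.val h2)
          have h3 : ∃ j, ∃ i : Fin _, (i : ℕ) < 2 * r j ∧ e j i = ⟨w, hw⟩ := by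
            by_contra hcon
            push Not at hcon
            exact hcase ⟨h1, h2, hcon⟩
          obtain ⟨j, i, hi, h4⟩ := h3
          exact Or.inr (Or.inr (Or.inl ⟨j, Or.inl ⟨i, hi, by rw [h4]⟩⟩))
    · rintro (rfl | rfl | ⟨j, ⟨i, -, rfl⟩ | ⟨i, rfl⟩ | ⟨i, -, rfl⟩ | ⟨i, rfl⟩⟩ | rfl | rfl)
      · exact Or.inr x'.2
      · exact Or.inr x.2
      · exact Or.inr (e j i).2
      · exact Or.inl (g j i).1.2
      · exact Or.inl (f j i).2
      · exact Or.inr (h j i).1.2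
      · exact Or.inl y.2
      · exact Or.inl y'.2
  · rw [Finset.card_union_of_disjoint hUV, hcardU, hcardV]
    simp only [Finset.sum_add_distrib]
    ring

/-! ### Typical chunks in a random graph. -/

theorem natCard_exists_le {Ω ι : Type*} [Finite Ω] [Fintype ι] (P : ι → Ω → Prop) :
    Nat.card {σ : Ω // ∃ i, P i σ} ≤ ∑ i, Nat.card {σ : Ω // P i σ} := by
  rw [← Nat.card_sigma]
  refine Nat.card_le_card_of_surjective
    (fun q : Σ i, {σ : Ω // P i σ} => (⟨q.2.1, q.1, q.2.2⟩ : {σ : Ω // ∃ i, P i σ})) ?_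
  rintro ⟨σ, i, h⟩
  exact ⟨⟨i, σ, h⟩, rfl⟩

theorem natCard_or_le {Ω : Type*} [Finite Ω] (P Q : Ω → Prop) :
    Nat.card {σ : Ω // P σ ∨ Q σ} ≤ Nat.card {σ : Ω // P σ} + Nat.card {σ : Ω // Q σ} := by
  rw [← Nat.card_sum]
  refine Nat.card_le_card_of_surjective
    (Sum.elim (fun q : {σ : Ω // P σ} => (⟨q.1, Or.inl q.2⟩ : {σ : Ω // P σ ∨ Q σ}))
      (fun q : {σ : Ω // Q σ} => ⟨q.1, Or.inr q.2⟩)) ?_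
  rintro ⟨σ, h | h⟩
  · exact ⟨Sum.inl ⟨σ, h⟩, rfl⟩
  · exact ⟨Sum.inr ⟨σ, h⟩, rfl⟩

theorem exists_linear_mul_pow_le (a ρ η : ℝ) (hρ0 : 0 < ρ) (hρ1 : ρ < 1) (hη : 0 < η) :
    ∃ z₀ : ℕ, ∀ z : ℕ, z₀ ≤ z → a * z * ρ ^ z ≤ η := by
  have h := (tendsto_self_mul_const_pow_of_lt_one hρ0.le hρ1).const_mul a
  rw [mul_zero] at h
  obtain ⟨z₀, hz₀⟩ := Filter.eventually_atTop.mp (h.eventually (ge_mem_nhds hη))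
  exact ⟨z₀, fun z hz => by rw [mul_assoc]; exact hz₀ z hz⟩

open Classical in
/-- A binomial random graph contains a family of disjoint paths on `K` vertices which is typical
with respect to two lower-regular relations and to a linear number of product sets. -/
theorem exists_robust_chunks (K : ℕ) (hK0 : 0 < K) (c ν δ : ℝ) (hc : 0 < c) (hc1 : c ≤ 1)
    (hν : 0 < ν) (hδ : 0 < δ) (hδ1 : δ ≤ 1) :
    ∃ c' : ℝ, 0 < c' ∧ ∃ C : ℝ, 0 < C ∧ ∀ d₁ d₂ α γ : ℝ, 0 < d₁ → d₁ ≤ 1 → 0 < d₂ → d₂ ≤ 1 →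
      0 < α → 0 < γ → ∃ ε : ℝ, 0 < ε ∧ ∀ η : ℝ, 0 < η → ∃ z₀ : ℕ,
      ∀ (Z T₁ T₂ : Type*) [Fintype Z] [Fintype T₁] [Fintype T₂],
      z₀ ≤ Fintype.card Z → Fintype.card T₁ ≤ 2 * Fintype.card Z →
      Fintype.card T₂ ≤ 2 * Fintype.card Z → ∀ (Rel₁ : Fin K → Z → T₁ → Prop)
      (Rel₂ : Fin K → Z → T₂ → Prop), (∀ i, IsLowerRegular (Rel₁ i) ε d₁) →
      (∀ i, IsLowerRegular (Rel₂ i) ε d₂) → ∀ N : ℕ, (N * K : ℝ) ≤ (1 - δ) * Fintype.card Z →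
      ∀ (ι : Type*) [Fintype ι], Fintype.card ι ≤ 10 * Fintype.card Z →
      ∀ (J : ι → Finset (Fin N)) (X : ι → Fin K → Finset Z),
      (∀ k, ν * Fintype.card Z ≤ (J k).card) → (∀ k i, c * Fintype.card Z ≤ (X k i).card) →
      ∀ p : unitInterval, C / (Fintype.card Z : ℝ) ≤ p →
      1 - η ≤ (SimpleGraph.binomialRandom Z p).real {G | ∃ φ : Fin N → Fin K → Z,
        Function.Injective (fun q : Fin N × Fin K => φ q.1 q.2) ∧
        (∀ j (i i' : Fin K), (i : ℕ) + 1 = i' → G.Adj (φ j i) (φ j i')) ∧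
        (∀ T' : Finset T₁, α * Fintype.card T₁ ≤ T'.card → ((Finset.univ.filter fun j =>
          ((commonRel Rel₁ T' (φ j)).card : ℝ) < d₁ ^ K * T'.card).card : ℝ) ≤
            γ * Fintype.card Z) ∧
        (∀ T' : Finset T₂, α * Fintype.card T₂ ≤ T'.card → ((Finset.univ.filter fun j =>
          ((commonRel Rel₂ T' (φ j)).card : ℝ) < d₂ ^ K * T'.card).card : ℝ) ≤
            γ * Fintype.card Z) ∧
        ∀ k, c' * Fintype.card Z ≤ (((J k).filter fun j => ∀ i, φ j i ∈ X k i).card : ℝ)} := by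
  obtain ⟨c', hc', ρ, hρ0, hρ1, z₁, hz₁, hfew⟩ := card_perm_few_chunks_le K hK0 c ν hc hc1 hν
  obtain ⟨C, hC, hmain⟩ := exists_random_chunks δ hδ
  refine ⟨c', hc', C, hC, fun d₁ d₂ α γ hd₁ hd₁' hd₂ hd₂' hα hγ => ?_⟩
  obtain ⟨ε₁, hε₁, h1⟩ := card_perm_common_nbrs_le K hK0 d₁ α γ δ hd₁ hd₁' hα hγ hδ hδ1
  obtain ⟨ε₂, hε₂, h2⟩ := card_perm_common_nbrs_le K hK0 d₂ α γ δ hd₂ hd₂' hα hγ hδ hδ1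
  refine ⟨min ε₁ ε₂, lt_min hε₁ hε₂, fun η hη => ?_⟩
  obtain ⟨z₂, hz₂⟩ := hmain η hη
  obtain ⟨z₃, hz₃⟩ := exists_linear_mul_pow_le 2 (1 / 2) (η / 4) (by norm_num) (by norm_num)
    (by positivity)
  obtain ⟨z₄, hz₄⟩ := exists_linear_mul_pow_le 10 ρ (η / 4) hρ0 hρ1 (by positivity)
  refine ⟨z₁ + z₂ + z₃ + z₄, ?_⟩
  intro Z T₁ T₂ _ _ _ hZ hT₁ hT₂ Rel₁ Rel₂ hR₁ hR₂ N hN ι _ hι J X hJ hX p hp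
  set z := Fintype.card Z
  have hz0 : 0 < z := by omega
  refine (hz₂ Z (by omega) p hp N K hN {φ | (∃ T' : Finset T₁, α * Fintype.card T₁ ≤ T'.card ∧
      γ * z < ((Finset.univ.filter fun j =>
          ((commonRel Rel₁ T' (φ j)).card : ℝ) < d₁ ^ K * T'.card).card : ℝ)) ∨
      (∃ T' : Finset T₂, α * Fintype.card T₂ ≤ T'.card ∧ γ * z < ((Finset.univ.filter fun j =>
          ((commonRel Rel₂ T' (φ j)).card : ℝ) < d₂ ^ K * T'.card).card : ℝ)) ∨
      ∃ k, (((J k).filter fun j => ∀ i, φ j i ∈ X k i).card : ℝ) < c' * z} ?_).trans ?_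
  · intro b hb
    have e1 := h1 Z T₁ hz0 hT₁ Rel₁ (fun i => (hR₁ i).mono (min_le_left _ _)) N hN b hb
    have e2 := h2 Z T₂ hz0 hT₂ Rel₂ (fun i => (hR₂ i).mono (min_le_right _ _)) N hN b hb
    have e3 : (Nat.card {σ : Equiv.Perm Z // ∃ k, (((J k).filter fun j =>
        ∀ i, σ (b j i) ∈ X k i).card : ℝ) < c' * z} : ℝ) ≤ 10 * z * ρ ^ z * z.factorial := by
      refine (Nat.cast_le.mpr (natCard_exists_le _)).trans ?_
      push_cast
      refine (Finset.sum_le_sum fun k _ => hfew Z (by omega) N b hb (J k) (hJ k) (X k) (hX k)).trans ?_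
      rw [Finset.sum_const, nsmul_eq_mul, Finset.card_univ, ← mul_assoc]
      have : (Fintype.card ι : ℝ) ≤ 10 * z := by exact_mod_cast hι
      gcongr
    have e4 := hz₃ z (by omega)
    have e5 := hz₄ z (by omega)
    have hf : (0 : ℝ) < z.factorial := by positivity
    have e6 : (1 / 2 : ℝ) ^ z + (1 / 2) ^ z ≤ η / 4 := by
      have h3 : (1 : ℝ) ≤ z := by exact_mod_cast hz0
      have h4 : (0 : ℝ) ≤ (1 / 2) ^ z := by positivity
      nlinarith
    refine (Nat.cast_le.mpr (natCard_or_le _ _)).trans ?_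
    push_cast
    have e7 := natCard_or_le (fun σ : Equiv.Perm Z => ∃ T' : Finset T₂,
      α * Fintype.card T₂ ≤ T'.card ∧ γ * z < ((Finset.univ.filter fun j =>
          ((commonRel Rel₂ T' (fun i => σ (b j i))).card : ℝ) < d₂ ^ K * T'.card).card : ℝ))
      (fun σ => ∃ k, (((J k).filter fun j => ∀ i, σ (b j i) ∈ X k i).card : ℝ) < c' * z)
    have e8 := (Nat.cast_le (α := ℝ)).mpr e7
    push_cast at e8
    have e9 := mul_le_mul_of_nonneg_right e6 hf.le
    have e10 := mul_le_mul_of_nonneg_right e5 hf.le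
    have e11 := add_le_add e1 (e8.trans (add_le_add e2 e3))
    refine e11.trans ?_
    nlinarith
  · refine MeasureTheory.measureReal_mono ?_ (MeasureTheory.measure_ne_top _ _)
    rintro G ⟨φ, hφ1, hφ2, hφ3⟩
    refine ⟨φ, hφ1, hφ2, ?_⟩
    simp only [Set.mem_ofPred_eq, not_or, not_exists, not_and, not_lt] at hφ3
    exact hφ3

open Classical in
/-- Selecting `t` good indices out of `t + q`, when at most `q` are bad; a given good index can be
made the last one. -/
theorem exists_selection {N t q : ℕ} (ht : 0 < t) (J : Finset (Fin N)) (hJ : J.card = t + q)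
    (P : Fin N → Prop) (hP : (J.filter fun j => ¬ P j).card ≤ q) (j₀ : Fin N) (hj₀ : j₀ ∈ J)
    (hPj₀ : P j₀) :
    ∃ ι : Fin t → Fin N, Function.Injective ι ∧ (∀ j, ι j ∈ J) ∧ (∀ j, P (ι j)) ∧
      (∀ j : Fin t, (j : ℕ) + 1 = t → ι j = j₀) ∧
      ∀ (Q : Fin N → Prop) [DecidablePred Q], (J.filter Q).card ≤ (Finset.univ.filter fun j => Q (ι j)).card + q := by
  have h1 := Finset.card_filter_add_card_filter_not (s := J) P
  obtain ⟨A, hA1, hA2, hA3⟩ := Finset.exists_subsuperset_card_eq (s := {j₀}) (t := J.filter P)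
    (n := t) (by simp [hj₀, hPj₀]) (by rw [Finset.card_singleton]; omega) (by omega)
  let F : Fin t ≃ A := (A.equivFinOfCardEq hA3).symm
  let l : Fin t := ⟨t - 1, by omega⟩
  let k : Fin t := F.symm ⟨j₀, hA1 (by simp)⟩
  -- The transposition puts j₀ in the last place.
  let E : Fin t ≃ A := (Equiv.swap l k).trans F
  have hEA : ∀ j, (E j : Fin N) ∈ J.filter P := fun j => hA2 (E j).2
  have hEi : Function.Injective fun j => (E j : Fin N) := Subtype.val_injective.comp E.injective
  refine ⟨fun j => E j, hEi,
    fun j => (Finset.mem_filter.mp (hEA j)).1, fun j => (Finset.mem_filter.mp (hEA j)).2, ?_, ?_⟩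
  · intro j hj
    have : j = l := Fin.ext (by simp [l]; omega)
    simp [E, this, k]
  · intro Q _
    have h2 : (J.filter Q) ⊆ ((Finset.univ.filter fun j => Q (E j)).image fun j => (E j : Fin N)) ∪
        (J \ A) := by
      intro j hj
      rw [Finset.mem_filter] at hj
      rw [Finset.mem_union]
      by_cases hjA : j ∈ A
      · refine Or.inl (Finset.mem_image.mpr ⟨E.symm ⟨j, hjA⟩, ?_, by simp⟩)
        simpa using hj.2
      · exact Or.inr (Finset.mem_sdiff.mpr ⟨hj.1, hjA⟩)
    have hAJ : A ⊆ J := hA2.trans (Finset.filter_subset _ _)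
    have h3 := (Finset.card_le_card h2).trans (Finset.card_union_le _ _)
    rw [Finset.card_image_of_injective _ hEi, Finset.card_sdiff_of_subset hAJ, hJ, hA3] at h3
    beta_reduce
    omega

open Classical in
theorem card_chunks_containing_le {Z : Type*} {N K : ℕ} (φ : Fin N → Fin K → Z)
    (hφ : Function.Injective (fun q : Fin N × Fin K => φ q.1 q.2)) (z : Z) :
    (Finset.univ.filter fun j => ∃ i, φ j i = z).card ≤ 1 := by
  rw [Finset.card_le_one]
  intro j hj j' hj'
  obtain ⟨i, hi⟩ := (Finset.mem_filter.mp hj).2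
  obtain ⟨i', hi'⟩ := (Finset.mem_filter.mp hj').2
  exact congrArg Prod.fst (@hφ (j, i) (j', i') (hi.trans hi'.symm))

open Classical in
/-- Chunks typical with respect to a lower-regular relation `A`, avoiding two given vertices and
with the last chunk inside a given large set. -/
theorem exists_typical_chunks (K : ℕ) (hK0 : 0 < K) (d : ℝ) (hd0 : 0 < d) (hd1 : d ≤ 1) :
    ∃ c : ℝ, 0 < c ∧ ∃ C : ℝ, 0 < C ∧ ∀ α γ : ℝ, 0 < α → α ≤ 1 → 0 < γ → ∃ ε : ℝ, 0 < ε ∧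
      ∀ η : ℝ, 0 < η → ∃ z₀ : ℕ, ∀ (Z T : Type*) [Fintype Z] [Fintype T],
      z₀ ≤ Fintype.card Z → Fintype.card T ≤ 2 * Fintype.card Z → ∀ A : Z → T → Prop,
      IsLowerRegular A ε d →
      (∀ u, d * Fintype.card Z ≤ ((Finset.univ.filter fun v => A v u).card : ℝ)) →
      ∀ Y₀ : Finset Z, d ^ 2 / 2 * Fintype.card Z ≤ Y₀.card → ∀ (x x' : Z) (t q : ℕ), 0 < t →
      (Fintype.card Z : ℝ) / 200 ≤ t + q → (t + q : ℝ) * K ≤ 19 / 20 * Fintype.card Z →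
      γ * Fintype.card Z + 2 ≤ q → q ≤ c / 2 * Fintype.card Z →
      ∀ p : unitInterval, C / (Fintype.card Z : ℝ) ≤ p →
      1 - η ≤ (SimpleGraph.binomialRandom Z p).real {G | ∃ e : Fin t → Fin K → Z,
        Function.Injective (fun q : Fin t × Fin K => e q.1 q.2) ∧
        (∀ j (i i' : Fin K), (i : ℕ) + 1 = i' → G.Adj (e j i) (e j i')) ∧
        (∀ j i, e j i ≠ x ∧ e j i ≠ x') ∧ (∀ j : Fin t, (j : ℕ) + 1 = t → ∀ i, e j i ∈ Y₀) ∧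
        (∀ j, d ^ K * Fintype.card T ≤
          ((Finset.univ.filter fun u => ∀ i, A (e j i) u).card : ℝ)) ∧
        (∀ u, c / 2 * Fintype.card Z ≤
          ((Finset.univ.filter fun j => ∀ i, A (e j i) u).card : ℝ)) ∧
        (∀ X : Finset T, α * Fintype.card T ≤ X.card → ((Finset.univ.filter fun j =>
          ((X.filter fun u => ∀ i, A (e j i) u).card : ℝ) < d ^ K * X.card).card : ℝ) ≤
            γ * Fintype.card Z)} := by
  have hd2 : d ^ 2 ≤ 1 := pow_le_one₀ hd0.le hd1
  have hd3 : d ^ 2 / 2 ≤ d := by nlinarith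
  obtain ⟨c, hc, C, hC, hmain⟩ := exists_robust_chunks K hK0 (d ^ 2 / 2) (1 / 200) (1 / 20)
    (by positivity) (by linarith) (by norm_num) (by norm_num) (by norm_num)
  refine ⟨c, hc, C, hC, fun α γ hα hα1 hγ => ?_⟩
  obtain ⟨ε, hε, hmain⟩ := hmain d d α γ hd0 hd1 hd0 hd1 hα hγ
  refine ⟨ε, hε, fun η hη => ?_⟩
  obtain ⟨z₀, hz₀⟩ := hmain η hη
  refine ⟨z₀ + 1, ?_⟩
  intro Z T _ _ hZ hT A hA hdeg Y₀ hY₀ x x' t q ht hN1 hN2 hq1 hq2 p hp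
  have hz0 : (0 : ℝ) < Fintype.card Z := by
    have : 0 < Fintype.card Z := by omega
    exact_mod_cast this
  have hTz : Fintype.card (Option T) ≤ 10 * Fintype.card Z := by
    rw [Fintype.card_option]; omega
  -- Only one relation is needed, so it fills both slots. The index `none` asks for chunks inside
  -- Y₀, the index `some u` for chunks inside the neighbourhood of u.
  refine (hz₀ Z T T (by omega) hT hT (fun _ => A) (fun _ => A) (fun _ => hA) (fun _ => hA) (t + q)
    (by push_cast; linarith) (Option T) hTz (fun _ => Finset.univ)
    (fun k _ => k.elim Y₀ fun u => Finset.univ.filter fun v => A v u) ?_ ?_ p hp).trans ?_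
  · intro k
    rw [Finset.card_univ, Fintype.card_fin]; push_cast; linarith
  · intro k _
    cases k with
    | none => exact hY₀
    | some u =>
      refine le_trans ?_ (hdeg u)
      gcongr
  refine MeasureTheory.measureReal_mono ?_ (MeasureTheory.measure_ne_top _ _)
  rintro G ⟨φ, hφi, hφc, hreg, -, hfew⟩
  simp only [commonRel] at hreg
  let P : Fin (t + q) → Prop := fun j => d ^ K * Fintype.card T ≤
    ((Finset.univ.filter fun u => ∀ i, A (φ j i) u).card : ℝ) ∧ ∀ i, φ j i ≠ x ∧ φ j i ≠ x'
  have hP : (Finset.univ.filter fun j => ¬ P j).card ≤ q := by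
    have h1 := hreg Finset.univ (by
      rw [Finset.card_univ]
      nlinarith [(Nat.cast_nonneg (Fintype.card T) : (0 : ℝ) ≤ _)])
    have h2 : (Finset.univ.filter fun j => ¬ P j) ⊆
        (Finset.univ.filter fun j => ((Finset.univ.filter fun u => ∀ i, A (φ j i) u).card : ℝ) <
          d ^ K * (Finset.univ : Finset T).card) ∪
        ((Finset.univ.filter fun j => ∃ i, φ j i = x) ∪
          (Finset.univ.filter fun j => ∃ i, φ j i = x')) := by
      intro j hj
      simp only [Finset.mem_filter, Finset.mem_univ, true_and, Finset.mem_union] at hj ⊢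
      by_contra hcon
      push Not at hcon
      refine hj ⟨?_, fun i => ⟨hcon.2.1 i, hcon.2.2 i⟩⟩
      rw [← Finset.card_univ]
      exact hcon.1
    have h3 := (Finset.card_le_card h2).trans ((Finset.card_union_le _ _).trans
      (Nat.add_le_add_left (Finset.card_union_le _ _) _))
    have h4 := card_chunks_containing_le φ hφi x
    have h5 := card_chunks_containing_le φ hφi x'
    have h6 : ((Finset.univ.filter fun j => ¬ P j).card : ℝ) ≤ q := by
      have h7 := (Nat.cast_le (α := ℝ)).mpr (h3.trans (Nat.add_le_add_left (Nat.add_le_add h4 h5) _))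
      push_cast at h7
      linarith
    exact_mod_cast h6
  -- At least c|Z| chunks lie in Y₀, while at most q ≤ (c/2)|Z| are discarded.
  have hj₀ : ∃ j₀, P j₀ ∧ ∀ i, φ j₀ i ∈ Y₀ := by
    by_contra hcon
    push Not at hcon
    have h1 := hfew none
    have h2 : (Finset.univ.filter fun j => ∀ i, φ j i ∈ Y₀) ⊆
        Finset.univ.filter fun j => ¬ P j := by
      intro j hj
      simp only [Finset.mem_filter, Finset.mem_univ, true_and] at hj ⊢
      intro hPj
      obtain ⟨i, hi⟩ := hcon j hPj
      exact hi (hj i)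
    have h3 := (Nat.cast_le (α := ℝ)).mpr ((Finset.card_le_card h2).trans hP)
    have h4 : c * Fintype.card Z ≤ ((Finset.univ.filter fun j => ∀ i, φ j i ∈ Y₀).card : ℝ) := h1
    nlinarith
  obtain ⟨j₀, hPj₀, hY⟩ := hj₀
  obtain ⟨ι, hι, -, hιP, hlast, hcount⟩ := exists_selection (q := q) ht Finset.univ (by simp) P
    (by convert hP) j₀
    (Finset.mem_univ _) hPj₀
  refine ⟨fun j => φ (ι j), ?_, fun j => hφc (ι j), fun j => (hιP j).2, ?_, fun j => (hιP j).1,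
    ?_, ?_⟩
  · rintro ⟨j, i⟩ ⟨j', i'⟩ h
    have := @hφi (ι j, i) (ι j', i') h
    rw [Prod.mk.injEq] at this
    exact Prod.ext (hι this.1) this.2
  · intro j hj i
    beta_reduce
    rw [hlast j hj]
    exact hY i
  · intro u
    have h1 : c * Fintype.card Z ≤ ((Finset.univ.filter fun j => ∀ i, A (φ j i) u).card : ℝ) := by
      refine (hfew (some u)).trans (le_of_eq ?_)
      congr 3
      ext j; simp
    have h2 := (Nat.cast_le (α := ℝ)).mpr (hcount fun j => ∀ i, A (φ j i) u)
    push_cast at h2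
    beta_reduce
    linarith
  · intro X hX
    refine le_trans (Nat.cast_le.mpr ?_) (hreg X hX)
    rw [← Finset.card_image_of_injective _ hι]
    refine Finset.card_le_card fun j hj => ?_
    obtain ⟨j, hj', rfl⟩ := Finset.mem_image.mp hj
    simpa using hj'

/-! ### Chunks of the second class fitted into the gaps of the first. -/

-- Interchanges the roles of vertices and indices by double counting. More than ε|Z| elements with
-- too few indices in T' would form a large set X with fewer than (d/2)|X||T'| related pairs. But
-- all but B ≤ |T'|/2 indices of T' are related to at least d|X| elements of X.
open Classical in
theorem isLowerRegular_of_few_bad {Z : Type*} [Fintype Z] {t : ℕ} (R : Z → Fin t → Prop)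
    {α ε d B : ℝ} (hd : 0 < d) (hα : α ≤ ε) (hε : 0 < ε) (hB : 2 * B ≤ ε * t)
    (h : ∀ X : Finset Z, α * Fintype.card Z ≤ X.card → ((Finset.univ.filter fun j =>
      ((X.filter fun u => R u j).card : ℝ) < d * X.card).card : ℝ) ≤ B) :
    IsLowerRegular R ε (d / 2) := by
  intro T' hT'
  rw [Fintype.card_fin] at hT'
  set X := Finset.univ.filter fun z => ((T'.filter fun t => R z t).card : ℝ) < d / 2 * T'.card
  by_contra hlt
  push Not at hlt
  have hX0 : (0 : ℝ) < X.card := lt_of_le_of_lt (by positivity) hlt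
  have h1 := h X ((mul_le_mul_of_nonneg_right hα (Nat.cast_nonneg _)).trans hlt.le)
  set D := Finset.univ.filter fun j => ((X.filter fun u => R u j).card : ℝ) < d * X.card
  have h2 : ∑ u ∈ X, ((T'.filter fun j => R u j).card : ℝ) =
      ∑ j ∈ T', ((X.filter fun u => R u j).card : ℝ) := by
    exact_mod_cast Finset.sum_card_bipartiteAbove_eq_sum_card_bipartiteBelow R
  have h3 : ∑ u ∈ X, ((T'.filter fun j => R u j).card : ℝ) < X.card * (d / 2 * T'.card) := by
    rw [← nsmul_eq_mul, ← Finset.sum_const]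
    refine Finset.sum_lt_sum_of_nonempty ?_ fun u hu => (Finset.mem_filter.mp hu).2
    exact Finset.card_pos.mp (by exact_mod_cast hX0)
  have h4 : ((T' \ D).card : ℝ) * (d * X.card) ≤ ∑ j ∈ T', ((X.filter fun u => R u j).card : ℝ) := by
    rw [← nsmul_eq_mul, ← Finset.sum_const]
    refine (Finset.sum_le_sum fun j hj => ?_).trans
      (Finset.sum_le_sum_of_subset_of_nonneg Finset.sdiff_subset fun _ _ _ => Nat.cast_nonneg _)
    have := (Finset.mem_sdiff.mp hj).2
    simpa [D] using this
  have h5 : (T'.card : ℝ) ≤ (T' \ D).card + B := by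
    have := Finset.card_le_card_sdiff_add_card (s := T') (t := D)
    have h6 := (Nat.cast_le (α := ℝ)).mpr this
    push_cast at h6
    linarith
  have h7 : ((T' \ D).card : ℝ) * (d * X.card) < T'.card / 2 * (d * X.card) := by
    calc _ ≤ _ := h4
      _ < X.card * (d / 2 * T'.card) := h2 ▸ h3
      _ = _ := by ring
  have h8 := lt_of_mul_lt_mul_right h7 (by positivity)
  linarith

open Classical in
/-- The vertex `u` is related to all entries of the chunk before position `j`, where the chunk before
the first one consists of `x` and `x'`. -/
def PrevRel {Z T : Type*} {t k : ℕ} (A : Z → T → Prop) (e : Fin t → Fin k → T) (x x' : T)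
    (u : Z) (j : Fin t) : Prop :=
  ((j : ℕ) = 0 → A u x ∧ A u x') ∧ ∀ j' : Fin t, (j' : ℕ) + 1 = j → ∀ i, A u (e j' i)

/-- The relation of a vertex in position `i` of a chunk to the gap before position `j` of the
sequence `e`: the first two vertices are joined to the preceding chunk, all others to the
following one. -/
def GapRel {Z T : Type*} {t k K : ℕ} (A : Z → T → Prop) (e : Fin t → Fin k → T) (x x' : T)
    (i : Fin K) (u : Z) (j : Fin t) : Prop :=
  if (i : ℕ) < 2 then PrevRel A e x x' u j else ∀ i', A u (e j i')

open Classical in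
theorem card_filter_gapRel {Z T : Type*} [Fintype Z] {t k K : ℕ} (A : Z → T → Prop)
    (e : Fin t → Fin k → T) (x x' : T) (i : Fin K) (j : Fin t) (X : Finset Z) (c : ℝ)
    (hx : (j : ℕ) = 0 → c ≤ ((X.filter fun u => A u x ∧ A u x').card : ℝ))
    (he : ∀ j' : Fin t, (j' : ℕ) + 1 = j ∨ j' = j →
      c ≤ ((X.filter fun u => ∀ i', A u (e j' i')).card : ℝ)) :
    c ≤ ((X.filter fun u => GapRel A e x x' i u j).card : ℝ) := by
  by_cases hi : (i : ℕ) < 2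
  · simp only [GapRel, hi, if_true]
    by_cases hj : (j : ℕ) = 0
    · refine (hx hj).trans (Nat.cast_le.mpr (Finset.card_le_card ?_))
      intro u hu
      rw [Finset.mem_filter] at hu ⊢
      exact ⟨hu.1, fun _ => hu.2, fun j' hj' => by omega⟩
    · have hlt : (j : ℕ) - 1 < t := by have := j.2; omega
      refine (he ⟨j - 1, hlt⟩ (Or.inl (by simp only; omega))).trans
        (Nat.cast_le.mpr (Finset.card_le_card ?_))
      intro u hu
      rw [Finset.mem_filter] at hu ⊢
      refine ⟨hu.1, fun h => absurd h hj, fun j' hj' => ?_⟩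
      have : j' = ⟨j - 1, hlt⟩ := Fin.ext (by simp only; omega)
      rw [this]
      exact hu.2
  · simp only [GapRel, hi, if_false]
    exact he j (Or.inr rfl)

-- The gap before chunk j is governed by chunk j - 1 or by chunk j, so a bad gap comes from a bad
-- chunk through an injective shift. The first gap has no preceding chunk and may be bad by itself,
-- which is the 1 in B + 1.
open Classical in
theorem isLowerRegular_gapRel {Z T : Type*} [Fintype Z] {t k K : ℕ} (A : Z → T → Prop)
    (e : Fin t → Fin k → T) (x x' : T) {α ε d B : ℝ} (hd : 0 < d) (hα : α ≤ ε) (hε : 0 < ε)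
    (hB : 2 * (B + 1) ≤ ε * t)
    (h : ∀ X : Finset Z, α * Fintype.card Z ≤ X.card → ((Finset.univ.filter fun j =>
      ((X.filter fun u => ∀ i, A u (e j i)).card : ℝ) < d * X.card).card : ℝ) ≤ B) (i : Fin K) :
    IsLowerRegular (GapRel A e x x' i) ε (d / 2) := by
  refine isLowerRegular_of_few_bad _ hd hα hε hB fun X hX => ?_
  have h1 := h X hX
  set D := Finset.univ.filter fun j => ((X.filter fun u => ∀ i, A u (e j i)).card : ℝ) < d * X.card
  set D' := Finset.univ.filter fun j =>
    ((X.filter fun u => GapRel A e x x' i u j).card : ℝ) < d * X.card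
  have h2 : D'.card ≤ D.card + 1 := by
    by_cases hi : (i : ℕ) < 2
    · let g : Fin t → Option (Fin t) := fun j =>
        if hj : (j : ℕ) = 0 then none else some ⟨j - 1, by have := j.2; omega⟩
      have hg : Function.Injective g := by
        intro j j' hjj
        simp only [g] at hjj
        split_ifs at hjj with h3 h4 h4
        · exact Fin.ext (by omega)
        · simp only [Option.some.injEq, Fin.mk.injEq] at hjj
          exact Fin.ext (by omega)
      rw [← Finset.card_insertNone, ← Finset.card_image_of_injective _ hg]
      refine Finset.card_le_card fun j hj => ?_
      obtain ⟨j, hj₁, rfl⟩ := Finset.mem_image.mp hj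
      have hj' := (Finset.mem_filter.mp hj₁).2
      simp only [g]
      split_ifs with h3
      · simp
      · rw [Finset.some_mem_insertNone]
        refine Finset.mem_filter.mpr ⟨Finset.mem_univ _, lt_of_le_of_lt (Nat.cast_le.mpr
          (Finset.card_le_card ?_)) hj'⟩
        intro u hu
        rw [Finset.mem_filter] at hu ⊢
        refine ⟨hu.1, ?_⟩
        simp only [GapRel, hi, if_true]
        refine ⟨fun h => absurd h h3, fun j' hj' => ?_⟩
        have : j' = ⟨j - 1, by have := j.2; omega⟩ := Fin.ext (by simp only; omega)
        rw [this]
        exact hu.2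
    · have : D' = D := by
        ext j
        simp only [D, D', GapRel, hi, if_false]
      rw [this]
      omega
  have h3 := (Nat.cast_le (α := ℝ)).mpr h2
  push_cast at h3
  linarith

set_option maxHeartbeats 1000000 in
open Classical in
/-- Given chunks `e` in the first class, a binomial random graph on the second class contains
chunks `f` that fit into the gaps between consecutive chunks of `e` and are otherwise typical. -/
theorem exists_matched_chunks (K : ℕ) (hK0 : 0 < K) (d d₁ : ℝ) (hd0 : 0 < d) (hd1 : d ≤ 1)
    (hd₁0 : 0 < d₁) (hd₁1 : d₁ ≤ 1) :
    ∃ c : ℝ, 0 < c ∧ ∃ C : ℝ, 0 < C ∧ ∀ α γ : ℝ, 0 < α → α ≤ 1 → 0 < γ → ∃ ε : ℝ, 0 < ε ∧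
      ∀ η : ℝ, 0 < η → ∃ z₀ : ℕ, ∀ (Z T : Type*) [Fintype Z] [Fintype T],
      z₀ ≤ Fintype.card Z → Fintype.card T ≤ 2 * Fintype.card Z → ∀ A : Z → T → Prop,
      IsLowerRegular A ε d →
      (∀ v, d * Fintype.card Z ≤ ((Finset.univ.filter fun u => A u v).card : ℝ)) →
      ∀ x x' : T, d ^ 2 / 2 * Fintype.card Z ≤
        ((Finset.univ.filter fun u => A u x ∧ A u x').card : ℝ) →
      ∀ (y y' : Z) (t q s k : ℕ), 0 < t → t ≤ 2 * Fintype.card Z →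
      (Fintype.card Z : ℝ) / 10000 ≤ t → (Fintype.card Z : ℝ) / 10000 ≤ s →
      (t + q + s : ℝ) * K ≤ 19 / 20 * Fintype.card Z →
      ∀ e : Fin t → Fin k → T,
      (∀ j, d₁ * Fintype.card Z ≤
        ((Finset.univ.filter fun u => ∀ i, A u (e j i)).card : ℝ)) →
      ∀ α₁ B : ℝ, (∀ X : Finset Z, α₁ * Fintype.card Z ≤ X.card → ((Finset.univ.filter fun j =>
        ((X.filter fun u => ∀ i, A u (e j i)).card : ℝ) < d₁ * X.card).card : ℝ) ≤ B) →
      α₁ ≤ ε → 2 * (B + 1) ≤ ε * t → 2 * (γ * Fintype.card Z) + 2 ≤ q →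
      ∀ (m b : ℝ), 0 < m → 0 ≤ b → m + q + 2 ≤ c * Fintype.card Z → m ≤ (d₁ / 2) ^ K * t →
      α * t ≤ m → α * Fintype.card T ≤ m → γ * Fintype.card Z < m →
      b * (γ * Fintype.card Z) < m →
      α * Fintype.card T ≤
        ((Finset.univ.filter fun v : T => v ≠ x ∧ v ≠ x' ∧ ∀ j i, e j i ≠ v).card : ℝ) →
      m ≤ d ^ K *
        ((Finset.univ.filter fun v : T => v ≠ x ∧ v ≠ x' ∧ ∀ j i, e j i ≠ v).card : ℝ) →
      ∀ p : unitInterval, C / (Fintype.card Z : ℝ) ≤ p →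
      1 - η ≤ (SimpleGraph.binomialRandom Z p).real {G | ∃ f : Fin t → Fin K → Z,
        Function.Injective (fun q : Fin t × Fin K => f q.1 q.2) ∧
        (∀ j (i i' : Fin K), (i : ℕ) + 1 = i' → G.Adj (f j i) (f j i')) ∧
        (∀ j i, f j i ≠ y ∧ f j i ≠ y') ∧ (∀ j i, GapRel A e x x' i (f j i) j) ∧
        (∀ v, m ≤ ((Finset.univ.filter fun j => ∀ i, A (f j i) v).card : ℝ)) ∧
        (∀ j, m ≤ ((Finset.univ.filter fun v => (∀ i, A (f j i) v) ∧
          v ≠ x ∧ v ≠ x' ∧ ∀ j i, e j i ≠ v).card : ℝ)) ∧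
        (∀ (D : Finset T) (J : Finset (Fin t)), m ≤ D.card → m ≤ b * J.card →
          ∃ v ∈ D, ∃ j ∈ J, ∀ i, A (f j i) v) ∧
        (∀ j, m ≤ ((Finset.univ.filter fun u => (∀ i, A u (e j i)) ∧
          u ≠ y ∧ u ≠ y' ∧ ∀ j i, f j i ≠ u).card : ℝ))} := by
  have hd2 : d ^ 2 ≤ 1 := pow_le_one₀ hd0.le hd1
  have hd3 : d ^ 2 / 2 ≤ d := by nlinarith
  set c₀ : ℝ := min (d ^ 2 / 2) d₁
  have hc₀1 : c₀ ≤ d ^ 2 / 2 := min_le_left _ _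
  have hc₀2 : c₀ ≤ d₁ := min_le_right _ _
  obtain ⟨c, hc, C, hC, hmain⟩ := exists_robust_chunks K hK0 c₀ (1 / 10000) (1 / 20)
    (by positivity) (by linarith) (by norm_num) (by norm_num) (by norm_num)
  refine ⟨c, hc, C, hC, fun α γ hα hα1 hγ => ?_⟩
  obtain ⟨ε, hε, hmain⟩ := hmain d (d₁ / 2) α γ hd0 hd1 (by positivity) (by linarith) hα hγ
  refine ⟨ε, hε, fun η hη => ?_⟩
  obtain ⟨z₀, hz₀⟩ := hmain η hη
  refine ⟨z₀ + 1, ?_⟩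
  intro Z T _ _ hZ hT A hA hdeg x x' hxx y y' t q s k ht ht2 htZ hsZ hN e he5 α₁ B he7 hα₁ hB hq m b
    hm hb hmc hmt hαt hαT hγm hbγ hVα hVm p hp
  have hz0 : (0 : ℝ) < Fintype.card Z := by
    have : 0 < Fintype.card Z := by omega
    exact_mod_cast this
  -- The chunks are split in advance: t of the first t + q become f, and the last s form a reserve
  -- whose vertices stay free for insertion into the chunks of e.
  let Jm : Finset (Fin (t + q + s)) := Finset.univ.filter fun j => (j : ℕ) < t + q
  let Js : Finset (Fin (t + q + s)) := Finset.univ.filter fun j => ¬ (j : ℕ) < t + q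
  have hJm : Jm.card = t + q := by
    rw [Fin.card_filter_val_lt]; omega
  have hJs : Js.card = s := by
    have := Finset.card_filter_add_card_filter_not (s := (Finset.univ : Finset (Fin (t + q + s))))
      (fun j => (j : ℕ) < t + q)
    rw [Finset.card_univ, Fintype.card_fin] at this
    have h2 : Jm.card + Js.card = t + q + s := this
    omega
  -- Three kinds of boxes: the neighbourhood of each v, the vertices fitting each gap position by
  -- position, and the common neighbourhood of each chunk of e. The last kind is imposed on the
  -- reserve.
  let Xf : T ⊕ (Fin t ⊕ Fin t) → Fin K → Finset Z := fun k i =>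
    Sum.elim (fun v => Finset.univ.filter fun u => A u v)
      (Sum.elim (fun j => Finset.univ.filter fun u => GapRel A e x x' i u j)
        (fun j => Finset.univ.filter fun u => ∀ i', A u (e j i'))) k
  let Jf : T ⊕ (Fin t ⊕ Fin t) → Finset (Fin (t + q + s)) :=
    Sum.elim (fun _ => Jm) (Sum.elim (fun _ => Jm) (fun _ => Js))
  refine (hz₀ Z T (Fin t) (by omega) hT (by simpa using ht2) (fun _ => A)
    (fun i => GapRel A e x x' i) (fun _ => hA)
    (fun i => isLowerRegular_gapRel A e x x' hd₁0 hα₁ hε hB he7 i) (t + q + s)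
    (by push_cast; linarith) (T ⊕ (Fin t ⊕ Fin t))
    (by rw [Fintype.card_sum, Fintype.card_sum, Fintype.card_fin]; omega) Jf Xf ?_ ?_ p hp).trans ?_
  · have h1 : (1 / 10000 : ℝ) * Fintype.card Z ≤ Jm.card := by
      rw [hJm]; push_cast
      linarith [(Nat.cast_nonneg q : (0 : ℝ) ≤ q)]
    rintro (v | j | j)
    · exact h1
    · exact h1
    · change (1 / 10000 : ℝ) * Fintype.card Z ≤ Js.card
      rw [hJs]; linarith
  · rintro (v | j | j) i
    · refine le_trans ?_ (hdeg v)
      have := hc₀1.trans hd3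
      gcongr
    · refine card_filter_gapRel A e x x' i j Finset.univ _ (fun _ => le_trans ?_ hxx)
        (fun j' _ => le_trans ?_ (he5 j')) <;> gcongr
    · refine le_trans ?_ (he5 j)
      gcongr
  refine MeasureTheory.measureReal_mono ?_ (MeasureTheory.measure_ne_top _ _)
  rintro G ⟨φ, hφi, hφc, hreg1, hreg2, hfew⟩
  simp only [commonRel] at hreg1 hreg2
  set V₀ : Finset T := Finset.univ.filter fun v : T => v ≠ x ∧ v ≠ x' ∧ ∀ j i, e j i ≠ v
  let P₁ : Fin (t + q + s) → Prop := fun j =>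
    d ^ K * V₀.card ≤ ((V₀.filter fun v => ∀ i, A (φ j i) v).card : ℝ)
  let P₂ : Fin (t + q + s) → Prop := fun j => (d₁ / 2) ^ K * (Finset.univ : Finset (Fin t)).card ≤
    ((Finset.univ.filter fun j' => ∀ i, GapRel A e x x' i (φ j i) j').card : ℝ)
  let P : Fin (t + q + s) → Prop := fun j => P₁ j ∧ P₂ j ∧ ∀ i, φ j i ≠ y ∧ φ j i ≠ y'
  have hP : (Jm.filter fun j => ¬ P j).card ≤ q := by
    have h1 := hreg1 V₀ hVα
    have h1' := hreg2 Finset.univ (by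
      rw [Finset.card_univ]
      nlinarith [(Nat.cast_nonneg (Fintype.card (Fin t)) : (0 : ℝ) ≤ _)])
    have h2 : (Jm.filter fun j => ¬ P j) ⊆
        ((Finset.univ.filter fun j => ((V₀.filter fun v => ∀ i, A (φ j i) v).card : ℝ) <
          d ^ K * V₀.card) ∪
        (Finset.univ.filter fun j =>
          ((Finset.univ.filter fun j' => ∀ i, GapRel A e x x' i (φ j i) j').card : ℝ) <
          (d₁ / 2) ^ K * (Finset.univ : Finset (Fin t)).card)) ∪
        ((Finset.univ.filter fun j => ∃ i, φ j i = y) ∪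
          (Finset.univ.filter fun j => ∃ i, φ j i = y')) := by
      intro j hj
      simp only [Finset.mem_filter, Finset.mem_univ, true_and, Finset.mem_union] at hj ⊢
      by_contra hcon
      push Not at hcon
      exact hj.2 ⟨hcon.1.1, hcon.1.2, fun i => ⟨hcon.2.1 i, hcon.2.2 i⟩⟩
    have h3 := (Finset.card_le_card h2).trans ((Finset.card_union_le _ _).trans
      (Nat.add_le_add (Finset.card_union_le _ _) (Finset.card_union_le _ _)))
    have h4 := card_chunks_containing_le φ hφi y
    have h5 := card_chunks_containing_le φ hφi y'
    have h6 : ((Jm.filter fun j => ¬ P j).card : ℝ) ≤ q := by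
      have h7 := (Nat.cast_le (α := ℝ)).mpr (h3.trans (Nat.add_le_add_left (Nat.add_le_add h4 h5) _))
      push_cast at h7
      linarith
    exact_mod_cast h6
  have hj₀ : ∃ j₀ ∈ Jm, P j₀ := by
    by_contra hcon
    push Not at hcon
    have : (Jm.filter fun j => ¬ P j) = Jm := Finset.filter_true_of_mem hcon
    rw [this, hJm] at hP
    omega
  obtain ⟨j₀, hj₀, hPj₀⟩ := hj₀
  obtain ⟨ι, hι, hιJ, hιP, -, hcount⟩ := exists_selection (q := q) ht Jm hJm P
    (by convert hP) j₀ hj₀ hPj₀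
  have hcountι : ∀ (π : Fin t → Fin t), Function.Injective π → ∀ Q : Fin (t + q + s) → Prop,
      (Finset.univ.filter fun j => Q (ι (π j))).card ≤ (Finset.univ.filter Q).card := by
    intro π hπ Q
    rw [← Finset.card_image_of_injective _ (hι.comp hπ)]
    refine Finset.card_le_card fun j hj => ?_
    obtain ⟨j', hj', rfl⟩ := Finset.mem_image.mp hj
    simpa using hj'
  -- Hall's theorem between gaps and selected chunks. Gaps have large degree by the box condition,
  -- chunks by `P₂`, and large sets are joined because few chunks are atypical for a given set of
  -- gaps.
  obtain ⟨π, hπ, hgap⟩ := exists_bijective_of_robust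
    (fun (j : Fin t) (j' : Fin t) => ∀ i, GapRel A e x x' i (φ (ι j') i) j) rfl m
    (by
      intro j
      have h1 := hfew (Sum.inr (Sum.inl j))
      have h2 := hcount fun j' => ∀ i, φ j' i ∈ Xf (Sum.inr (Sum.inl j)) i
      have h3 := h1.trans ((Nat.cast_le (α := ℝ)).mpr h2)
      push_cast at h3
      have h4 : m ≤ ((Finset.univ.filter fun j' =>
        ∀ i, φ (ι j') i ∈ Xf (Sum.inr (Sum.inl j)) i).card : ℝ) := by linarith
      refine h4.trans (Nat.cast_le.mpr (Finset.card_le_card fun j' hj' => ?_))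
      simpa [Xf] using hj')
    (by
      intro j
      have h1 := (hιP j).2.1
      simp only [P₂] at h1
      rw [Finset.card_univ, Fintype.card_fin] at h1
      refine (hmt.trans h1).trans (Nat.cast_le.mpr (Finset.card_le_card fun j' hj' => ?_))
      simpa using hj')
    (by
      intro D J hD hJ
      by_contra hcon
      push Not at hcon
      have h1 := hreg2 D (by rw [Fintype.card_fin]; linarith)
      have h2 : (J.card : ℝ) ≤ γ * Fintype.card Z := by
        refine le_trans (Nat.cast_le.mpr (le_trans (Finset.card_le_card ?_)
          (hcountι id Function.injective_id _))) h1
        intro j hj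
        simp only [Finset.mem_filter, Finset.mem_univ, true_and]
        have h3 : (D.filter fun j' => ∀ i, GapRel A e x x' i (φ (ι (id j)) i) j') = ∅ := by
          refine Finset.filter_eq_empty_iff.mpr fun j' hj' hall => ?_
          obtain ⟨i, hi⟩ := hcon j' hj' j hj
          exact hi (hall i)
        rw [h3, Finset.card_empty, Nat.cast_zero]
        have : 0 < (D.card : ℝ) := by linarith
        positivity
      linarith)
  have hfi : Function.Injective (fun q : Fin t × Fin K => φ (ι (π q.1)) q.2) := by
    rintro ⟨j, i⟩ ⟨j', i'⟩ h
    have := @hφi (ι (π j), i) (ι (π j'), i') h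
    rw [Prod.mk.injEq] at this
    exact Prod.ext (hπ.1 (hι this.1)) this.2
  refine ⟨fun j => φ (ι (π j)), hfi, fun j => hφc _, fun j => (hιP _).2.2, hgap, ?_, ?_, ?_, ?_⟩
  · intro v
    have h1 := hfew (Sum.inl v)
    have h2 := hcount fun j' => ∀ i, φ j' i ∈ Xf (Sum.inl v) i
    have h3 := h1.trans ((Nat.cast_le (α := ℝ)).mpr h2)
    push_cast at h3
    have h4 : m ≤ ((Finset.univ.filter fun j' =>
      ∀ i, φ (ι j') i ∈ Xf (Sum.inl v) i).card : ℝ) := by linarith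
    refine h4.trans (Nat.cast_le.mpr ?_)
    rw [← Finset.card_map (Equiv.ofBijective π hπ).symm.toEmbedding]
    refine Finset.card_le_card fun j hj => ?_
    obtain ⟨j', hj', rfl⟩ := Finset.mem_map.mp hj
    have h5 : π ((Equiv.ofBijective π hπ).symm j') = j' :=
      (Equiv.ofBijective π hπ).apply_symm_apply j'
    simpa [Xf, h5] using hj'
  · intro j
    have h1 : d ^ K * V₀.card ≤ ((V₀.filter fun v => ∀ i, A (φ (ι (π j)) i) v).card : ℝ) :=
      (hιP (π j)).1
    refine (hVm.trans h1).trans (Nat.cast_le.mpr (Finset.card_le_card fun v hv => ?_))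
    simp only [V₀, Finset.mem_filter, Finset.mem_univ, true_and] at hv ⊢
    exact ⟨hv.2, hv.1⟩
  · intro D J hD hJ
    by_contra hcon
    push Not at hcon
    have h1 := hreg1 D (by linarith)
    have h2 : (J.card : ℝ) ≤ γ * Fintype.card Z := by
      refine le_trans (Nat.cast_le.mpr (le_trans (Finset.card_le_card ?_)
        (hcountι π hπ.1 _))) h1
      intro j hj
      simp only [Finset.mem_filter, Finset.mem_univ, true_and]
      have h3 : (D.filter fun v => ∀ i, A (φ (ι (π j)) i) v) = ∅ := by
        refine Finset.filter_eq_empty_iff.mpr fun v hv hall => ?_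
        obtain ⟨i, hi⟩ := hcon v hv j hj
        exact hi (hall i)
      rw [h3, Finset.card_empty, Nat.cast_zero]
      have : 0 < (D.card : ℝ) := by linarith
      positivity
    have h4 := mul_le_mul_of_nonneg_left h2 hb
    linarith
  · intro j
    have h1 := hfew (Sum.inr (Sum.inr j))
    set S : Finset Z := Finset.univ.filter fun u => (∀ i, A u (e j i)) ∧
      ∀ j' i, φ (ι (π j')) i ≠ u
    -- The first vertices of the reserve chunks lying in the common neighbourhood of chunk j are
    -- distinct and unused by f.
    have h2 : c * Fintype.card Z ≤ S.card := by
      refine h1.trans (Nat.cast_le.mpr (Finset.card_le_card_of_injOn (fun j' => φ j' ⟨0, hK0⟩) ?_ ?_))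
      · intro j' hj'
        simp only [Finset.coe_filter, Set.mem_ofPred_eq, S, Finset.mem_univ, true_and, Jf, Xf,
          Sum.elim_inr, Finset.mem_filter, Js] at hj' ⊢
        refine ⟨hj'.2 ⟨0, hK0⟩, fun j'' i hji => ?_⟩
        have h3 := @hφi (ι (π j''), i) (j', ⟨0, hK0⟩) hji
        rw [Prod.mk.injEq] at h3
        have h4 := (Finset.mem_filter.mp (hιJ (π j''))).2
        rw [h3.1] at h4
        exact hj'.1 h4
      · intro j' _ j'' _ hji
        exact congrArg Prod.fst (@hφi (j', ⟨0, hK0⟩) (j'', ⟨0, hK0⟩) hji)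
    have h3 : S.card ≤ ((S.erase y).erase y').card + 2 := by
      have h4 := Finset.pred_card_le_card_erase (s := S) (a := y)
      have h5 := Finset.pred_card_le_card_erase (s := S.erase y) (a := y')
      omega
    have h4 : (S.card : ℝ) ≤ ((S.erase y).erase y').card + 2 := by exact_mod_cast h3
    have h5 : m ≤ (((S.erase y).erase y').card : ℝ) := by
      linarith [(Nat.cast_nonneg q : (0 : ℝ) ≤ q)]
    refine h5.trans (Nat.cast_le.mpr (Finset.card_le_card fun u hu => ?_))
    simp only [S, Finset.mem_erase, Finset.mem_filter, Finset.mem_univ, true_and] at hu ⊢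
    exact ⟨hu.2.2.1, hu.2.1, hu.1, hu.2.2.2⟩

/-! ### Super-regular pairs, segment lengths and product measures. -/

open Classical in
theorem exists_degree_ge_of_edgeDensity {W : Type*} (G : SimpleGraph W) {d : ℝ} {X Y : Finset W}
    (hY : Y.Nonempty) (h : d ≤ ((G.edgeDensity X Y : ℚ) : ℝ)) :
    ∃ y ∈ Y, d * X.card ≤ ((X.filter fun x => G.Adj x y).card : ℝ) := by
  by_contra hcon
  push Not at hcon
  have h1 : ((G.interedges X Y).card : ℝ) = ∑ y ∈ Y, ((X.filter fun x => G.Adj x y).card : ℝ) := by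
    rw [SimpleGraph.interedges_def, Finset.card_filter, Finset.sum_product_right]
    push_cast
    simp only [Finset.card_filter, Nat.cast_sum, Nat.cast_ite, Nat.cast_one, Nat.cast_zero]
  have h2 : ((G.interedges X Y).card : ℝ) < Y.card * (d * X.card) := by
    rw [h1, ← nsmul_eq_mul, ← Finset.sum_const]
    exact Finset.sum_lt_sum_of_nonempty hY hcon
  have hX : (0 : ℝ) < X.card := by
    rcases Finset.eq_empty_or_nonempty X with rfl | hX
    · simp [SimpleGraph.interedges_def] at h2
    · exact_mod_cast Finset.card_pos.mpr hX
  have hY0 : (0 : ℝ) < Y.card := by exact_mod_cast Finset.card_pos.mpr hY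
  rw [SimpleGraph.edgeDensity_def] at h
  push_cast at h
  rw [le_div_iff₀ (by positivity)] at h
  linarith [mul_comm d ((X.card : ℝ) * Y.card)]

-- The atypical vertices, if too many, would form together with T' a pair of large sets of density
-- below d.
open Classical in
theorem isLowerRegular_of_density {W : Type*} {G : SimpleGraph W} {U V : Finset W} {ε d : ℝ}
    (hε : 0 ≤ ε)
    (h : ∀ X ⊆ U, ∀ Y ⊆ V, ε * (U.card : ℝ) ≤ X.card → ε * (V.card : ℝ) ≤ Y.card →
      d ≤ ((G.edgeDensity X Y : ℚ) : ℝ)) :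
    IsLowerRegular (fun (v : {w // w ∈ V}) (u : {w // w ∈ U}) => G.Adj u v) ε d := by
  intro T' hT'
  rw [Fintype.card_coe] at hT' ⊢
  by_contra hlt
  push Not at hlt
  set B := Finset.univ.filter fun v : {w // w ∈ V} =>
    ((T'.filter fun u : {w // w ∈ U} => G.Adj u.1 v.1).card : ℝ) < d * T'.card
  have hB : B.Nonempty := by
    rw [← Finset.card_pos]
    have : (0 : ℝ) < B.card := lt_of_le_of_lt (by positivity) hlt
    exact_mod_cast this
  obtain ⟨y, hy, hyd⟩ := exists_degree_ge_of_edgeDensity G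
    (X := T'.map (Function.Embedding.subtype _)) (Y := B.map (Function.Embedding.subtype _))
    (by simpa using hB) (h _ (by intro w hw; simp at hw; exact hw.1) _
      (by intro w hw; simp at hw; exact hw.1) (by simpa using hT') (by simpa using hlt.le))
  obtain ⟨v, hv, rfl⟩ := Finset.mem_map.mp hy
  have hv' := (Finset.mem_filter.mp hv).2
  rw [Finset.card_map] at hyd
  refine absurd hv' (not_lt.mpr (hyd.trans (Nat.cast_le.mpr ?_)))
  rw [Finset.filter_map, Finset.card_map]
  exact Finset.card_le_card fun w hw =>
    Finset.mem_filter.mpr (Finset.mem_filter.mp hw)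

open Classical in
theorem card_filter_subtype_eq_ncard {W : Type*} (S : Finset W) (P : W → Prop) :
    (Finset.univ.filter fun w : {w // w ∈ S} => P w).card = Set.ncard {w : W | w ∈ S ∧ P w} := by
  rw [← Finset.card_map (Function.Embedding.subtype _), ← Set.ncard_coe_finset]
  congr 1
  ext w
  simp [and_comm]

/-- Taking the first length as small as allowed, but at least R - kt, leaves a remainder that the
other t lengths can absorb. -/
theorem exists_lengths (k t R : ℕ) (hk : 2 ≤ k) (h1 : 2 * t ≤ R) (h2 : R ≤ k * t) :
    ∃ r : Fin t → ℕ, (∀ j, 2 ≤ r j) ∧ (∀ j, r j ≤ k) ∧ ∑ j, r j = R := by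
  induction t generalizing R with
  | zero => exact ⟨fun _ => 2, by simp, fun j => j.elim0, by simp at h2 ⊢; omega⟩
  | succ t ih =>
    rw [mul_add, mul_one] at h2
    have hkt : 2 * t ≤ k * t := Nat.mul_le_mul_right t hk
    obtain ⟨r, hr1, hr2, hr3⟩ := ih (R - max 2 (R - k * t)) (by omega) (by omega)
    refine ⟨Fin.cons (max 2 (R - k * t)) r, ?_, ?_, ?_⟩
    · intro j
      refine Fin.cases ?_ (fun j => ?_) j
      · simp
      · simpa using hr1 j
    · intro j
      refine Fin.cases ?_ (fun j => ?_) j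
      · simp; omega
      · simpa using hr2 j
    · rw [Fin.sum_univ_succ]
      simp only [Fin.cons_zero, Fin.cons_succ, hr3]
      omega

/-- With R and S the sums of the lengths, the two equations become 3R = 2n + t - m - 2 and 3S = 2m +
t - n - 2. A suitable residue of t modulo 3 makes both divisible. From t ≥ n/100 and 3n/4 ≤ m ≤ n
follow R ≤ 43t and S ≤ 34t, which fixes the chunk lengths. -/
theorem exists_segment_lengths (n m : ℕ) (hn : 1000 ≤ n) (hm1 : 3 * n ≤ 4 * m) (hm2 : m ≤ n) :
    ∃ t : ℕ, n ≤ 100 * t ∧ 100 * t ≤ n + 300 ∧ ∃ r s : Fin t → ℕ, (∀ j, 2 ≤ r j) ∧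
      (∀ j, r j ≤ 43) ∧ (∀ j, 2 ≤ s j) ∧ (∀ j, s j ≤ 34) ∧
      m = 2 + ∑ j, 2 * s j + ∑ j, (r j - 1) ∧ n = 2 + ∑ j, 2 * r j + ∑ j, (s j - 1) := by
  obtain ⟨t, ht1, ht2, ht3⟩ : ∃ t : ℕ, n ≤ 100 * t ∧ 100 * t ≤ n + 300 ∧
      (2 * n + t) % 3 = (m + 2) % 3 := by
    have : (2 * n + (n / 100 + 1)) % 3 = (m + 2) % 3 ∨ (2 * n + (n / 100 + 2)) % 3 = (m + 2) % 3 ∨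
        (2 * n + (n / 100 + 3)) % 3 = (m + 2) % 3 := by
      have hmod : ∀ a b : ℕ, (a + 1) % 3 = b % 3 ∨ (a + 2) % 3 = b % 3 ∨ (a + 3) % 3 = b % 3 := by
        omega
      simpa only [add_assoc] using hmod (2 * n + n / 100) (m + 2)
    rcases this with h | h | h
    · exact ⟨n / 100 + 1, by omega, by omega, h⟩
    · exact ⟨n / 100 + 2, by omega, by omega, h⟩
    · exact ⟨n / 100 + 3, by omega, by omega, h⟩
  obtain ⟨R, hR⟩ : ∃ R, 3 * R + m + 2 = 2 * n + t := ⟨(2 * n + t - m - 2) / 3, by omega⟩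
  obtain ⟨S, hS⟩ : ∃ S, 3 * S + n + 2 = 2 * m + t := ⟨(2 * m + t - n - 2) / 3, by omega⟩
  obtain ⟨r, hr1, hr2, hr3⟩ := exists_lengths 43 t R (by norm_num) (by omega) (by omega)
  obtain ⟨s, hs1, hs2, hs3⟩ := exists_lengths 34 t S (by norm_num) (by omega) (by omega)
  have hsub : ∀ f : Fin t → ℕ, (∀ j, 2 ≤ f j) → ∑ j, (f j - 1) + t = ∑ j, f j := by
    intro f hf
    have : ∑ j, (f j - 1) + ∑ _j : Fin t, 1 = ∑ j, f j := by
      rw [← Finset.sum_add_distrib]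
      exact Finset.sum_congr rfl fun j _ => by have := hf j; omega
    simpa using this
  have h1 := hsub r hr1
  have h2 := hsub s hs1
  refine ⟨t, ht1, ht2, r, s, hr1, hr2, hs1, hs2, ?_, ?_⟩
  · rw [← Finset.mul_sum]; omega
  · rw [← Finset.mul_sum]; omega

/-- A lower bound for the probability of an event in a product space in terms of the second
coordinate and the corresponding slices. -/
theorem prod_real_ge_of_slices {X Y : Type*} [Finite X] [Finite Y] [MeasurableSpace X]
    [MeasurableSpace Y] [MeasurableSingletonClass X] [MeasurableSingletonClass Y]
    (μ : MeasureTheory.Measure X) (ν : MeasureTheory.Measure Y)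
    [MeasureTheory.IsProbabilityMeasure μ] [MeasureTheory.IsProbabilityMeasure ν]
    (E : Set (X × Y)) (F : Set Y) (η : ℝ) (hη : 0 ≤ η) (hη1 : η ≤ 1) (hF : 1 - η ≤ ν.real F)
    (hE : ∀ y ∈ F, 1 - η ≤ μ.real {x | (x, y) ∈ E}) :
    1 - 2 * η ≤ (μ.prod ν).real E := by
  have h1 : ENNReal.ofReal (1 - η) * ν F ≤ (μ.prod ν) E := by
    rw [MeasureTheory.Measure.prod_apply_symm (Set.toFinite E).measurableSet,
      ← MeasureTheory.setLIntegral_const]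
    refine (MeasureTheory.setLIntegral_mono' (Set.toFinite F).measurableSet fun y hy => ?_).trans
      (MeasureTheory.setLIntegral_le_lintegral F _)
    exact ENNReal.ofReal_le_of_le_toReal (hE y hy)
  have h2 : (1 - η) * ν.real F ≤ (μ.prod ν).real E := by
    have := ENNReal.toReal_mono (MeasureTheory.measure_ne_top _ _) h1
    rwa [ENNReal.toReal_mul, ENNReal.toReal_ofReal (by linarith)] at this
  have h3 := mul_le_mul_of_nonneg_left hF (show 0 ≤ 1 - η by linarith)
  nlinarith

-- An index related to nothing in D is bad for D, and J has more than B elements.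
open Classical in
theorem exists_related_of_few_bad {X : Type*} {t : ℕ} (R : X → Fin t → Prop) {d B : ℝ}
    (hd : 0 < d) (D : Finset X) (J : Finset (Fin t)) (hD : 0 < D.card) (hJ : B < J.card)
    (h : ((Finset.univ.filter fun j =>
      ((D.filter fun u => R u j).card : ℝ) < d * D.card).card : ℝ) ≤ B) :
    ∃ u ∈ D, ∃ j ∈ J, R u j := by
  by_contra hcon
  push Not at hcon
  refine absurd (hJ.trans_le (le_trans (Nat.cast_le.mpr (Finset.card_le_card fun j hj => ?_)) h))
    (lt_irrefl _)
  have hD' : (0 : ℝ) < D.card := by exact_mod_cast hD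
  rw [Finset.mem_filter, Finset.filter_false_of_mem fun u hu => hcon u hu j hj]
  exact ⟨Finset.mem_univ _, by simpa using mul_pos hd hD'⟩

open Classical in
theorem card_le_card_filter_avoiding {Z : Type*} [Fintype Z] {t K : ℕ} (φ : Fin t → Fin K → Z)
    (p p' : Z) : Fintype.card Z ≤
      (Finset.univ.filter fun z => z ≠ p ∧ z ≠ p' ∧ ∀ j i, φ j i ≠ z).card + t * K + 2 := by
  have h1 : (Finset.univ : Finset Z) ⊆ (Finset.univ.filter fun z => z ≠ p ∧ z ≠ p' ∧
      ∀ j i, φ j i ≠ z) ∪ Finset.univ.image (fun q : Fin t × Fin K => φ q.1 q.2) ∪ {p, p'} := by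
    intro z _
    simp only [Finset.mem_union, Finset.mem_filter, Finset.mem_univ, true_and, Finset.mem_image,
      Prod.exists, Finset.mem_insert, Finset.mem_singleton]
    by_cases h : ∃ j i, φ j i = z
    · exact Or.inl (Or.inr h)
    · push Not at h
      by_cases hp : z = p
      · exact Or.inr (Or.inl hp)
      · by_cases hp' : z = p'
        · exact Or.inr (Or.inr hp')
        · exact Or.inl (Or.inl ⟨hp, hp', h⟩)
  have h2 := Finset.card_le_card h1
  have h3 : (Finset.univ.image (fun q : Fin t × Fin K => φ q.1 q.2)).card ≤ t * K :=
    Finset.card_image_le.trans (by simp)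
  have h4 := Finset.card_le_two (a := p) (b := p')
  refine h2.trans ((Finset.card_union_le _ _).trans ?_)
  have h5 := Finset.card_union_le (Finset.univ.filter fun z => z ≠ p ∧ z ≠ p' ∧
      ∀ j i, φ j i ≠ z) (Finset.univ.image (fun q : Fin t × Fin K => φ q.1 q.2))
  omega

namespace IsSuperRegular

variable {W : Type*} {G : SimpleGraph W} {U V : Finset W} {ε d : ℝ}

theorem symm (h : IsSuperRegular G ε d U V) : IsSuperRegular G ε d V U where
  disjoint := h.disjoint.symm
  density X hX Y hY h1 h2 := by
    have := h.density Y hY X hX h2 h1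
    rw [SimpleGraph.edgeDensity_comm] at this
    convert this
  degree_left := h.degree_right
  degree_right := h.degree_left

theorem isLowerRegular (h : IsSuperRegular G ε d U V) (hε : 0 ≤ ε) :
    IsLowerRegular (fun (v : {w // w ∈ V}) (u : {w // w ∈ U}) => G.Adj u v) ε d :=
  isLowerRegular_of_density hε fun X hX Y hY h1 h2 => by
    have := h.density X hX Y hY h1 h2
    convert this

theorem isLowerRegular_symm (h : IsSuperRegular G ε d U V) (hε : 0 ≤ ε) :
    IsLowerRegular (fun (u : {w // w ∈ U}) (v : {w // w ∈ V}) => G.Adj u v) ε d := by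
  have := h.symm.isLowerRegular hε
  rwa [show (fun (u : {w // w ∈ U}) (v : {w // w ∈ V}) => G.Adj v.1 u.1) =
    fun u v => G.Adj u.1 v.1 from funext fun u => funext fun v => propext (G.adj_comm _ _)] at this

open Classical in
theorem card_filter_left (h : IsSuperRegular G ε d U V) (u : {w // w ∈ U}) :
    d * V.card ≤ ((Finset.univ.filter fun v : {w // w ∈ V} => G.Adj u v).card : ℝ) := by
  have := h.degree_left u u.2
  rw [degInto, ← card_filter_subtype_eq_ncard V (fun w => G.Adj u w)] at this
  exact this

open Classical in
theorem card_filter_right (h : IsSuperRegular G ε d U V) (v : {w // w ∈ V}) :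
    d * U.card ≤ ((Finset.univ.filter fun u : {w // w ∈ U} => G.Adj u v).card : ℝ) := by
  refine (h.symm.card_filter_left v).trans (Nat.cast_le.mpr (Finset.card_le_card fun u hu => ?_))
  rw [Finset.mem_filter] at hu ⊢
  exact ⟨hu.1, hu.2.symm⟩

end IsSuperRegular

open Classical in
theorem codegInto_eq_card_filter {W : Type*} (G : SimpleGraph W) (y y' : W) (V : Finset W) :
    codegInto G y y' V =
      (Finset.univ.filter fun v : {w // w ∈ V} => G.Adj y v ∧ G.Adj y' v).card := by
  rw [codegInto, ← card_filter_subtype_eq_ncard V (fun w => G.Adj y w ∧ G.Adj y' w)]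
  congr

open Classical in
theorem codegInto_eq_card_filter_symm {W : Type*} (G : SimpleGraph W) (x x' : W) (U : Finset W) :
    codegInto G x x' U =
      (Finset.univ.filter fun u : {w // w ∈ U} => G.Adj u x ∧ G.Adj u x').card := by
  rw [codegInto_eq_card_filter]
  simp only [G.adj_comm]

/-! ### Choice of constants and conclusion. -/

set_option maxHeartbeats 4000000 in
open Classical in
theorem lemma3p8 (d : ℝ) (hd0 : 0 < d) (hd1 : d < 1) :
    ∃ ε : ℝ, 0 < ε ∧ ∃ C : ℝ, 0 < C ∧
      ∀ η : ℝ, 0 < η → ∃ N : ℕ, ∀ n : ℕ, N ≤ n →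
        ∀ (W : Type*) (G : SimpleGraph W) (U V : Finset W) (x x' y y' : W) (p : unitInterval),
          V.card = n → (3 / 4 : ℝ) * (n : ℝ) ≤ (U.card : ℝ) → U.card ≤ n →
          IsSuperRegular G ε d U V →
          x ∈ V → x' ∈ V → x ≠ x' → y ∈ U → y' ∈ U → y ≠ y' →
          (1 / 2 : ℝ) * d ^ 2 * (n : ℝ) ≤ (codegInto G x x' U : ℝ) →
          (1 / 2 : ℝ) * d ^ 2 * (n : ℝ) ≤ (codegInto G y y' V : ℝ) →
          C / (n : ℝ) ≤ (p : ℝ) →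
          1 - η ≤ (randomPair U V p).real
            {ω | ∃ l : List W,
              IsSquareHamiltonPath (perturbedPair G U V ω.1 ω.2) (U ∪ V) x x' y y' l} := by
  obtain ⟨DV, hDV, hDV0, hDV1⟩ : ∃ D : ℝ, D = d ^ (2 * 43) ∧ 0 < D ∧ D ≤ 1 :=
    ⟨_, rfl, by positivity, pow_le_one₀ hd0.le hd1.le⟩
  obtain ⟨DU, hDU, hDU0⟩ : ∃ D : ℝ, D = d ^ (2 * 34) ∧ 0 < D := ⟨_, rfl, by positivity⟩
  obtain ⟨DE, hDE, hDE0⟩ : ∃ D : ℝ, D = (DV / 2) ^ (2 * 34) ∧ 0 < D := ⟨_, rfl, by positivity⟩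
  obtain ⟨cA, hcA, CA, hCA, hA⟩ := exists_typical_chunks (2 * 43) (by norm_num) d hd0 hd1.le
  obtain ⟨cB, hcB, CB, hCB, hB⟩ :=
    exists_matched_chunks (2 * 34) (by norm_num) d DV hd0 hd1.le hDV0 hDV1
  simp only [← hDV] at hA
  simp only [← hDU, ← hDE] at hB
  -- Here βn is the degree threshold m of all Hall matchings, and θn, introduced next, the number of
  -- spare chunks.
  obtain ⟨β, hβ, hβ1, hβ2, hβ3, hβ4, hβ5⟩ : ∃ β : ℝ, 0 < β ∧ β ≤ cA / 2 ∧ β ≤ cB / 4 ∧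
      β ≤ DE / 100 ∧ β ≤ DU / 10 ∧ β ≤ 1 / 10 :=
    ⟨min (cA / 2) (min (cB / 4) (min (DE / 100) (min (DU / 10) (1 / 10)))), by positivity, by simp,
      by simp, by simp, by simp, by simp⟩
  obtain ⟨θ, hθ, hθ1, hθ2, hθ3⟩ : ∃ θ : ℝ, 0 < θ ∧ θ ≤ cA / 2 ∧ θ ≤ cB / 4 ∧ θ ≤ 1 / 10000 :=
    ⟨min (cA / 2) (min (cB / 4) (1 / 10000)), by positivity, by simp, by simp, by simp⟩
  obtain ⟨γU, hγU, hγU1, hγU2⟩ : ∃ γ : ℝ, 0 < γ ∧ γ ≤ β / 70 ∧ γ ≤ θ / 4 :=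
    ⟨min (β / 70) (θ / 4), by positivity, by simp, by simp⟩
  -- The constants of the second round come first: the typicality αV, γV demanded of e must be fine
  -- enough for the gap relation to be regular at level εU.
  obtain ⟨εU, hεU, hB⟩ := hB β γU hβ (by linarith) hγU
  obtain ⟨αV, hαV, hαV1, hαV2⟩ : ∃ α : ℝ, 0 < α ∧ α ≤ β ∧ α ≤ εU :=
    ⟨min β εU, by positivity, by simp, by simp⟩
  obtain ⟨γV, hγV, hγV1, hγV2, hγV3⟩ : ∃ γ : ℝ, 0 < γ ∧ γ ≤ θ / 4 ∧ γ ≤ εU / 400 ∧ γ ≤ β / 50 :=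
    ⟨min (θ / 4) (min (εU / 400) (β / 50)), by positivity, by simp, by simp, by simp⟩
  obtain ⟨εV, hεV, hA⟩ := hA αV γV hαV (by linarith) hγV
  -- The factor 2 allows for |U| being smaller than n, since |U| ≥ 3n/4.
  refine ⟨min εU εV, by positivity, CA + 2 * CB, by positivity, fun η hη => ?_⟩
  obtain ⟨η', hη'0, hη'1, hη'2⟩ : ∃ η' : ℝ, 0 < η' ∧ η' ≤ 1 ∧ 2 * η' ≤ η :=
    ⟨min η 1 / 2, by positivity, by linarith [min_le_right η 1], by linarith [min_le_left η 1]⟩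
  obtain ⟨zA, hA⟩ := hA η' hη'0
  obtain ⟨zB, hB⟩ := hB η' hη'0
  obtain ⟨N, hN⟩ := exists_nat_ge (20000 + zA + 2 * zB + 10 / θ + 400 / εU + 8 / cB)
  refine ⟨N, ?_⟩
  intro n hn W G U V x x' y y' p hVn hUn hUn' hsr hx hx' hxx hy hy' hyy hcx hcy hp
  have hn0 : 20000 + zA + 2 * zB + 10 / θ + 400 / εU + 8 / cB ≤ (n : ℝ) :=
    hN.trans (Nat.cast_le.mpr hn)
  have q1 : 0 < 10 / θ := by positivity
  have q2 : 0 < 400 / εU := by positivity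
  have q3 : 0 < 8 / cB := by positivity
  have q4 : (0 : ℝ) ≤ zA := Nat.cast_nonneg _
  have q5 : (0 : ℝ) ≤ zB := Nat.cast_nonneg _
  have hn1 : (20000 : ℝ) ≤ n := by linarith
  have hn2 : (zA : ℝ) ≤ n := by linarith
  have hn3 : (zB : ℝ) ≤ U.card := by linarith
  have hn4 : 10 ≤ θ * n := by
    rw [mul_comm]; exact (div_le_iff₀ hθ).mp (by linarith)
  have hn5 : 400 ≤ εU * n := by
    rw [mul_comm]; exact (div_le_iff₀ hεU).mp (by linarith)
  have hn6 : 8 ≤ cB * n := by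
    rw [mul_comm]; exact (div_le_iff₀ hcB).mp (by linarith)
  have hUn'' : (U.card : ℝ) ≤ n := by exact_mod_cast hUn'
  have hn1' : 20000 ≤ n := by exact_mod_cast hn1
  have hUn3 : 3 * n ≤ 4 * U.card := by
    have : (3 * n : ℝ) ≤ 4 * U.card := by linarith
    exact_mod_cast this
  obtain ⟨t, ht1, ht2, r, s, hr2, hra, hs2, hsb, hcU, hcV⟩ :=
    exists_segment_lengths n U.card (by omega) hUn3 hUn'
  have ht1' : (n : ℝ) ≤ 100 * t := by exact_mod_cast ht1
  have ht2' : 100 * (t : ℝ) ≤ n + 300 := by exact_mod_cast ht2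
  have ht0 : 0 < t := by omega
  obtain ⟨q, hq1, hq2⟩ : ∃ q : ℕ, θ * n - 1 ≤ q ∧ (q : ℝ) ≤ θ * n :=
    ⟨⌊θ * n⌋₊, by linarith [Nat.lt_floor_add_one (θ * n)], Nat.floor_le (by positivity)⟩
  obtain ⟨w, hw1, hw2⟩ : ∃ w : ℕ, (U.card : ℝ) / 10000 ≤ w ∧ (w : ℝ) ≤ U.card / 10000 + 1 :=
    ⟨⌈(U.card : ℝ) / 10000⌉₊, Nat.le_ceil _, (Nat.ceil_lt_add_one (by positivity)).le⟩
  have hp1 : CA / (n : ℝ) ≤ p :=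
    (div_le_div_of_nonneg_right (by linarith) (by linarith)).trans hp
  have hp2 : CB / (U.card : ℝ) ≤ p := by
    refine le_trans ?_ hp
    rw [div_le_div_iff₀ (by linarith) (by linarith)]
    have h1 := mul_le_mul_of_nonneg_left hUn hCB.le
    have h2 : 0 < CA * U.card := mul_pos hCA (by linarith)
    have h3 : 0 < CB * n := mul_pos hCB (by linarith)
    rw [add_mul]
    linarith
  have hmul : ∀ {a b : ℝ}, a ≤ b → a * n ≤ b * n := fun h =>
    mul_le_mul_of_nonneg_right h (Nat.cast_nonneg _)
  have hmulU : ∀ {a : ℝ}, 0 ≤ a → a * U.card ≤ a * n := fun h =>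
    mul_le_mul_of_nonneg_left hUn'' h
  have b1 := hmul hβ1
  have b2 := hmul hβ2
  have b3 := hmul hβ3
  have b4 := hmul hβ4
  have b5 := hmul hβ5
  have t1 := hmul hθ1
  have t2 := hmul hθ2
  have t3 := hmul hθ3
  have g1 := (hmulU hγU.le).trans (hmul hγU1)
  have g2 := (hmulU hγU.le).trans (hmul hγU2)
  have g3 := (hmulU hαV.le).trans (hmul hαV1)
  have v1 := hmul hγV1
  have v2 := hmul hγV2
  have v3 := hmul hγV3
  have c1 := mul_le_mul_of_nonneg_left hUn hcB.le
  have c2 := mul_le_mul_of_nonneg_left ht1' hεU.le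
  have c3 := mul_le_mul_of_nonneg_left ht1' hDE0.le
  have c4 : β * t ≤ β * n := mul_le_mul_of_nonneg_left (by linarith) hβ.le
  have hβn : 0 < β * n := mul_pos hβ (by linarith)
  have hregV := (hsr.isLowerRegular (by positivity)).mono (min_le_right εU εV)
  have hregU := (hsr.isLowerRegular_symm (by positivity)).mono (min_le_left εU εV)
  have hdegU := hsr.card_filter_left
  have hdegV := hsr.card_filter_right
  rw [hVn] at hdegU
  have hdd : d ^ 2 / 2 * (U.card : ℝ) ≤ 1 / 2 * d ^ 2 * n := by
    have := mul_le_mul_of_nonneg_left hUn'' (show 0 ≤ d ^ 2 / 2 by positivity)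
    linarith
  have hdd' : d ^ 2 / 2 * (n : ℝ) ≤ 1 / 2 * d ^ 2 * n := by linarith
  rw [codegInto_eq_card_filter_symm] at hcx
  rw [codegInto_eq_card_filter] at hcy
  have hcx' := hdd.trans hcx
  have hcy' := hdd'.trans hcy
  have hkA := hA {w // w ∈ V} {w // w ∈ U} (by rw [Fintype.card_coe, hVn]; exact_mod_cast hn2)
    (by rw [Fintype.card_coe, Fintype.card_coe]; omega) (fun v u => G.Adj u v) hregV
    (by rw [Fintype.card_coe, hVn]; exact hdegU)
    (Finset.univ.filter fun v : {w // w ∈ V} => G.Adj y v ∧ G.Adj y' v)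
    (by rw [Fintype.card_coe, hVn]; exact hcy') ⟨x, hx⟩ ⟨x', hx'⟩ t q ht0
    (by rw [Fintype.card_coe, hVn]; linarith [(Nat.cast_nonneg q : (0:ℝ) ≤ q)])
    (by rw [Fintype.card_coe, hVn]; push_cast; linarith)
    (by rw [Fintype.card_coe, hVn]; linarith) (by rw [Fintype.card_coe, hVn]; linarith) p
    (by rw [Fintype.card_coe, hVn]; exact hp1)
  simp only [Fintype.card_coe, hVn] at hkA
  -- The graph on V is revealed first; for each good outcome, independence lets G(U,p) be estimated
  -- with e fixed.
  refine le_trans (show 1 - η ≤ 1 - 2 * η' by linarith) (prod_real_ge_of_slices _ _ _ _ η' hη'0.le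
    hη'1 hkA ?_)
  rintro S ⟨e, hei, he, hex, hey, he5, he6, he7⟩
  have hV₀ := card_le_card_filter_avoiding e ⟨x, hx⟩ ⟨x', hx'⟩
  rw [Fintype.card_coe, hVn] at hV₀
  -- The chunks e occupy 86t vertices, about 0.86n, so a linear part of V stays free for insertion
  -- into the chunks of f.
  have hV₀' : (n : ℝ) / 10 ≤ ((Finset.univ.filter fun v : {w // w ∈ V} =>
      v ≠ ⟨x, hx⟩ ∧ v ≠ ⟨x', hx'⟩ ∧ ∀ j i, e j i ≠ v).card : ℝ) := by
    have : (n : ℝ) ≤ ((Finset.univ.filter fun v : {w // w ∈ V} =>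
      v ≠ ⟨x, hx⟩ ∧ v ≠ ⟨x', hx'⟩ ∧ ∀ j i, e j i ≠ v).card : ℝ) + t * (2 * 43) + 2 := by
      exact_mod_cast hV₀
    linarith
  have hkB := hB {w // w ∈ U} {w // w ∈ V} (by rw [Fintype.card_coe]; exact_mod_cast hn3)
    (by rw [Fintype.card_coe, Fintype.card_coe]; omega) (fun u v => G.Adj u v) hregU
    (by rw [Fintype.card_coe]; exact hdegV) ⟨x, hx⟩ ⟨x', hx'⟩
    (by rw [Fintype.card_coe]; exact hcx') ⟨y, hy⟩ ⟨y', hy'⟩ t q w (2 * 43) ht0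
    (by rw [Fintype.card_coe]; omega) (by rw [Fintype.card_coe]; linarith)
    (by rw [Fintype.card_coe]; exact hw1)
    (by rw [Fintype.card_coe]; push_cast; linarith) e
    (by rw [Fintype.card_coe]; exact he5) αV (γV * n) (by rw [Fintype.card_coe]; exact he7) hαV2
    (by linarith) (by rw [Fintype.card_coe]; linarith) (β * n) 34 (by positivity) (by norm_num)
    (by rw [Fintype.card_coe]; linarith) (by linarith) (by linarith)
    (by rw [Fintype.card_coe, hVn]) (by rw [Fintype.card_coe]; linarith)
    (by rw [Fintype.card_coe]; linarith)
    (by rw [Fintype.card_coe, hVn]; exact le_trans (b := (n : ℝ) / 10) (by linarith) (hV₀'.trans (le_of_eq (by congr!))))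
    ((show β * n ≤ DU * (n / 10) by linarith).trans
      (mul_le_mul_of_nonneg_left (hV₀'.trans (le_of_eq (by congr!))) hDU0.le)) p (by rw [Fintype.card_coe]; exact hp2)
  refine hkB.trans (MeasureTheory.measureReal_mono ?_ (MeasureTheory.measure_ne_top _ _))
  rintro R ⟨f, hfi, hf, hfy, hgap, hf4, hf5, hf6, hf7⟩
  refine exists_isSquareHamiltonPath_of_robust (x := ⟨x, hx⟩) (x' := ⟨x', hx'⟩) (y := ⟨y, hy⟩)
    (y' := ⟨y', hy'⟩) hsr.disjoint (fun h => hxx (congrArg Subtype.val h))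
    (fun h => hyy (congrArg Subtype.val h)) ht0 r s hr2 hra hs2 hsb hcU (hVn.trans hcV) e f hei hfi
    he hf hex hfy ?_ ?_ ?_ (fun j hj i => by simpa using hey j hj i) (β * n) ?_ hf4 (fun j => by convert hf7 j) (fun j => by convert hf5 j) ?_ hf6
  · intro j i i' hi
    have := hgap j i
    rw [GapRel, if_neg (by omega)] at this
    exact this i'
  · intro j j' hj i i' hi
    have := hgap j' i
    rw [GapRel, if_pos hi] at this
    exact this.2 j hj i'
  · intro j hj i hi
    have := hgap j i
    rw [GapRel, if_pos hi] at this
    exact this.1 hj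
  · exact fun u => le_trans (by linarith) (he6 u)
  · intro D J hD hJ
    have h7 := he7 D (by linarith)
    refine exists_related_of_few_bad (fun (u : {w // w ∈ U}) j => ∀ i, G.Adj u (e j i))
      (d := DV) (B := γV * n) hDV0 D J ?_ ?_ (by convert h7)
    · exact_mod_cast hβn.trans_le hD
    · push_cast at hJ
      linarith
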